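/- Let $p_n$ denote the $n$-th prime, and let $\varpi(n)=\log n$ if $n$ is prime and $\varpi(n)=0$ otherwise. For real $x>0$, an integer $q\ge 1$ and an integer $a$ with $(a,q)=1$, define $E(x;q,a)$ by $$\sum_{\substack{x<n\le 2x\\ n\equiv a\ (\mathrm{mod}\ q)}}\varpi(n)=\frac{x}{\phi(q)}+E(x;q,a),$$ where $\phi$ is Euler's function, and put $$E(x,q)=\max_{(a,q)=1}|E(x;q,a)|,\qquad E^*(N,q)=\sup_{0<x\le N}E(x,q).$$ For $1/2<\theta\le 1$, Hypothesis $BV(\theta)$ is the assertion that for all $A>0$ and $\epsilon>0$, $$\sum_{1\le q\le N^{\theta-\epsilon}}E^*(N,q)\ll_{A,\epsilon}N(\log N)^{-A}\qquad(N\to\infty).$$ **Theorem.** If Hypothesis $BV(\theta)$ is true for some $\theta$ with $1/2<\theta\le 1$, then $$\liminf_{n\to\infty}(p_{n+1}-p_n)<\infty.$$ If Hypothesis $BV(\theta)$ is true for some $\theta$ with $4(8-\sqrt{19})/15<\theta\le 1$ (where $4(8-\sqrt{19})/15=0.97096\ldots$), then $$\liminf_{n\to\infty}(p_{n+1}-p_n)\le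 16.$$ -/

import Mathlib

open Filter Asymptotics

namespace PrimeGaps

/-- The weight `ϖ(n)`: `log n` if `n` is prime, and `0` otherwise. -/
noncomputable def varpi (n : ℕ) : ℝ :=
  if n.Prime then Real.log n else 0

/-- The error term `E(x; q, a)`, defined by
`∑_{x < n ≤ 2x, n ≡ a (mod q)} ϖ(n) = x / φ(q) + E(x; q, a)`, for real `x > 0`. -/
noncomputable def errorTerm (x : ℝ) (q : ℕ) (a : ZMod q) : ℝ :=
  (∑ n ∈ (Finset.Ioc ⌊x⌋₊ ⌊2 * x⌋₊).filter (fun n : ℕ => (n : ZMod q) = a), varpi n)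
    - x / (Nat.totient q : ℝ)

/-- `E(x, q)`: the maximum of `|E(x; q, a)|` over the reduced residue classes `a` modulo `q`
(a finite, non-empty set). -/
noncomputable def maxError (x : ℝ) (q : ℕ) : ℝ :=
  ⨆ a : (ZMod q)ˣ, |errorTerm x q (a : ZMod q)|

/-- `E*(N, q)`: the supremum of `E(x, q)` over real `0 < x ≤ N`. It is a supremum of a
bounded set, by `bddAbove_maxError`. -/
noncomputable def maxErrorStar (N : ℝ) (q : ℕ) : ℝ :=
  sSup ((fun x : ℝ => maxError x q) '' Set.Ioc 0 N)

/-- Level of distribution `θ`: for all `A > 0` and `ε > 0`,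
`∑_{1 ≤ q ≤ N^(θ-ε)} E*(N, q) = O_{A,ε}(N (log N)^(-A))` as the real variable `N → ∞`. -/
def HypothesisBV (θ : ℝ) : Prop :=
  ∀ A : ℝ, 0 < A → ∀ ε : ℝ, 0 < ε →
    (fun N : ℝ => ∑ q ∈ Finset.Icc 1 ⌊N ^ (θ - ε)⌋₊, maxErrorStar N q)
      =O[atTop] (fun N : ℝ => N * Real.log N ^ (-A))

/-- The gap `p_{n+1} - p_n` between consecutive primes (indexed from `p_0 = 2`), as an
extended real number. -/
noncomputable def primeGap (n : ℕ) : EReal :=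
  (((Nat.nth Nat.Prime (n + 1) : ℝ) - (Nat.nth Nat.Prime n : ℝ) : ℝ) : EReal)

theorem varpi_nonneg (n : ℕ) : 0 ≤ varpi n := by
  unfold varpi
  split_ifs
  · exact Real.log_natCast_nonneg n
  · exact le_rfl

/-- The set whose supremum is `E*(N, q)` is bounded. -/
theorem bddAbove_maxError (N : ℝ) (q : ℕ) :
    BddAbove ((fun x : ℝ => maxError x q) '' Set.Ioc 0 N) := by
  refine ⟨(∑ n ∈ Finset.Ioc 0 ⌊2 * N⌋₊, varpi n) + N / (Nat.totient q : ℝ), ?_⟩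
  rintro _ ⟨x, ⟨hx0, hxN⟩, rfl⟩
  refine ciSup_le fun a => ?_
  have h1 : (∑ n ∈ (Finset.Ioc ⌊x⌋₊ ⌊2 * x⌋₊).filter
      (fun n : ℕ => (n : ZMod q) = (a : ZMod q)), varpi n)
      ≤ ∑ n ∈ Finset.Ioc 0 ⌊2 * N⌋₊, varpi n := by
    refine Finset.sum_le_sum_of_subset_of_nonneg ?_ (fun n _ _ => varpi_nonneg n)
    refine (Finset.filter_subset _ _).trans (Finset.Ioc_subset_Ioc (Nat.zero_le _) ?_)
    exact Nat.floor_mono (by linarith)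
  have h0 : 0 ≤ ∑ n ∈ (Finset.Ioc ⌊x⌋₊ ⌊2 * x⌋₊).filter
      (fun n : ℕ => (n : ZMod q) = (a : ZMod q)), varpi n :=
    Finset.sum_nonneg fun n _ => varpi_nonneg n
  have h2 : x / (Nat.totient q : ℝ) ≤ N / (Nat.totient q : ℝ) := by gcongr
  have h3 : 0 ≤ x / (Nat.totient q : ℝ) := by positivity
  unfold errorTerm
  rw [abs_le]
  constructor <;> linarith

end PrimeGaps

/-! This is the Goldston–Pintz–Yıldırım argument. Fix an admissible tuple `H` of `k` shifts and put
`W = D!`. If no `n > N` has two primes among the `n + m`, `m ∈ H`, then `∑_{m ∈ H} varpi (n + m) ≤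
log (3N)` for all `n` in `(N, 2N]`. Averaging this against a nonnegative weight `Λ(n)²` over those
`n` in a class mod `W` coprime to all small primes on every shift gives an inequality between two
sieve sums. A good choice of `Λ` makes it false for large `N`.

Take `Λ(n) = ∑ λ_s` over the sets `s` of primes in `(D, X]` each dividing some `n + m`; sets of
primes play the role of squarefree integers, and `λ` lives on products up to `R = N^η` with `2η <
θ`. Expanding the square turns the sum over `n` into the quadratic form of `p ↦ k/p`, and the sum
over primes `n + m` into that of `p ↦ (k-1)/(p-1)`. The remainders involve moduli up to `W R²`,
which the level of distribution controls (`sieve_inequality`).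

Selberg's diagonalisation evaluates both forms (`quadForm_selbergWeight`). If the diagonal variables
are `y_r = F(log (R/r))` with `F` a polynomial with nonnegative coefficients, the first form is a
`k`-dimensional sum of `F²`. The second is a `(k-1)`-dimensional sum of squares of one-dimensional
sums of `F`, which behave like the antiderivative of `F`. Positivity means that only an upper bound
for the first (`quadForm_upper_le`) and a lower bound for the second (`le_quadForm_lower`) are
needed. Both reduce to elementary one-dimensional estimates for sums of `1/m`, raised to higher
dimension by induction (`sieveSum_le_of_dim_one`, `le_sieveSum_of_dim_one`) and to polynomial
weights by integration.

Letting `N → ∞` and then `D → ∞` leaves the criterion `upperConst < k (θ/2) lowerConst` of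
`exists_prime_pair`. For `θ > 1/2` it holds with `F` a monomial of high degree and `k` large; a
linear `F` with `k = 6` gives the explicit threshold and the tuple of diameter 16. -/

namespace PrimeGaps

/-! ### Selberg's diagonalisation over finite sets -/

section Combinatorics

variable {α : Type*} [DecidableEq α]

theorem sum_powerset_split (P : Finset α) (φ : Finset α → Finset α → ℝ) :
    ∑ s ∈ P.powerset, ∑ t ∈ s.powerset, φ t (s \ t) =
      ∑ t ∈ P.powerset, ∑ v ∈ (P \ t).powerset, φ t v := by
  rw [Finset.sum_sigma', Finset.sum_sigma']
  refine Finset.sum_nbij' (fun x => ⟨x.2, x.1 \ x.2⟩) (fun x => ⟨x.1 ∪ x.2, x.1⟩) ?_ ?_ ?_ ?_ ?_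
  · rintro ⟨s, t⟩ h
    simp only [Finset.mem_sigma, Finset.mem_powerset] at h ⊢
    exact ⟨h.2.trans h.1, Finset.sdiff_subset_sdiff h.1 le_rfl⟩
  · rintro ⟨t, v⟩ h
    simp only [Finset.mem_sigma, Finset.mem_powerset] at h ⊢
    exact ⟨Finset.union_subset h.1 (h.2.trans Finset.sdiff_subset), Finset.subset_union_left⟩
  · rintro ⟨s, t⟩ h
    simp only [Finset.mem_sigma, Finset.mem_powerset] at h ⊢
    simp [Finset.union_sdiff_of_subset h.2]
  · rintro ⟨t, v⟩ h
    simp only [Finset.mem_sigma, Finset.mem_powerset] at h ⊢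
    have hd : Disjoint t v := (Finset.disjoint_sdiff.mono_right h.2)
    simp [Finset.union_sdiff_cancel_left hd]
  · rintro ⟨s, t⟩ h
    rfl

theorem sum_superset_eq (P r : Finset α) (hr : r ⊆ P) (φ : Finset α → ℝ) :
    ∑ s ∈ P.powerset with r ⊆ s, φ s = ∑ w ∈ (P \ r).powerset, φ (r ∪ w) := by
  refine Finset.sum_nbij' (fun s => s \ r) (fun w => r ∪ w) ?_ ?_ ?_ ?_ ?_
  · intro s h
    simp only [Finset.mem_filter, Finset.mem_powerset] at h ⊢
    exact Finset.sdiff_subset_sdiff h.1 le_rfl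
  · intro w h
    simp only [Finset.mem_filter, Finset.mem_powerset] at h ⊢
    exact ⟨Finset.union_subset hr (h.trans Finset.sdiff_subset), Finset.subset_union_left⟩
  · intro s h
    simp only [Finset.mem_filter, Finset.mem_powerset] at h
    exact Finset.union_sdiff_of_subset h.2
  · intro w h
    simp only [Finset.mem_powerset] at h
    exact Finset.union_sdiff_cancel_left (Finset.disjoint_sdiff.mono_right h)
  · intro s h
    simp only [Finset.mem_filter, Finset.mem_powerset] at h
    rw [Finset.union_sdiff_of_subset h.2]

theorem prod_add_split (s : Finset α) (f g : α → ℝ) :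
    ∏ p ∈ s, (f p + g p) = ∑ t ∈ s.powerset, (∏ p ∈ t, f p) * ∏ p ∈ s \ t, g p :=
  Finset.prod_add f g s

/-- The quadratic form attached to a multiplicative function. -/
noncomputable def quadForm (P : Finset α) (lam : Finset α → ℝ) (f : α → ℝ) : ℝ :=
  ∑ s ∈ P.powerset, ∑ t ∈ P.powerset, lam s * lam t * ∏ p ∈ s ∪ t, f p

/-- Selberg's weights, parametrised by the diagonalising variables `y`. -/
noncomputable def selbergWeight (P : Finset α) (f : α → ℝ) (y : Finset α → ℝ) (s : Finset α) : ℝ :=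
  (∏ p ∈ s, (-(f p)⁻¹)) * ∑ v ∈ (P \ s).powerset, y (s ∪ v) * ∏ p ∈ s ∪ v, ((f p)⁻¹ - 1)⁻¹

/-- The product over `s ∪ t` is the product over `s` times that over `t`, divided by that over `s ∩
t`. Writing `1/f = 1 + (1/f - 1)` expands the reciprocal over subsets `r ⊆ s ∩ t`, and this
separates `s` from `t`. -/
theorem quadForm_eq_sum_sq (P : Finset α) (lam : Finset α → ℝ) (f : α → ℝ)
    (hf : ∀ p ∈ P, f p ≠ 0) :
    quadForm P lam f = ∑ r ∈ P.powerset, (∏ p ∈ r, ((f p)⁻¹ - 1)) *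
      (∑ s ∈ P.powerset with r ⊆ s, lam s * ∏ p ∈ s, f p) ^ 2 := by
  have key : ∀ s ∈ P.powerset, ∀ t ∈ P.powerset, lam s * lam t * ∏ p ∈ s ∪ t, f p =
      ∑ r ∈ P.powerset, (∏ p ∈ r, ((f p)⁻¹ - 1)) *
        ((if r ⊆ s then lam s * ∏ p ∈ s, f p else 0) *
          (if r ⊆ t then lam t * ∏ p ∈ t, f p else 0)) := by
    intro s hs t ht
    rw [Finset.mem_powerset] at hs ht
    have h1 : (∏ p ∈ s ∪ t, f p) = (∏ p ∈ s, f p) * (∏ p ∈ t, f p) * ∏ p ∈ s ∩ t, (f p)⁻¹ := by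
      have h0 : (∏ p ∈ s ∩ t, f p) * ∏ p ∈ s ∩ t, (f p)⁻¹ = 1 := by
        rw [← Finset.prod_mul_distrib]
        exact Finset.prod_eq_one fun p hp =>
          mul_inv_cancel₀ (hf p (hs (Finset.mem_inter.1 hp).1))
      rw [← Finset.prod_union_inter, mul_assoc, h0, mul_one]
    have h2 : ∏ p ∈ s ∩ t, (f p)⁻¹ = ∑ r ∈ P.powerset with r ⊆ s ∩ t, ∏ p ∈ r, ((f p)⁻¹ - 1) := by
      have : P.powerset.filter (fun r => r ⊆ s ∩ t) = (s ∩ t).powerset := by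
        ext r
        simp only [Finset.mem_filter, Finset.mem_powerset]
        exact ⟨fun h => h.2, fun h => ⟨(h.trans Finset.inter_subset_left).trans hs, h⟩⟩
      rw [this, ← Finset.prod_add_one]
      simp
    rw [h1, h2, Finset.sum_filter, Finset.mul_sum, Finset.mul_sum]
    refine Finset.sum_congr rfl fun r _ => ?_
    by_cases h3 : r ⊆ s <;> by_cases h4 : r ⊆ t <;> simp [h3, h4, Finset.subset_inter_iff]
    ring
  unfold quadForm
  rw [Finset.sum_congr rfl fun s hs => Finset.sum_congr rfl fun t ht => key s hs t ht]
  rw [Finset.sum_congr rfl fun s _ => Finset.sum_comm, Finset.sum_comm]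
  refine Finset.sum_congr rfl fun r _ => ?_
  rw [Finset.sum_filter, sq, Finset.sum_mul_sum, Finset.mul_sum]
  refine Finset.sum_congr rfl fun s _ => ?_
  rw [Finset.mul_sum]

/-- The weights are adapted to `f`, but the diagonal variables are needed for a second function `g`.
Collecting terms with the same union, the sum over subsets of `-g/f` becomes `∏ (1 - g/f)`. For `g =
f` only `v = ∅` survives, which is Möbius inversion. -/
theorem sum_superset_selbergWeight (P r : Finset α) (hr : r ⊆ P) (f g : α → ℝ)
    (y : Finset α → ℝ) :
    ∑ s ∈ P.powerset with r ⊆ s, selbergWeight P f y s * ∏ p ∈ s, g p =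
      (∏ p ∈ r, (-(g p / f p) * ((f p)⁻¹ - 1)⁻¹)) * ∑ v ∈ (P \ r).powerset,
        y (r ∪ v) * ∏ p ∈ v, ((1 - g p / f p) * ((f p)⁻¹ - 1)⁻¹) := by
  rw [sum_superset_eq P r hr]
  unfold selbergWeight
  have key : ∀ w ∈ (P \ r).powerset, (∏ p ∈ r ∪ w, (-(f p)⁻¹)) *
      (∑ v ∈ (P \ (r ∪ w)).powerset, y (r ∪ w ∪ v) * ∏ p ∈ r ∪ w ∪ v, ((f p)⁻¹ - 1)⁻¹) *
        ∏ p ∈ r ∪ w, g p =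
      ∑ v ∈ ((P \ r) \ w).powerset, (∏ p ∈ r, (-(g p / f p))) *
        ((∏ p ∈ w, (-(g p / f p))) * (y (r ∪ (w ∪ v)) *
          ((∏ p ∈ r, ((f p)⁻¹ - 1)⁻¹) * ∏ p ∈ w ∪ v, ((f p)⁻¹ - 1)⁻¹))) := by
    intro w hw
    rw [Finset.mem_powerset] at hw
    rw [Finset.mul_sum, Finset.sum_mul, sdiff_sdiff_left]
    refine Finset.sum_congr rfl fun v hv => ?_
    rw [Finset.mem_powerset] at hv
    have hd : Disjoint r w := Finset.disjoint_sdiff.mono_right hw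
    have hd2 : Disjoint (r ∪ w) v := Finset.disjoint_sdiff.mono_right hv
    have hd3 : Disjoint r (w ∪ v) := Finset.disjoint_union_right.2
      ⟨hd, (Finset.disjoint_union_left.1 hd2).1⟩
    rw [← Finset.union_assoc r w v, ← Finset.prod_union hd3, ← Finset.union_assoc]
    have e : ∀ s : Finset α, ∏ p ∈ s, (-(g p / f p)) = (∏ p ∈ s, (-(f p)⁻¹)) * ∏ p ∈ s, g p := by
      intro s
      rw [← Finset.prod_mul_distrib]
      exact Finset.prod_congr rfl fun p _ => by rw [div_eq_mul_inv]; ring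
    rw [Finset.prod_union hd, Finset.prod_union hd, e, e]
    ring
  rw [Finset.sum_congr rfl key, ← sum_powerset_split (P \ r) (fun w v =>
    (∏ p ∈ r, (-(g p / f p))) * ((∏ p ∈ w, (-(g p / f p))) * (y (r ∪ (w ∪ v)) *
          ((∏ p ∈ r, ((f p)⁻¹ - 1)⁻¹) * ∏ p ∈ w ∪ v, ((f p)⁻¹ - 1)⁻¹)))), Finset.mul_sum]
  refine Finset.sum_congr rfl fun u _ => ?_
  have h1 : ∏ p ∈ u, (1 - g p / f p) = ∑ w ∈ u.powerset, ∏ p ∈ w, (-(g p / f p)) := by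
    rw [← Finset.prod_add_one]
    exact Finset.prod_congr rfl fun p _ => by ring
  rw [Finset.prod_mul_distrib, Finset.prod_mul_distrib, h1, Finset.sum_mul, Finset.mul_sum,
    Finset.mul_sum]
  refine Finset.sum_congr rfl fun w hw => ?_
  rw [Finset.union_sdiff_of_subset (Finset.mem_powerset.1 hw)]
  ring

theorem quadForm_selbergWeight (P : Finset α) (f g : α → ℝ) (y : Finset α → ℝ)
    (hg : ∀ p ∈ P, g p ≠ 0) :
    quadForm P (selbergWeight P f y) g = ∑ r ∈ P.powerset,
      (∏ p ∈ r, (((g p)⁻¹ - 1) * ((g p / f p) * ((f p)⁻¹ - 1)⁻¹) ^ 2)) *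
      (∑ v ∈ (P \ r).powerset,
        y (r ∪ v) * ∏ p ∈ v, ((1 - g p / f p) * ((f p)⁻¹ - 1)⁻¹)) ^ 2 := by
  rw [quadForm_eq_sum_sq P _ g hg]
  refine Finset.sum_congr rfl fun r hr => ?_
  rw [sum_superset_selbergWeight P r (Finset.mem_powerset.1 hr), mul_pow, ← mul_assoc,
    ← Finset.prod_pow, ← Finset.prod_mul_distrib]
  congr 1
  exact Finset.prod_congr rfl fun p _ => by ring

end Combinatorics

/-! ### Truncated powers and their integrals -/

/-- The truncated monomial `u ^ j / j!`, extended by zero to negative `u`. -/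
noncomputable def truncPow (j : ℕ) (u : ℝ) : ℝ :=
  if 0 ≤ u then u ^ j / (j.factorial : ℝ) else 0

theorem truncPow_of_nonneg (j : ℕ) {u : ℝ} (hu : 0 ≤ u) :
    truncPow j u = u ^ j / (j.factorial : ℝ) := if_pos hu

theorem truncPow_of_neg (j : ℕ) {u : ℝ} (hu : u < 0) : truncPow j u = 0 :=
  if_neg (not_le.2 hu)

theorem truncPow_nonneg (j : ℕ) (u : ℝ) : 0 ≤ truncPow j u := by
  unfold truncPow
  split_ifs <;> positivity

theorem truncPow_mono (j : ℕ) : Monotone (truncPow j) := by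
  intro a b hab
  rcases lt_or_ge a 0 with ha | ha
  · rw [truncPow_of_neg j ha]
    exact truncPow_nonneg j b
  · rw [truncPow_of_nonneg j ha, truncPow_of_nonneg j (ha.trans hab)]
    gcongr

theorem truncPow_mul (i j : ℕ) (u : ℝ) :
    truncPow i u * truncPow j u = ((i + j).choose i : ℝ) * truncPow (i + j) u := by
  rcases lt_or_ge u 0 with h | h
  · simp [truncPow_of_neg _ h]
  · rw [truncPow_of_nonneg _ h, truncPow_of_nonneg _ h, truncPow_of_nonneg _ h, pow_add]
    have h1 := Nat.add_choose_mul_factorial_mul_factorial i j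
    rw [← Nat.choose_symm_add] at h1
    have h2 : ((i + j).choose i : ℝ) * (i.factorial : ℝ) * (j.factorial : ℝ) =
        ((i + j).factorial : ℝ) := by exact_mod_cast h1
    have := Nat.factorial_ne_zero i
    have := Nat.factorial_ne_zero j
    have := Nat.factorial_ne_zero (i + j)
    rw [← h2]
    have h3 : ((i + j).choose i : ℝ) ≠ 0 := by
      have := (Nat.choose_pos (Nat.le_add_right i j)).ne'
      exact_mod_cast this
    field_simp

theorem intervalIntegrable_truncPow (j : ℕ) (t a b : ℝ) :
    IntervalIntegrable (fun v => truncPow j (v - t)) MeasureTheory.volume a b :=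
  Monotone.intervalIntegrable fun x y h => truncPow_mono j (by linarith)

theorem intervalIntegrable_sum_truncPow {ι : Type*} (S : Finset ι) (w t : ι → ℝ) (j : ℕ) (a b : ℝ) :
    IntervalIntegrable (fun v => ∑ i ∈ S, w i * truncPow j (v - t i)) MeasureTheory.volume a b := by
  have := IntervalIntegrable.sum (f := fun i v => w i * truncPow j (v - t i)) S
    fun i _ => (intervalIntegrable_truncPow j (t i) a b).const_mul (w i)
  rwa [Finset.sum_fn] at this

theorem integral_truncPow (j : ℕ) {a t u : ℝ} (ha : a ≤ t) (hu : a ≤ u) :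
    ∫ v in a..u, truncPow j (v - t) = truncPow (j + 1) (u - t) := by
  have hz : ∀ b, a ≤ b → b ≤ t → ∫ v in a..b, truncPow j (v - t) = 0 := by
    intro b hab hbt
    -- Only almost everywhere: for `j = 0` the integrand is `1` at `v = t`.
    rw [intervalIntegral.integral_congr_ae (g := fun _ => (0 : ℝ))]
    · simp
    · have : ∀ᵐ v : ℝ ∂MeasureTheory.volume, v ≠ t :=
        MeasureTheory.Measure.ae_ne MeasureTheory.volume t
      filter_upwards [this] with v hv hmem
      rw [Set.uIoc_of_le hab] at hmem
      exact truncPow_of_neg j (by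
        have := lt_of_le_of_ne (hmem.2.trans hbt) hv
        linarith)
  rcases le_or_gt u t with h | h
  · rw [hz u hu h]
    rcases h.lt_or_eq with h | h
    · rw [truncPow_of_neg _ (by linarith)]
    · rw [h, sub_self, truncPow_of_nonneg _ le_rfl]
      simp
  · rw [← intervalIntegral.integral_add_adjacent_intervals
      (intervalIntegrable_truncPow j t a t) (intervalIntegrable_truncPow j t t u), hz t ha le_rfl,
      zero_add, truncPow_of_nonneg _ (by linarith)]
    have : ∫ v in t..u, truncPow j (v - t) = ∫ v in t..u, (v - t) ^ j / (j.factorial : ℝ) := by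
      refine intervalIntegral.integral_congr fun v hv => ?_
      rw [Set.uIcc_of_le h.le] at hv
      exact truncPow_of_nonneg j (by linarith [hv.1])
    rw [this, intervalIntegral.integral_comp_sub_right (fun x => x ^ j / (j.factorial : ℝ)),
      intervalIntegral.integral_div, integral_pow, Nat.factorial_succ]
    have := Nat.factorial_ne_zero j
    push_cast
    simp only [sub_self]
    field_simp
    simp

/-- A lower bound for the counting function of a discrete measure propagates to all truncated
powers. -/
theorem le_sum_truncPow {ι : Type*} (S : Finset ι) (a t : ι → ℝ) (ht : ∀ i ∈ S, 0 ≤ t i) (c U : ℝ)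
    (h : ∀ u, 0 ≤ u → u ≤ U → c * truncPow 1 u ≤ ∑ i ∈ S, a i * truncPow 0 (u - t i)) (j : ℕ) :
    ∀ u, 0 ≤ u → u ≤ U → c * truncPow (j + 1) u ≤ ∑ i ∈ S, a i * truncPow j (u - t i) := by
  induction j with
  | zero => exact h
  | succ j ih =>
    intro u hu huU
    -- Each truncated power is the integral of the preceding one, so the bound for exponent `j` is
    -- integrated from `0` to `u`.
    have h1 : ∑ i ∈ S, a i * truncPow (j + 1) (u - t i) =
        ∫ v in (0 : ℝ)..u, ∑ i ∈ S, a i * truncPow j (v - t i) := by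
      rw [intervalIntegral.integral_finsetSum]
      · refine Finset.sum_congr rfl fun i hi => ?_
        rw [intervalIntegral.integral_const_mul, integral_truncPow j (ht i hi) hu]
      · exact fun i _ => (intervalIntegrable_truncPow j (t i) 0 u).const_mul _
    have h2 : c * truncPow (j + 1 + 1) u = ∫ v in (0 : ℝ)..u, c * truncPow (j + 1) v := by
      have := integral_truncPow (j + 1) (le_refl (0 : ℝ)) hu
      simp only [sub_zero] at this
      rw [intervalIntegral.integral_const_mul, this]
    rw [h1, h2]
    refine intervalIntegral.integral_mono_on hu ?_ ?_ fun v hv => ih v hv.1 (hv.2.trans huU)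
    · have := (intervalIntegrable_truncPow (j + 1) 0 0 u).const_mul c
      simpa using this
    · exact intervalIntegrable_sum_truncPow S a t j 0 u

/-- An upper bound for the counting function of a discrete measure propagates to all truncated
powers. -/
theorem sum_truncPow_le {ι : Type*} (S : Finset ι) (a t : ι → ℝ) (ht : ∀ i ∈ S, 0 ≤ t i)
    (c C : ℝ) (hc : 0 ≤ c) (hC : 0 ≤ C)
    (h : ∀ u, 0 ≤ u → ∑ i ∈ S, a i * truncPow 0 (u - t i) ≤ c * truncPow 1 (u + C)) (j : ℕ) :
    ∀ u, ∑ i ∈ S, a i * truncPow j (u - t i) ≤ c * truncPow (j + 1) (u + C) := by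
  have hneg : ∀ j, ∀ u < 0, ∑ i ∈ S, a i * truncPow j (u - t i) = 0 := fun j u hu =>
    Finset.sum_eq_zero fun i hi => by
      rw [truncPow_of_neg j (by linarith [ht i hi]), mul_zero]
  induction j with
  | zero =>
    intro u
    rcases lt_or_ge u 0 with hu | hu
    · rw [hneg 0 u hu]
      exact mul_nonneg hc (truncPow_nonneg _ _)
    · exact h u hu
  | succ j ih =>
    intro u
    rcases lt_or_ge u 0 with hu | hu
    · rw [hneg _ u hu]
      exact mul_nonneg hc (truncPow_nonneg _ _)
    have hCu : -C ≤ u := by linarith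
    -- Integration starts at `-C`, where the shifted majorant begins, so that its integral is again
    -- a pure truncated power.
    have h1 : ∑ i ∈ S, a i * truncPow (j + 1) (u - t i) =
        ∫ v in (-C)..u, ∑ i ∈ S, a i * truncPow j (v - t i) := by
      rw [intervalIntegral.integral_finsetSum]
      · refine Finset.sum_congr rfl fun i hi => ?_
        rw [intervalIntegral.integral_const_mul,
          integral_truncPow j (by linarith [ht i hi]) hCu]
      · exact fun i _ => (intervalIntegrable_truncPow j (t i) _ u).const_mul _
    have h2 : c * truncPow (j + 1 + 1) (u + C) = ∫ v in (-C)..u, c * truncPow (j + 1) (v + C) := by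
      have := integral_truncPow (j + 1) (le_refl (-C)) hCu
      simp only [sub_neg_eq_add] at this
      rw [intervalIntegral.integral_const_mul, this]
    rw [h1, h2]
    refine intervalIntegral.integral_mono_on hCu ?_ ?_ fun v _ => ih v
    · exact intervalIntegrable_sum_truncPow S a t j _ u
    · have := (intervalIntegrable_truncPow (j + 1) (-C) (-C) u).const_mul c
      simpa using this

theorem sum_le_sum_of_injOn_map {ι κ : Type*} [DecidableEq κ] {A : Finset ι} {B : Finset κ}
    {f : ι → ℝ} {g : κ → ℝ} (e : ι → κ) (he : ∀ i ∈ A, e i ∈ B)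
    (hinj : Set.InjOn e (A : Set ι)) (hfg : ∀ i ∈ A, f i ≤ g (e i)) (hg : ∀ j ∈ B, 0 ≤ g j) :
    ∑ i ∈ A, f i ≤ ∑ j ∈ B, g j :=
  calc ∑ i ∈ A, f i ≤ ∑ i ∈ A, g (e i) := Finset.sum_le_sum hfg
    _ = ∑ j ∈ A.image e, g j := (Finset.sum_image hinj).symm
    _ ≤ ∑ j ∈ B, g j := Finset.sum_le_sum_of_subset_of_nonneg
        (Finset.image_subset_iff.2 he) fun j hj _ => hg j hj

/-! ### Sums over sets of primes and induction on the dimension -/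

/-- The primes `p` with `D < p ≤ X`. -/
def primesIoc (D X : ℕ) : Finset ℕ := (Finset.Ioc D X).filter Nat.Prime

theorem mem_primesIoc {D X p : ℕ} : p ∈ primesIoc D X ↔ (D < p ∧ p ≤ X) ∧ p.Prime := by
  simp [primesIoc]

/-- The logarithm of the product of the elements of `s`. -/
noncomputable def logProd (s : Finset ℕ) : ℝ := ∑ p ∈ s, Real.log (p : ℝ)

theorem logProd_union {s t : Finset ℕ} (h : Disjoint s t) :
    logProd (s ∪ t) = logProd s + logProd t := Finset.sum_union h

theorem logProd_nonneg (s : Finset ℕ) : 0 ≤ logProd s :=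
  Finset.sum_nonneg fun p _ => Real.log_natCast_nonneg p

theorem logProd_eq {s : Finset ℕ} (h : ∀ p ∈ s, p.Prime) :
    logProd s = Real.log ((∏ p ∈ s, p : ℕ) : ℝ) := by
  rw [logProd, Nat.cast_prod, Real.log_prod]
  exact fun p hp => by exact_mod_cast (h p hp).ne_zero

theorem prod_pos_of_prime {s : Finset ℕ} (h : ∀ p ∈ s, p.Prime) : 0 < ∏ p ∈ s, p :=
  Finset.prod_pos fun p hp => (h p hp).pos

theorem logProd_le_iff {s : Finset ℕ} (h : ∀ p ∈ s, p.Prime) (u : ℝ) :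
    logProd s ≤ u ↔ ((∏ p ∈ s, p : ℕ) : ℝ) ≤ Real.exp u := by
  rw [logProd_eq h, Real.log_le_iff_le_exp]
  exact_mod_cast prod_pos_of_prime h

theorem prod_injOn_primes (P : Finset ℕ) (hP : ∀ p ∈ P, p.Prime) :
    Set.InjOn (fun s : Finset ℕ => ∏ p ∈ s, p) (P.powerset : Set (Finset ℕ)) := by
  intro s hs t ht h
  simp only [Finset.coe_powerset, Set.mem_preimage, Set.mem_powerset_iff, Finset.coe_subset] at hs ht
  rw [← Nat.primeFactors_prod fun p hp => hP p (hs hp),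
    ← Nat.primeFactors_prod fun p hp => hP p (ht hp)]
  exact congrArg Nat.primeFactors h

/-- A sum over finite sets of primes, weighted by a product and a truncated power. -/
noncomputable def sieveSum (P : Finset ℕ) (w : ℕ → ℝ) (j : ℕ) (u : ℝ) : ℝ :=
  ∑ t ∈ P.powerset, (∏ p ∈ t, w p) * truncPow j (u - logProd t)

theorem sieveSum_nonneg (P : Finset ℕ) (w : ℕ → ℝ) (hw : ∀ p ∈ P, 0 ≤ w p) (j : ℕ) (u : ℝ) :
    0 ≤ sieveSum P w j u :=
  Finset.sum_nonneg fun _ ht => mul_nonneg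
    (Finset.prod_nonneg fun p hp => hw p (Finset.mem_powerset.1 ht hp)) (truncPow_nonneg _ _)

/-- Adjoining a prime `p` adds at most `w p` times the old sum, because truncated powers are
monotone. Read backwards, deleting the primes of `B` costs at most an Euler factor. -/
theorem sieveSum_union_le (B Q : Finset ℕ) (hBQ : Disjoint B Q) (w : ℕ → ℝ)
    (hw : ∀ p, 0 ≤ w p) (j : ℕ) (u : ℝ) :
    sieveSum (B ∪ Q) w j u ≤ (∏ p ∈ B, (1 + w p)) * sieveSum Q w j u := by
  induction B using Finset.induction_on with
  | empty => simp
  | insert p B hp ih =>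
    rw [Finset.disjoint_insert_left] at hBQ
    have hpn : p ∉ B ∪ Q := by simp [hp, hBQ.1]
    rw [Finset.insert_union, sieveSum, Finset.sum_powerset_insert hpn, Finset.prod_insert hp]
    have h1 : ∑ t ∈ (B ∪ Q).powerset, (∏ q ∈ insert p t, w q) *
        truncPow j (u - logProd (insert p t)) ≤ w p * sieveSum (B ∪ Q) w j u := by
      rw [sieveSum, Finset.mul_sum]
      refine Finset.sum_le_sum fun t ht => ?_
      have hpt : p ∉ t := fun h => hpn (Finset.mem_powerset.1 ht h)
      rw [Finset.prod_insert hpt, mul_assoc]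
      have h2 : truncPow j (u - logProd (insert p t)) ≤ truncPow j (u - logProd t) := by
        apply truncPow_mono
        rw [logProd, Finset.sum_insert hpt]
        have := Real.log_natCast_nonneg p
        rw [logProd]
        linarith
      have := Finset.prod_nonneg fun q (_ : q ∈ t) => hw q
      exact mul_le_mul_of_nonneg_left (mul_le_mul_of_nonneg_left h2 this) (hw p)
    have h3 := ih hBQ.2
    calc _ ≤ sieveSum (B ∪ Q) w j u + w p * sieveSum (B ∪ Q) w j u := add_le_add le_rfl h1
      _ = (1 + w p) * sieveSum (B ∪ Q) w j u := by ring
      _ ≤ (1 + w p) * ((∏ p ∈ B, (1 + w p)) * sieveSum Q w j u) :=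
        mul_le_mul_of_nonneg_left h3 (by have := hw p; linarith)
      _ = _ := by ring

/-- Dimension is additive: distribute each prime of a set to `v` or to `w`, and sum over the
`w`-part first. -/
theorem sieveSum_add (P : Finset ℕ) (v w : ℕ → ℝ) (j : ℕ) (u : ℝ) :
    sieveSum P (fun p => v p + w p) j u = ∑ a ∈ P.powerset, (∏ p ∈ a, v p) *
      sieveSum (P \ a) w j (u - logProd a) := by
  have h := sum_powerset_split P fun a b => (∏ p ∈ a, v p) * ((∏ p ∈ b, w p) *
    truncPow j (u - logProd a - logProd b))
  rw [sieveSum]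
  trans ∑ s ∈ P.powerset, ∑ t ∈ s.powerset, (∏ p ∈ t, v p) * ((∏ p ∈ s \ t, w p) *
    truncPow j (u - logProd t - logProd (s \ t)))
  · refine Finset.sum_congr rfl fun s _ => ?_
    rw [prod_add_split, Finset.sum_mul]
    refine Finset.sum_congr rfl fun t ht => ?_
    rw [Finset.mem_powerset] at ht
    have : logProd s = logProd t + logProd (s \ t) := by
      rw [← logProd_union Finset.disjoint_sdiff, Finset.union_sdiff_of_subset ht]
    rw [this, mul_assoc, sub_sub]
  · rw [h]
    exact Finset.sum_congr rfl fun a _ => by rw [sieveSum, Finset.mul_sum]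

theorem sieveSum_mono_left {P Q : Finset ℕ} (h : P ⊆ Q) (w : ℕ → ℝ) (hw : ∀ p ∈ Q, 0 ≤ w p)
    (j : ℕ) (u : ℝ) : sieveSum P w j u ≤ sieveSum Q w j u :=
  Finset.sum_le_sum_of_subset_of_nonneg (Finset.powerset_mono.2 h) fun _ ht _ =>
    mul_nonneg (Finset.prod_nonneg fun p hp => hw p (Finset.mem_powerset.1 ht hp))
      (truncPow_nonneg _ _)

theorem sieveSum_mono_weight (P : Finset ℕ) (v w : ℕ → ℝ) (hv : ∀ p ∈ P, 0 ≤ v p)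
    (hvw : ∀ p ∈ P, v p ≤ w p) (j : ℕ) (u : ℝ) : sieveSum P v j u ≤ sieveSum P w j u :=
  Finset.sum_le_sum fun _ ht => mul_le_mul_of_nonneg_right
    (Finset.prod_le_prod (fun p hp => hv p (Finset.mem_powerset.1 ht hp))
      fun p hp => hvw p (Finset.mem_powerset.1 ht hp)) (truncPow_nonneg _ _)

theorem sieveSum_zero (P : Finset ℕ) (j : ℕ) (u : ℝ) :
    sieveSum P (fun _ => 0) j u = truncPow j u := by
  rw [sieveSum, Finset.sum_eq_single ∅]
  · simp [logProd]
  · intro t _ ht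
    rw [Finset.prod_const, zero_pow (Finset.card_ne_zero.2 (Finset.nonempty_iff_ne_empty.2 ht)),
      zero_mul]
  · simp

/-- Upper bounds in dimension one propagate to all dimensions. -/
theorem sieveSum_le_of_dim_one (P : Finset ℕ) (w : ℕ → ℝ) (hw : ∀ p ∈ P, 0 ≤ w p) (c C : ℝ)
    (hc : 0 ≤ c)
    (h : ∀ j u, sieveSum P w j u ≤ c * truncPow (j + 1) (u + C)) (κ : ℕ) :
    ∀ j u, sieveSum P (fun p => κ * w p) j u ≤ c ^ κ * truncPow (j + κ) (u + κ * C) := by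
  induction κ with
  | zero => intro j u; simp [sieveSum_zero]
  | succ κ ih =>
    intro j u
    have e : (fun p => ((κ + 1 : ℕ) : ℝ) * w p) = fun p => (κ * w p) + w p := by
      ext p; push_cast; ring
    rw [e, sieveSum_add]
    have hn : ∀ a ∈ P.powerset, 0 ≤ ∏ p ∈ a, ((κ : ℝ) * w p) := fun a ha =>
      Finset.prod_nonneg fun p hp => mul_nonneg κ.cast_nonneg (hw p (Finset.mem_powerset.1 ha hp))
    -- One dimension is summed first and raises the exponent from `j` to `j + 1`. For an upper bound
    -- the condition of being disjoint from `a` may be dropped.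
    calc _ ≤ ∑ a ∈ P.powerset, (∏ p ∈ a, (κ * w p)) *
          (c * truncPow (j + 1) ((u + C) - logProd a)) := by
          refine Finset.sum_le_sum fun a ha => mul_le_mul_of_nonneg_left ?_ (hn a ha)
          refine (sieveSum_mono_left Finset.sdiff_subset w hw j _).trans ((h j _).trans_eq ?_)
          congr 2
          ring
      _ = c * sieveSum P (fun p => κ * w p) (j + 1) (u + C) := by
          rw [sieveSum, Finset.mul_sum]
          exact Finset.sum_congr rfl fun a _ => by ring
      _ ≤ c * (c ^ κ * truncPow (j + 1 + κ) (u + C + κ * C)) :=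
          mul_le_mul_of_nonneg_left (ih _ _) hc
      _ = _ := by
          rw [pow_succ, show j + 1 + κ = j + (κ + 1) by ring,
            show u + C + κ * C = u + ((κ + 1 : ℕ) : ℝ) * C by push_cast; ring]
          ring

/-- Lower bounds in dimension one, uniform in an auxiliary coprimality condition, propagate to all
dimensions. -/
theorem le_sieveSum_of_dim_one (P : Finset ℕ) (c U : ℝ) (hc : 0 ≤ c)
    (h : ∀ s ⊆ P, ∀ j u, 0 ≤ u → u ≤ U → c * (∏ p ∈ s, (1 - (p : ℝ)⁻¹)) * truncPow (j + 1) u ≤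
      sieveSum (P \ s) (fun p => ((p : ℝ) - 1)⁻¹) j u) (κ : ℕ) (hP : ∀ p ∈ P, κ < p) :
    ∀ j u, 0 ≤ u → u ≤ U →
      c ^ κ * truncPow (j + κ) u ≤ sieveSum P (fun p => κ * ((p : ℝ) - κ)⁻¹) j u := by
  induction κ with
  | zero => intro j u _ _; simp [sieveSum_zero]
  | succ κ ih =>
    intro j u hu hU
    have ih' := ih (fun p hp => (Nat.lt_succ_self κ).trans (hP p hp))
    have hp1 : ∀ p ∈ P, (κ : ℝ) + 1 < p := fun p hp => by exact_mod_cast hP p hp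
    have e : (fun p : ℕ => ((κ + 1 : ℕ) : ℝ) * ((p : ℝ) - ((κ + 1 : ℕ) : ℝ))⁻¹) = fun p : ℕ =>
        (κ : ℝ) * ((p : ℝ) - (κ + 1))⁻¹ + ((p : ℝ) - (κ + 1))⁻¹ := by
      ext p; push_cast; ring
    rw [e, sieveSum_add]
    have hk : (0 : ℝ) ≤ κ := κ.cast_nonneg
    have hterm : ∀ a ∈ P.powerset,
        c * ((∏ p ∈ a, ((κ : ℝ) * ((p : ℝ) - κ)⁻¹)) * truncPow (j + 1) (u - logProd a)) ≤
        (∏ p ∈ a, ((κ : ℝ) * ((p : ℝ) - (κ + 1))⁻¹)) *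
          sieveSum (P \ a) (fun p => ((p : ℝ) - (κ + 1))⁻¹) j (u - logProd a) := by
      intro a ha
      rw [Finset.mem_powerset] at ha
      have hn : 0 ≤ ∏ p ∈ a, ((κ : ℝ) * ((p : ℝ) - (κ + 1))⁻¹) :=
        Finset.prod_nonneg fun p hp => mul_nonneg hk
          (inv_nonneg.2 (by linarith [hp1 p (ha hp)]))
      rcases lt_or_ge (u - logProd a) 0 with hneg | hpos
      · rw [truncPow_of_neg _ hneg, mul_zero, mul_zero]
        exact mul_nonneg hn (sieveSum_nonneg _ _ (fun p hp =>
          (inv_nonneg.2 (by linarith [hp1 p (Finset.mem_sdiff.1 hp).1]))) _ _)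
      have h1 : sieveSum (P \ a) (fun p => ((p : ℝ) - 1)⁻¹) j (u - logProd a) ≤
          sieveSum (P \ a) (fun p => ((p : ℝ) - (κ + 1))⁻¹) j (u - logProd a) := by
        refine sieveSum_mono_weight _ _ _ (fun p hp => ?_) (fun p hp => ?_) _ _
        · have := hp1 p (Finset.mem_sdiff.1 hp).1
          exact inv_nonneg.2 (by linarith)
        · have := hp1 p (Finset.mem_sdiff.1 hp).1
          exact inv_anti₀ (by linarith) (by linarith)
      have h2 := (h a ha j _ hpos (by linarith [logProd_nonneg a])).trans h1
      refine le_trans ?_ (mul_le_mul_of_nonneg_left h2 hn)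
      -- Here disjointness from `a` cannot be dropped and costs `∏ (1 - 1/p)`. The larger weight
      -- `κ/(p - κ - 1)` absorbs it, since `p (p - κ - 1) ≤ (p - 1)(p - κ)`; this is why the weight
      -- in dimension `κ` has the form `κ/(p - κ)`.
      have h3 : ∏ p ∈ a, ((κ : ℝ) * ((p : ℝ) - κ)⁻¹) ≤
          (∏ p ∈ a, ((κ : ℝ) * ((p : ℝ) - (κ + 1))⁻¹)) * ∏ p ∈ a, (1 - (p : ℝ)⁻¹) := by
        rw [← Finset.prod_mul_distrib]
        refine Finset.prod_le_prod (fun p hp => mul_nonneg hk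
          (inv_nonneg.2 (by linarith [hp1 p (ha hp)]))) fun p hp => ?_
        have hp' := hp1 p (ha hp)
        rw [mul_assoc]
        refine mul_le_mul_of_nonneg_left ?_ hk
        have hp0 : (0 : ℝ) < p := by linarith
        have ha1 : (0 : ℝ) < (p : ℝ) - (κ + 1) := by linarith
        have ha2 : (0 : ℝ) < (p : ℝ) - κ := by linarith
        have : ((p : ℝ) - (κ + 1))⁻¹ * (1 - (p : ℝ)⁻¹) = (p - 1) / ((p - (κ + 1)) * p) := by
          field_simp
        rw [this, inv_eq_one_div, div_le_div_iff₀ ha2 (by positivity)]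
        nlinarith
      have h4 := mul_le_mul_of_nonneg_right h3
        (mul_nonneg hc (truncPow_nonneg (j + 1) (u - logProd a)))
      calc _ = (∏ p ∈ a, ((κ : ℝ) * ((p : ℝ) - κ)⁻¹)) *
            (c * truncPow (j + 1) (u - logProd a)) := by ring
        _ ≤ _ := h4
        _ = _ := by ring
    refine le_trans ?_ (Finset.sum_le_sum hterm)
    rw [← Finset.mul_sum]
    have := mul_le_mul_of_nonneg_left (ih' (j + 1) u hu hU) hc
    rw [sieveSum] at this
    refine le_trans (le_of_eq ?_) this
    rw [pow_succ, show j + 1 + κ = j + (κ + 1) by ring]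
    ring

/-! ### One-dimensional estimates -/

theorem prime_of_mem_primesIoc {D X p : ℕ} (h : p ∈ primesIoc D X) : p.Prime :=
  (mem_primesIoc.1 h).2

theorem sum_geometric_inv_le (x : ℝ) (hx : 1 < x) (n : ℕ) :
    ∑ e ∈ Finset.Icc 1 n, (x ^ e)⁻¹ ≤ (x - 1)⁻¹ := by
  have h : ∀ n : ℕ, ∑ e ∈ Finset.Icc 1 n, (x ^ e)⁻¹ = (x - 1)⁻¹ * (1 - (x ^ n)⁻¹) := by
    intro n
    have h1 : x - 1 ≠ 0 := by linarith
    have h2 : x ≠ 0 := by linarith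
    induction n with
    | zero => simp
    | succ n ih =>
      rw [Finset.sum_Icc_succ_top (by omega), ih]
      field_simp
      ring
  rw [h]
  have h1 : 0 ≤ (x - 1)⁻¹ := inv_nonneg.2 (by linarith)
  have h2 : 0 ≤ (x ^ n)⁻¹ := by positivity
  nlinarith

/-- The reciprocals of the integers with a given set `t` of prime factors sum to at most
`∏ 1 / (p - 1)`. -/
theorem sum_inv_primeFactors_eq_le (X : ℕ) (t : Finset ℕ) (ht : ∀ p ∈ t, p.Prime) :
    ∑ m ∈ Finset.Icc 1 X with m.primeFactors = t, (m : ℝ)⁻¹ ≤ ∏ p ∈ t, ((p : ℝ) - 1)⁻¹ := by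
  have h1 : ∏ p ∈ t, ∑ e ∈ Finset.Icc 1 X, (((p : ℕ) : ℝ) ^ e)⁻¹ ≤ ∏ p ∈ t, ((p : ℝ) - 1)⁻¹ :=
    Finset.prod_le_prod (fun p _ => Finset.sum_nonneg fun e _ => by positivity) fun p hp =>
      sum_geometric_inv_le _ (by exact_mod_cast (ht p hp).one_lt) X
  refine le_trans ?_ h1
  -- The expanded product runs over vectors of exponents, and an integer with prime factors `t` is
  -- determined by its vector.
  rw [Finset.prod_sum]
  refine sum_le_sum_of_injOn_map (fun m p _ => m.factorization p) ?_ ?_ ?_ ?_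
  · intro m hm
    simp only [Finset.mem_filter, Finset.mem_Icc, Finset.mem_pi] at hm ⊢
    intro p hp
    have hpm : p ∈ m.primeFactors := hm.2 ▸ hp
    have hp' := Nat.mem_primeFactors.1 hpm
    refine ⟨(hp'.1.factorization_pos_of_dvd hp'.2.2 hp'.2.1), ?_⟩
    exact ((Nat.factorization_lt p hp'.2.2).le).trans hm.1.2
  · intro m hm n hn hmn
    simp only [Finset.coe_filter, Set.mem_ofPred_eq, Finset.mem_Icc] at hm hn
    refine Nat.eq_of_factorization_eq (by omega) (by omega) fun p => ?_
    by_cases hp : p ∈ t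
    · exact congrFun (congrFun hmn p) hp
    · have e1 : m.factorization p = 0 := by
        rw [← Finsupp.notMem_support_iff, Nat.support_factorization, hm.2]; exact hp
      have e2 : n.factorization p = 0 := by
        rw [← Finsupp.notMem_support_iff, Nat.support_factorization, hn.2]; exact hp
      rw [e1, e2]
  · intro m hm
    simp only [Finset.mem_filter, Finset.mem_Icc] at hm
    rw [Finset.prod_attach t (fun p => (((p : ℕ) : ℝ) ^ (m.factorization p))⁻¹),
      Finset.prod_inv_distrib]
    have h2 : m = ∏ p ∈ t, p ^ m.factorization p := by
      conv_lhs => rw [← Nat.prod_factorization_pow_eq_self (n := m) (by omega)]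
      rw [Nat.prod_factorization_eq_prod_primeFactors, hm.2]
    have h3 : (m : ℝ) = ∏ p ∈ t, (p : ℝ) ^ m.factorization p := by
      conv_lhs => rw [h2]
      push_cast
      rfl
    rw [← h3]
  · intro f _
    exact Finset.prod_nonneg fun p _ => by positivity

/-- The harmonic sum up to `e^u` is at least `u`. Grouping its terms by their set of prime factors
gives a geometric series for each prime, whence the weight `1/(p - 1)`. -/
theorem le_sieveSum_primes (Y : ℕ) (u : ℝ) (hY : ⌊Real.exp u⌋₊ = Y) (Q : Finset ℕ)
    (hQ : primesIoc 0 Y ⊆ Q) (hQp : ∀ p ∈ Q, p.Prime) :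
    u ≤ sieveSum Q (fun p => ((p : ℝ) - 1)⁻¹) 0 u := by
  have h1 : u ≤ ∑ m ∈ Finset.Icc 1 Y, (m : ℝ)⁻¹ := by
    have h2 := log_add_one_le_harmonic Y
    rw [harmonic_eq_sum_Icc] at h2
    push_cast at h2
    refine le_trans ?_ h2
    rw [Real.le_log_iff_exp_le (by positivity), ← hY]
    exact (Nat.lt_floor_add_one _).le
  have hpos : ∀ t ⊆ Q, 0 ≤ ∏ p ∈ t, ((p : ℝ) - 1)⁻¹ := fun t ht =>
    Finset.prod_nonneg fun p hp => inv_nonneg.2 (by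
      have : (1 : ℝ) < p := by exact_mod_cast (hQp p (ht hp)).one_lt
      linarith)
  have hmaps : ∀ m ∈ Finset.Icc 1 Y, m.primeFactors ∈
      Q.powerset.filter (fun t => logProd t ≤ u) := by
    intro m hm
    rw [Finset.mem_Icc] at hm
    rw [Finset.mem_filter, Finset.mem_powerset]
    constructor
    · intro p hp
      have hp' := Nat.mem_primeFactors.1 hp
      exact hQ (mem_primesIoc.2 ⟨⟨hp'.1.pos, (Nat.le_of_dvd (by omega) hp'.2.1).trans hm.2⟩, hp'.1⟩)
    · rw [logProd_le_iff fun p hp => Nat.prime_of_mem_primeFactors hp]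
      have h3 : ∏ p ∈ m.primeFactors, p ≤ m :=
        Nat.le_of_dvd (by omega) (Nat.prod_primeFactors_dvd m)
      have h4 : ((∏ p ∈ m.primeFactors, p : ℕ) : ℝ) ≤ Y := by exact_mod_cast h3.trans hm.2
      refine h4.trans ?_
      rw [← hY]
      exact Nat.floor_le (Real.exp_pos u).le
  refine h1.trans ?_
  rw [← Finset.sum_fiberwise_of_maps_to hmaps]
  calc _ ≤ ∑ t ∈ Q.powerset with logProd t ≤ u, ∏ p ∈ t, ((p : ℝ) - 1)⁻¹ := by
        refine Finset.sum_le_sum fun t ht => sum_inv_primeFactors_eq_le Y t fun p hp => ?_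
        exact hQp p (Finset.mem_powerset.1 (Finset.mem_filter.1 ht).1 hp)
    _ = ∑ t ∈ Q.powerset with logProd t ≤ u, (∏ p ∈ t, ((p : ℝ) - 1)⁻¹) *
          truncPow 0 (u - logProd t) := by
        refine Finset.sum_congr rfl fun t ht => ?_
        rw [truncPow_of_nonneg 0 (by linarith [(Finset.mem_filter.1 ht).2])]
        simp
    _ ≤ _ := Finset.sum_le_sum_of_subset_of_nonneg (Finset.filter_subset _ _) fun t ht _ =>
        mul_nonneg (hpos t (Finset.mem_powerset.1 ht)) (truncPow_nonneg _ _)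

/-- The density `∏_{p ≤ D} (1 - 1/p)` of the integers free of prime factors up to `D`. -/
noncomputable def roughDensity (D : ℕ) : ℝ := ∏ p ∈ primesIoc 0 D, (1 - (p : ℝ)⁻¹)

theorem one_sub_inv_pos {p : ℕ} (hp : p.Prime) : 0 < 1 - (p : ℝ)⁻¹ := by
  have : (1 : ℝ) < p := by exact_mod_cast hp.one_lt
  have := inv_lt_one_of_one_lt₀ this
  linarith

theorem roughDensity_pos (D : ℕ) : 0 < roughDensity D :=
  Finset.prod_pos fun _ hp => one_sub_inv_pos (prime_of_mem_primesIoc hp)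

theorem roughDensity_eq (D : ℕ) :
    roughDensity D = (Nat.totient D.factorial : ℝ) / (D.factorial : ℝ) := by
  have h := Nat.totient_eq_mul_prod_factors D.factorial
  have h1 : D.factorial.primeFactors = primesIoc 0 D := by
    ext p
    rw [Nat.mem_primeFactors, mem_primesIoc]
    constructor
    · rintro ⟨h1, h2, _⟩
      exact ⟨⟨h1.pos, (h1.dvd_factorial).1 h2⟩, h1⟩
    · rintro ⟨⟨_, h2⟩, h1⟩
      exact ⟨h1, h1.dvd_factorial.2 h2, D.factorial_ne_zero⟩
  rw [h1] at h
  have h2 : (Nat.totient D.factorial : ℝ) = (D.factorial : ℝ) * roughDensity D := by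
    have := congrArg (fun x : ℚ => (x : ℝ)) h
    push_cast at this
    rw [this, roughDensity]
  have : (D.factorial : ℝ) ≠ 0 := by exact_mod_cast D.factorial_ne_zero
  rw [h2]
  field_simp

/-- Start from the lower bound with all primes up to `e^u` present. Deleting those up to `D` and
those of `s` costs exactly the inverse of `∏ (1 - 1/p)` over the deleted primes. Integration then
gives every exponent `j`. -/
theorem le_sieveSum_sdiff (D X : ℕ) (hX : 1 ≤ X) (s : Finset ℕ) (hs : s ⊆ primesIoc D X) (j : ℕ)
    (u : ℝ) (hu : 0 ≤ u) (huX : u ≤ Real.log X) :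
    roughDensity D * (∏ p ∈ s, (1 - (p : ℝ)⁻¹)) * truncPow (j + 1) u ≤
      sieveSum (primesIoc D X \ s) (fun p => ((p : ℝ) - 1)⁻¹) j u := by
  refine le_sum_truncPow _ _ _ (fun t _ => logProd_nonneg t) _ (Real.log X) ?_ j u hu huX
  intro u hu huX
  set B := primesIoc 0 D ∪ s with hB
  have hBp : ∀ p ∈ B, p.Prime := fun p hp => by
    rcases Finset.mem_union.1 hp with h | h
    · exact prime_of_mem_primesIoc h
    · exact prime_of_mem_primesIoc (hs h)
  have hdis : Disjoint (primesIoc 0 D) s := by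
    rw [Finset.disjoint_left]
    intro p hp hps
    have := (mem_primesIoc.1 (hs hps)).1.1
    have := (mem_primesIoc.1 hp).1.2
    omega
  have hBQ : Disjoint B (primesIoc D X \ s) := by
    rw [Finset.disjoint_left]
    intro p hp hpQ
    rw [Finset.mem_sdiff] at hpQ
    rcases Finset.mem_union.1 hp with h | h
    · have := (mem_primesIoc.1 hpQ.1).1.1
      have := (mem_primesIoc.1 h).1.2
      omega
    · exact hpQ.2 h
  -- `sieveSum_union_le` wants a weight nonnegative at every natural number, and `1/(p - 1)` is `-1`
  -- at `0`.
  have hw : ∀ p : ℕ, 0 ≤ max 0 (((p : ℝ) - 1)⁻¹) := fun p => le_max_left _ _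
  have hwe : ∀ p : ℕ, p.Prime → max 0 (((p : ℝ) - 1)⁻¹) = ((p : ℝ) - 1)⁻¹ := fun p hp => by
    have : (1 : ℝ) < p := by exact_mod_cast hp.one_lt
    exact max_eq_right (inv_nonneg.2 (by linarith))
  have hsw : ∀ Q : Finset ℕ, (∀ p ∈ Q, p.Prime) →
      sieveSum Q (fun p => max 0 (((p : ℝ) - 1)⁻¹)) 0 u =
        sieveSum Q (fun p => ((p : ℝ) - 1)⁻¹) 0 u := fun Q hQ =>
    Finset.sum_congr rfl fun t ht => by
      rw [Finset.prod_congr rfl fun p hp => hwe p (hQ p (Finset.mem_powerset.1 ht hp))]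
  have h1 := sieveSum_union_le B (primesIoc D X \ s) hBQ _ hw 0 u
  have hpQ : ∀ p ∈ primesIoc D X \ s, p.Prime := fun p hp =>
    prime_of_mem_primesIoc (Finset.mem_sdiff.1 hp).1
  have hpU : ∀ p ∈ B ∪ (primesIoc D X \ s), p.Prime := fun p hp => by
    rcases Finset.mem_union.1 hp with h | h
    · exact hBp p h
    · exact hpQ p h
  rw [hsw _ hpQ, hsw _ hpU] at h1
  have hsub : primesIoc 0 ⌊Real.exp u⌋₊ ⊆ B ∪ (primesIoc D X \ s) := by
    intro p hp
    rw [mem_primesIoc] at hp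
    have hpX : p ≤ X := by
      have h2 : Real.exp u ≤ X := by
        rw [← Real.exp_log (show (0 : ℝ) < X by exact_mod_cast hX)]
        exact Real.exp_le_exp.2 huX
      have h3 : (p : ℝ) ≤ Real.exp u :=
        (Nat.cast_le.2 hp.1.2).trans (Nat.floor_le (Real.exp_pos u).le)
      exact_mod_cast h3.trans h2
    by_cases hpD : p ≤ D
    · exact Finset.mem_union_left _ (Finset.mem_union_left _ (mem_primesIoc.2 ⟨⟨hp.1.1, hpD⟩, hp.2⟩))
    · by_cases hps : p ∈ s
      · exact Finset.mem_union_left _ (Finset.mem_union_right _ hps)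
      · exact Finset.mem_union_right _ (Finset.mem_sdiff.2
          ⟨mem_primesIoc.2 ⟨⟨by omega, hpX⟩, hp.2⟩, hps⟩)
  have h2 := le_sieveSum_primes _ u rfl _ hsub hpU
  have h3 : roughDensity D * (∏ p ∈ s, (1 - (p : ℝ)⁻¹)) *
      ∏ p ∈ B, (1 + max 0 (((p : ℝ) - 1)⁻¹)) = 1 := by
    rw [roughDensity, ← Finset.prod_union hdis, ← Finset.prod_mul_distrib]
    refine Finset.prod_eq_one fun p hp => ?_
    rw [hwe p (hBp p hp)]
    have : (1 : ℝ) < p := by exact_mod_cast (hBp p hp).one_lt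
    have h4 : (p : ℝ) - 1 ≠ 0 := by linarith
    have h5 : (p : ℝ) ≠ 0 := by linarith
    field_simp
    ring
  have h6 : 0 ≤ roughDensity D * (∏ p ∈ s, (1 - (p : ℝ)⁻¹)) :=
    mul_nonneg (roughDensity_pos D).le
      (Finset.prod_nonneg fun p hp => (one_sub_inv_pos (prime_of_mem_primesIoc (hs hp))).le)
  have h7 := mul_le_mul_of_nonneg_left (h2.trans h1) h6
  rw [← mul_assoc, h3, one_mul] at h7
  have h8 : truncPow 1 u = u := by rw [truncPow_of_nonneg 1 hu]; simp
  rw [h8]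
  exact h7

/-- The harmonic sum over integers coprime to `W`. -/
theorem sum_inv_coprime_le (W : ℕ) (hW : 0 < W) (Y : ℕ) :
    ∑ m ∈ Finset.Icc 1 Y with W.Coprime m, (m : ℝ)⁻¹ ≤
      (Nat.totient W : ℝ) / W * (1 + Real.log Y) + W := by
  -- The integers are cut into blocks of length `W`, each with `φ(W)` coprime residues. The block `m
  -- / W = 0` is bounded trivially by `W`.
  have hmaps : ∀ m ∈ (Finset.Icc 1 Y).filter (fun m => W.Coprime m), m / W ∈ Finset.range (Y + 1) :=
    fun m hm => by
      simp only [Finset.mem_filter, Finset.mem_Icc] at hm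
      exact Finset.mem_range.2 (Nat.lt_succ_of_le ((Nat.div_le_self _ _).trans hm.1.2))
  rw [← Finset.sum_fiberwise_of_maps_to hmaps, Finset.sum_range_succ']
  have hW' : (0 : ℝ) < W := by exact_mod_cast hW
  refine add_le_add ?_ ?_
  · have h1 : ∀ j ∈ Finset.range Y, ∑ m ∈ (Finset.Icc 1 Y).filter (fun m => W.Coprime m) with
        m / W = j + 1, (m : ℝ)⁻¹ ≤ (Nat.totient W : ℝ) / W * ((j + 1 : ℕ) : ℝ)⁻¹ := by
      intro j _
      have hsub : ((Finset.Icc 1 Y).filter (fun m => W.Coprime m)).filter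
          (fun m => m / W = j + 1) ⊆
          (Finset.Ico (W * (j + 1)) (W * (j + 1) + W)).filter (fun m => W.Coprime m) := by
        intro m hm
        simp only [Finset.mem_filter, Finset.mem_Icc, Finset.mem_Ico] at hm ⊢
        refine ⟨?_, hm.1.2⟩
        rw [← hm.2]
        exact ⟨Nat.mul_div_le m W, by
          have := Nat.lt_mul_div_succ m hW
          rw [mul_add, mul_one] at this
          exact this⟩
      have h2 : ∀ m ∈ (Finset.Ico (W * (j + 1)) (W * (j + 1) + W)).filter (fun m => W.Coprime m),
          (m : ℝ)⁻¹ ≤ ((W : ℝ) * ((j + 1 : ℕ) : ℝ))⁻¹ := by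
        intro m hm
        simp only [Finset.mem_filter, Finset.mem_Ico] at hm
        refine inv_anti₀ (by positivity) ?_
        exact_mod_cast hm.1.1
      refine (Finset.sum_le_sum_of_subset_of_nonneg hsub fun m _ _ => by positivity).trans ?_
      refine (Finset.sum_le_sum h2).trans ?_
      rw [Finset.sum_const, Nat.filter_coprime_Ico_eq_totient, nsmul_eq_mul, mul_inv]
      exact le_of_eq (by ring)
    refine (Finset.sum_le_sum h1).trans ?_
    rw [← Finset.mul_sum]
    refine mul_le_mul_of_nonneg_left ?_ (by positivity)
    have h2 := harmonic_le_one_add_log Y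
    rw [harmonic] at h2
    push_cast at h2 ⊢
    exact h2
  · have hsub : ((Finset.Icc 1 Y).filter (fun m => W.Coprime m)).filter (fun m => m / W = 0) ⊆
        Finset.range W := by
      intro m hm
      simp only [Finset.mem_filter, Finset.mem_Icc] at hm
      rw [Nat.div_eq_zero_iff] at hm
      rw [Finset.mem_range]
      omega
    calc _ ≤ ∑ m ∈ ((Finset.Icc 1 Y).filter (fun m => W.Coprime m)).filter (fun m => m / W = 0),
          (1 : ℝ) := by
          refine Finset.sum_le_sum fun m hm => ?_
          simp only [Finset.mem_filter, Finset.mem_Icc] at hm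
          exact inv_le_one_of_one_le₀ (by exact_mod_cast hm.1.1.1)
      _ ≤ ∑ m ∈ Finset.range W, (1 : ℝ) :=
          Finset.sum_le_sum_of_subset_of_nonneg hsub fun _ _ _ => zero_le_one
      _ = W := by simp

/-- Distinct sets of primes above `D` have distinct products, all coprime to `D!`, so the sum is
part of a harmonic sum over integers coprime to `D!`. -/
theorem sieveSum_inv_le (D X : ℕ) (u : ℝ) (hu : 0 ≤ u) :
    sieveSum (primesIoc D X) (fun p => (p : ℝ)⁻¹) 0 u ≤
      roughDensity D * (1 + u) + D.factorial := by
  set Y := ⌊Real.exp u⌋₊ with hY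
  have hY1 : 1 ≤ Y := Nat.one_le_floor_iff _ |>.2 (Real.one_le_exp hu)
  have hYu : Real.log Y ≤ u := by
    rw [Real.log_le_iff_le_exp (by exact_mod_cast hY1)]
    exact Nat.floor_le (Real.exp_pos u).le
  have hP : ∀ p ∈ primesIoc D X, p.Prime := fun p hp => prime_of_mem_primesIoc hp
  have h1 := sum_inv_coprime_le D.factorial D.factorial_pos Y
  rw [← roughDensity_eq] at h1
  have h2 : sieveSum (primesIoc D X) (fun p => (p : ℝ)⁻¹) 0 u =
      ∑ t ∈ (primesIoc D X).powerset with logProd t ≤ u, ∏ p ∈ t, (p : ℝ)⁻¹ := by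
    rw [sieveSum, Finset.sum_filter]
    refine Finset.sum_congr rfl fun t _ => ?_
    split_ifs with h
    · rw [truncPow_of_nonneg 0 (by linarith)]; simp
    · rw [truncPow_of_neg 0 (by linarith [not_le.1 h]), mul_zero]
  rw [h2]
  have h3 : ∑ t ∈ (primesIoc D X).powerset with logProd t ≤ u, ∏ p ∈ t, (p : ℝ)⁻¹ ≤
      ∑ m ∈ Finset.Icc 1 Y with D.factorial.Coprime m, (m : ℝ)⁻¹ := by
    refine sum_le_sum_of_injOn_map (fun t => ∏ p ∈ t, p) ?_ ?_ ?_ ?_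
    · intro t ht
      rw [Finset.mem_filter, Finset.mem_powerset] at ht
      have hp : ∀ p ∈ t, p.Prime := fun p hp => hP p (ht.1 hp)
      rw [Finset.mem_filter, Finset.mem_Icc]
      refine ⟨⟨prod_pos_of_prime hp, ?_⟩, ?_⟩
      · exact Nat.le_floor ((logProd_le_iff hp u).1 ht.2)
      · refine Nat.Coprime.prod_right fun p hpt => ?_
        rw [Nat.coprime_comm, (hp p hpt).coprime_iff_not_dvd, (hp p hpt).dvd_factorial]
        have := (mem_primesIoc.1 (ht.1 hpt)).1.1
        omega
    · exact (prod_injOn_primes _ hP).mono fun t ht => by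
        have := (Finset.mem_filter.1 (Finset.mem_coe.1 ht)).1
        exact Finset.mem_coe.2 this
    · intro t _
      rw [Nat.cast_prod, Finset.prod_inv_distrib]
    · intro m _
      positivity
  refine h3.trans (h1.trans ?_)
  have := roughDensity_pos D
  gcongr

/-- This is the price of replacing `1/p` by `1/(p - k)`, since `1/(p - k) = 1/p + k/(p (p - k))`. It
tends to `1` as `D → ∞`, which makes the loss harmless in the end. -/
theorem prod_one_add_le (k D X : ℕ) (hD : 0 < D) (hkD : 2 * k ≤ D) :
    ∏ p ∈ primesIoc D X, (1 + (k : ℝ) * ((p : ℝ) * (p - k))⁻¹) ≤ Real.exp (2 * k / D) := by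
  have hp : ∀ p ∈ Finset.Ioc D X, (D : ℝ) < p ∧ 2 * (k : ℝ) < p := fun p hp => by
    rw [Finset.mem_Ioc] at hp
    exact ⟨by exact_mod_cast hp.1, by exact_mod_cast hkD.trans_lt hp.1⟩
  have hDr : (0 : ℝ) < D := by exact_mod_cast hD
  have hsub : primesIoc D X ⊆ Finset.Ioc D X := Finset.filter_subset _ _
  have hk : (0 : ℝ) ≤ k := k.cast_nonneg
  calc _ ≤ ∏ p ∈ primesIoc D X, Real.exp (2 * k * ((p : ℝ) ^ 2)⁻¹) := by
        refine Finset.prod_le_prod (fun p hpp => ?_) fun p hpp => ?_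
        · have := hp p (hsub hpp)
          have h1 : 0 ≤ ((p : ℝ) * (p - k))⁻¹ :=
            inv_nonneg.2 (mul_nonneg (by linarith) (by linarith))
          positivity
        · have := hp p (hsub hpp)
          rw [add_comm]
          refine le_trans ?_ (Real.add_one_le_exp _)
          have h0 : (0 : ℝ) < p := by linarith
          have h2 : ((p : ℝ) * (p - k))⁻¹ ≤ 2 * ((p : ℝ) ^ 2)⁻¹ := by
            have h3 : (p : ℝ) ^ 2 / 2 ≤ p * (p - k) := by nlinarith
            refine (inv_anti₀ (by positivity) h3).trans (le_of_eq ?_)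
            field_simp
          have := mul_le_mul_of_nonneg_left h2 hk
          linarith
    _ = Real.exp (∑ p ∈ primesIoc D X, 2 * k * ((p : ℝ) ^ 2)⁻¹) := (Real.exp_sum _ _).symm
    _ ≤ _ := by
        refine Real.exp_le_exp.2 ?_
        rw [← Finset.mul_sum, mul_div_assoc, div_eq_mul_inv, mul_assoc]
        refine mul_le_mul_of_nonneg_left (mul_le_mul_of_nonneg_left ?_ hk) (by norm_num)
        refine (Finset.sum_le_sum_of_subset_of_nonneg hsub fun p _ _ => by positivity).trans ?_
        rcases le_or_gt D X with h | h
        · refine (sum_Ioc_inv_sq_le_sub hD.ne' h).trans ?_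
          have : (0 : ℝ) ≤ (X : ℝ)⁻¹ := by positivity
          linarith
        · rw [Finset.Ioc_eq_empty (by omega)]
          simp

theorem sieveSum_le (k D X : ℕ) (hD : 0 < D) (hkD : 2 * k ≤ D) (j : ℕ) (u : ℝ) :
    sieveSum (primesIoc D X) (fun p => ((p : ℝ) - k)⁻¹) j u ≤
      Real.exp (2 * k / D) * roughDensity D *
        truncPow (j + 1) (u + (1 + D.factorial / roughDensity D)) := by
  have hc := roughDensity_pos D
  refine sum_truncPow_le _ _ _ (fun t _ => logProd_nonneg t) _ _ (by positivity) (by positivity)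
    ?_ j u
  intro u hu
  have hp : ∀ p ∈ primesIoc D X, (0 : ℝ) < p ∧ (0 : ℝ) < p - k := fun p hp => by
    have h1 := (mem_primesIoc.1 hp).1.1
    have h2 : (k : ℝ) < p := by exact_mod_cast (by omega : k < p)
    have h3 : (0 : ℝ) ≤ k := k.cast_nonneg
    exact ⟨by linarith, by linarith⟩
  have e : sieveSum (primesIoc D X) (fun p => ((p : ℝ) - k)⁻¹) 0 u =
      sieveSum (primesIoc D X) (fun p => (k : ℝ) * ((p : ℝ) * (p - k))⁻¹ + (p : ℝ)⁻¹) 0 u := by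
    refine Finset.sum_congr rfl fun t ht => ?_
    congr 1
    refine Finset.prod_congr rfl fun p hpt => ?_
    obtain ⟨h1, h2⟩ := hp p (Finset.mem_powerset.1 ht hpt)
    have := h1.ne'
    have := h2.ne'
    field_simp
    ring
  have hv : ∀ p ∈ primesIoc D X, 0 ≤ (k : ℝ) * ((p : ℝ) * (p - k))⁻¹ := fun p hpp => by
    obtain ⟨h1, h2⟩ := hp p hpp
    positivity
  have h1 : sieveSum (primesIoc D X) (fun p => (p : ℝ)⁻¹) 0 u ≤
      roughDensity D * (u + (1 + D.factorial / roughDensity D)) := by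
    refine (sieveSum_inv_le D X u hu).trans (le_of_eq ?_)
    field_simp
    ring
  change sieveSum (primesIoc D X) (fun p => ((p : ℝ) - k)⁻¹) 0 u ≤ _
  rw [e, sieveSum_add]
  have hC : 0 ≤ D.factorial / roughDensity D := by positivity
  calc _ ≤ ∑ a ∈ (primesIoc D X).powerset, (∏ p ∈ a, ((k : ℝ) * ((p : ℝ) * (p - k))⁻¹)) *
        sieveSum (primesIoc D X) (fun p => (p : ℝ)⁻¹) 0 u := by
        refine Finset.sum_le_sum fun a ha => mul_le_mul_of_nonneg_left ?_
          (Finset.prod_nonneg fun p hpa => hv p (Finset.mem_powerset.1 ha hpa))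
        refine (sieveSum_mono_left Finset.sdiff_subset _ (fun p _ => by positivity) _ _).trans ?_
        refine Finset.sum_le_sum fun t _ => mul_le_mul_of_nonneg_left
          (truncPow_mono 0 (by linarith [logProd_nonneg a]))
          (Finset.prod_nonneg fun p _ => by positivity)
    _ = (∏ p ∈ primesIoc D X, (1 + (k : ℝ) * ((p : ℝ) * (p - k))⁻¹)) *
        sieveSum (primesIoc D X) (fun p => (p : ℝ)⁻¹) 0 u := by
        rw [← Finset.sum_mul, Finset.prod_one_add]
    _ ≤ Real.exp (2 * k / D) * (roughDensity D * (u + (1 + D.factorial / roughDensity D))) := by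
        refine mul_le_mul (prod_one_add_le k D X hD hkD) h1
          (sieveSum_nonneg _ _ (fun p _ => by positivity) _ _) (Real.exp_pos _).le
    _ = _ := by
        rw [truncPow_of_nonneg 1 (by positivity)]
        simp
        ring

/-! ### Polynomial weights and the two diagonal forms -/

/-- The homogenised polynomial `∑ c_i L^(l-i) u^i / i!`, extended by zero to negative `u`. -/
noncomputable def truncPoly (c : ℕ → ℝ) (l : ℕ) (L u : ℝ) : ℝ :=
  ∑ i ∈ Finset.range (l + 1), c i * L ^ (l - i) * truncPow i u

/-- The constant in the main term of the sieve sum over integers. -/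
noncomputable def upperConst (c : ℕ → ℝ) (l k : ℕ) : ℝ :=
  ∑ i ∈ Finset.range (l + 1), ∑ j ∈ Finset.range (l + 1),
    c i * c j * ((i + j).choose i : ℝ) / ((i + j + k).factorial : ℝ)

/-- The constant in the main term of the sieve sum over primes. -/
noncomputable def lowerConst (c : ℕ → ℝ) (l k : ℕ) : ℝ :=
  ∑ i ∈ Finset.range (l + 1), ∑ j ∈ Finset.range (l + 1),
    c i * c j * ((i + 1 + (j + 1)).choose (i + 1) : ℝ) / ((i + j + k + 1).factorial : ℝ)

/-- The sieve weights attached to a polynomial. -/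
noncomputable def gpyWeight (P : Finset ℕ) (k : ℕ) (c : ℕ → ℝ) (l : ℕ) (L : ℝ) (s : Finset ℕ) : ℝ :=
  selbergWeight P (fun p => (k : ℝ) / p) (fun t => truncPoly c l L (L - logProd t)) s

theorem truncPoly_nonneg {c : ℕ → ℝ} (hc : ∀ i, 0 ≤ c i) (l : ℕ) {L : ℝ} (hL : 0 ≤ L) (u : ℝ) :
    0 ≤ truncPoly c l L u :=
  Finset.sum_nonneg fun i _ => mul_nonneg (mul_nonneg (hc i) (pow_nonneg hL _))
    (truncPow_nonneg i u)

theorem truncPoly_of_neg (c : ℕ → ℝ) (l : ℕ) (L : ℝ) {u : ℝ} (hu : u < 0) :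
    truncPoly c l L u = 0 :=
  Finset.sum_eq_zero fun i _ => by rw [truncPow_of_neg i hu, mul_zero]

theorem sum_mul_truncPoly {ι : Type*} (S : Finset ι) (w t : ι → ℝ) (c : ℕ → ℝ) (l : ℕ) (L : ℝ) :
    ∑ a ∈ S, w a * truncPoly c l L (t a) =
      ∑ i ∈ Finset.range (l + 1), c i * L ^ (l - i) * ∑ a ∈ S, w a * truncPow i (t a) := by
  simp only [truncPoly, Finset.mul_sum]
  rw [Finset.sum_comm]
  exact Finset.sum_congr rfl fun i _ => Finset.sum_congr rfl fun a _ => by ring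

/-- The parameters of the sieve: `k` shifts, primes above `D`. -/
structure SieveParams (k D : ℕ) : Prop where
  two_le : 2 ≤ k
  two_mul_le : 2 * k ≤ D

namespace SieveParams

variable {k D X : ℕ}

theorem lt_of_mem (h : SieveParams k D) {p : ℕ} (hp : p ∈ primesIoc D X) :
    2 * (k : ℝ) < p := by
  have := (mem_primesIoc.1 hp).1.1
  have := h.two_mul_le
  exact_mod_cast (by omega : 2 * k < p)

theorem k_pos (h : SieveParams k D) : (2 : ℝ) ≤ k := by exact_mod_cast h.two_le

theorem weight_nonneg (h : SieveParams k D) {p : ℕ} (hp : p ∈ primesIoc D X) :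
    0 ≤ ((p : ℝ) - k)⁻¹ := inv_nonneg.2 (by linarith [h.lt_of_mem hp, h.k_pos])

theorem sieveSum_kfold_le (h : SieveParams k D) (κ j : ℕ) (u : ℝ) :
    sieveSum (primesIoc D X) (fun p => κ * ((p : ℝ) - k)⁻¹) j u ≤
      (Real.exp (2 * k / D) * roughDensity D) ^ κ *
        truncPow (j + κ) (u + κ * (1 + D.factorial / roughDensity D)) := by
  refine sieveSum_le_of_dim_one _ _ (fun p hp => h.weight_nonneg hp) _ _ ?_ ?_ κ j u
  · have := roughDensity_pos D; positivity
  · intro j u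
    have := h.two_mul_le
    have := h.two_le
    exact sieveSum_le k D X (by omega) h.two_mul_le j u

/-- Here `g = f = k/p`, so the form is exactly diagonal in the polynomial values, with the weight
`k/(p - k)` of dimension `k`. -/
theorem quadForm_upper_eq (h : SieveParams k D) (c : ℕ → ℝ) (l : ℕ) (L : ℝ) :
    quadForm (primesIoc D X) (gpyWeight (primesIoc D X) k c l L) (fun p => (k : ℝ) / p) =
      ∑ r ∈ (primesIoc D X).powerset, (∏ p ∈ r, ((k : ℝ) * ((p : ℝ) - k)⁻¹)) *
        truncPoly c l L (L - logProd r) ^ 2 := by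
  have hk := h.k_pos
  have hp0 : ∀ p ∈ primesIoc D X, (k : ℝ) / p ≠ 0 := fun p hp => by
    have := h.lt_of_mem hp
    have h1 : (0 : ℝ) < p := by linarith
    have h2 : (0 : ℝ) < k := by linarith
    positivity
  unfold gpyWeight
  rw [quadForm_selbergWeight _ _ _ _ hp0]
  refine Finset.sum_congr rfl fun r hr => ?_
  rw [Finset.mem_powerset] at hr
  congr 1
  · refine Finset.prod_congr rfl fun p hp => ?_
    have := h.lt_of_mem (hr hp)
    have h1 : (p : ℝ) ≠ 0 := by linarith
    have h2 : (k : ℝ) ≠ 0 := by linarith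
    have h3 : (p : ℝ) - k ≠ 0 := by linarith
    rw [div_self (hp0 p (hr hp))]
    have h4 : ((k : ℝ) / p)⁻¹ - 1 = (p - k) / k := by field_simp
    rw [h4]
    field_simp
  · rw [Finset.sum_eq_single ∅]
    · simp
    · intro v hv hne
      obtain ⟨p, hp⟩ := Finset.nonempty_iff_ne_empty.2 hne
      rw [Finset.prod_eq_zero hp, mul_zero]
      have hpP := (Finset.mem_sdiff.1 (Finset.mem_powerset.1 hv hp)).1
      rw [div_self (hp0 p hpP)]
      simp
    · simp

theorem quadForm_upper_le (h : SieveParams k D) (c : ℕ → ℝ) (hc : ∀ i, 0 ≤ c i) (l : ℕ) (L : ℝ)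
    (hL : 0 ≤ L) :
    quadForm (primesIoc D X) (gpyWeight (primesIoc D X) k c l L) (fun p => (k : ℝ) / p) ≤
      (Real.exp (2 * k / D) * roughDensity D) ^ k *
        (L + k * (1 + D.factorial / roughDensity D)) ^ (2 * l + k) * upperConst c l k := by
  have hρ := roughDensity_pos D
  set C := (1 + D.factorial / roughDensity D : ℝ) with hC
  have hC0 : 0 ≤ C := by positivity
  set A := Real.exp (2 * k / D) * roughDensity D with hA
  have hA0 : 0 ≤ A := by positivity
  rw [h.quadForm_upper_eq]
  have e : ∀ r : Finset ℕ, truncPoly c l L (L - logProd r) ^ 2 =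
      ∑ i ∈ Finset.range (l + 1), ∑ j ∈ Finset.range (l + 1),
        c i * c j * L ^ (l - i) * L ^ (l - j) * ((i + j).choose i : ℝ) *
          truncPow (i + j) (L - logProd r) := by
    intro r
    rw [sq, truncPoly, Finset.sum_mul_sum]
    refine Finset.sum_congr rfl fun i _ => Finset.sum_congr rfl fun j _ => ?_
    have := truncPow_mul i j (L - logProd r)
    calc _ = c i * c j * L ^ (l - i) * L ^ (l - j) *
          (truncPow i (L - logProd r) * truncPow j (L - logProd r)) := by ring
      _ = _ := by rw [this]; ring
  have e2 : ∑ r ∈ (primesIoc D X).powerset, (∏ p ∈ r, ((k : ℝ) * ((p : ℝ) - k)⁻¹)) *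
        truncPoly c l L (L - logProd r) ^ 2 =
      ∑ i ∈ Finset.range (l + 1), ∑ j ∈ Finset.range (l + 1),
        c i * c j * L ^ (l - i) * L ^ (l - j) * ((i + j).choose i : ℝ) *
          sieveSum (primesIoc D X) (fun p => k * ((p : ℝ) - k)⁻¹) (i + j) L := by
    simp only [e, sieveSum, Finset.mul_sum]
    rw [Finset.sum_comm]
    refine Finset.sum_congr rfl fun i _ => ?_
    rw [Finset.sum_comm]
    exact Finset.sum_congr rfl fun j _ => Finset.sum_congr rfl fun r _ => by ring
  rw [e2, upperConst, Finset.mul_sum]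
  refine Finset.sum_le_sum fun i hi => ?_
  rw [Finset.mul_sum]
  refine Finset.sum_le_sum fun j hj => ?_
  rw [Finset.mem_range] at hi hj
  have hLC : 0 ≤ L + k * C := by positivity
  have hLle : L ≤ L + k * C := by
    have : 0 ≤ k * C := by positivity
    linarith
  have h1 := h.sieveSum_kfold_le (X := X) k (i + j) L
  rw [truncPow_of_nonneg _ hLC] at h1
  -- All terms are brought to one power of the shifted logarithm; the shift is independent of `L`
  -- and disappears in the limit.
  have h2 : L ^ (l - i) * L ^ (l - j) * (L + k * C) ^ (i + j + k) ≤ (L + k * C) ^ (2 * l + k) := by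
    calc _ ≤ (L + k * C) ^ (l - i) * (L + k * C) ^ (l - j) * (L + k * C) ^ (i + j + k) := by gcongr
      _ = _ := by rw [← pow_add, ← pow_add]; congr 1; omega
  have hci := hc i
  have hcj := hc j
  calc _ ≤ c i * c j * L ^ (l - i) * L ^ (l - j) * ((i + j).choose i : ℝ) *
        (A ^ k * ((L + k * C) ^ (i + j + k) / ((i + j + k).factorial : ℝ))) := by
        gcongr
    _ = c i * c j * ((i + j).choose i : ℝ) / ((i + j + k).factorial : ℝ) * A ^ k *
        (L ^ (l - i) * L ^ (l - j) * (L + k * C) ^ (i + j + k)) := by ring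
    _ ≤ c i * c j * ((i + j).choose i : ℝ) / ((i + j + k).factorial : ℝ) * A ^ k *
        (L + k * C) ^ (2 * l + k) := by gcongr
    _ = _ := by ring

theorem gpyWeight_eq_zero (P : Finset ℕ) (k : ℕ) (c : ℕ → ℝ) (l : ℕ) (L : ℝ)
    {s : Finset ℕ} (hs : L < logProd s) : gpyWeight P k c l L s = 0 := by
  unfold gpyWeight selbergWeight
  rw [Finset.sum_eq_zero, mul_zero]
  intro v hv
  have hd : Disjoint s v := Finset.disjoint_sdiff.mono_right (Finset.mem_powerset.1 hv)
  have h1 : L - logProd (s ∪ v) < 0 := by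
    rw [logProd_union hd]
    linarith [logProd_nonneg v]
  beta_reduce
  rw [truncPoly_of_neg c l L h1, zero_mul]

theorem abs_gpyWeight_le (h : SieveParams k D) (c : ℕ → ℝ) (hc : ∀ i, 0 ≤ c i) (l : ℕ) (L : ℝ)
    (hL : 0 ≤ L) (s : Finset ℕ) (hs : s ⊆ primesIoc D X) :
    |gpyWeight (primesIoc D X) k c l L s| ≤ 2 ^ s.card *
      ((Real.exp (2 * k / D) * roughDensity D) ^ k * (∑ i ∈ Finset.range (l + 1), c i) *
        (L + k * (1 + D.factorial / roughDensity D)) ^ (l + k)) := by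
  have hρ := roughDensity_pos D
  set C := (1 + D.factorial / roughDensity D : ℝ) with hC
  have hC0 : 0 ≤ C := by positivity
  set A := Real.exp (2 * k / D) * roughDensity D with hA
  have hA0 : 0 ≤ A := by positivity
  have hk := h.k_pos
  have hp : ∀ p ∈ primesIoc D X, (0 : ℝ) < p ∧ (0 : ℝ) < p - k := fun p hp => by
    have := h.lt_of_mem hp
    constructor <;> linarith
  have hLC : 0 ≤ L + k * C := by positivity
  have hLle : L ≤ L + k * C := by
    have : 0 ≤ k * C := by positivity
    linarith
  have e : gpyWeight (primesIoc D X) k c l L s = (∏ p ∈ s, (-((p : ℝ) * ((p : ℝ) - k)⁻¹))) *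
      ∑ v ∈ (primesIoc D X \ s).powerset, (∏ p ∈ v, ((k : ℝ) * ((p : ℝ) - k)⁻¹)) *
        truncPoly c l L (L - logProd s - logProd v) := by
    have e1 : ∀ p ∈ primesIoc D X, (((k : ℝ) / p)⁻¹ - 1)⁻¹ = (k : ℝ) * ((p : ℝ) - k)⁻¹ := by
      intro p hpP
      obtain ⟨h1, h2⟩ := hp p hpP
      have h3 : ((k : ℝ) / p)⁻¹ - 1 = (p - k) / k := by field_simp
      rw [h3]
      field_simp
    unfold gpyWeight selbergWeight
    rw [Finset.mul_sum, Finset.mul_sum]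
    refine Finset.sum_congr rfl fun v hv => ?_
    rw [Finset.mem_powerset] at hv
    have hd : Disjoint s v := Finset.disjoint_sdiff.mono_right hv
    beta_reduce
    rw [logProd_union hd, Finset.prod_union hd, ← sub_sub,
      Finset.prod_congr rfl fun p hpv => e1 p (Finset.mem_sdiff.1 (hv hpv)).1]
    have e2 : ∏ p ∈ s, (-((p : ℝ) * ((p : ℝ) - k)⁻¹)) =
        (∏ p ∈ s, (-((k : ℝ) / p)⁻¹)) * ∏ p ∈ s, (((k : ℝ) / p)⁻¹ - 1)⁻¹ := by
      rw [← Finset.prod_mul_distrib]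
      refine Finset.prod_congr rfl fun p hps => ?_
      obtain ⟨h1, h2⟩ := hp p (hs hps)
      rw [e1 p (hs hps)]
      field_simp
    rw [e2]
    ring
  rw [e, abs_mul, Finset.abs_prod]
  -- Each factor `p/(p - k)` is at most `2` because `p > 2k`.
  have h1 : ∏ p ∈ s, |(-((p : ℝ) * ((p : ℝ) - k)⁻¹))| ≤ 2 ^ s.card := by
    rw [← Finset.prod_const]
    refine Finset.prod_le_prod (fun p _ => abs_nonneg _) fun p hps => ?_
    obtain ⟨h1, h2⟩ := hp p (hs hps)
    have := h.lt_of_mem (hs hps)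
    rw [abs_neg, abs_of_nonneg (by positivity), ← div_eq_mul_inv, div_le_iff₀ h2]
    linarith
  have hw : ∀ p ∈ primesIoc D X, 0 ≤ (k : ℝ) * ((p : ℝ) - k)⁻¹ := fun p hpP =>
    mul_nonneg k.cast_nonneg (h.weight_nonneg hpP)
  have hwv : ∀ v ∈ (primesIoc D X \ s).powerset, 0 ≤ ∏ p ∈ v, ((k : ℝ) * ((p : ℝ) - k)⁻¹) :=
    fun v hv => Finset.prod_nonneg fun p hpv =>
      hw p (Finset.mem_sdiff.1 (Finset.mem_powerset.1 hv hpv)).1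
  have h2 : ∑ v ∈ (primesIoc D X \ s).powerset, (∏ p ∈ v, ((k : ℝ) * ((p : ℝ) - k)⁻¹)) *
        truncPoly c l L (L - logProd s - logProd v) ≤
      A ^ k * (∑ i ∈ Finset.range (l + 1), c i) * (L + k * C) ^ (l + k) := by
    rw [sum_mul_truncPoly, Finset.mul_sum, Finset.sum_mul]
    refine Finset.sum_le_sum fun i hi => ?_
    rw [Finset.mem_range] at hi
    have h3 : ∑ v ∈ (primesIoc D X \ s).powerset, (∏ p ∈ v, ((k : ℝ) * ((p : ℝ) - k)⁻¹)) *
        truncPow i (L - logProd s - logProd v) ≤ A ^ k * (L + k * C) ^ (i + k) := by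
      refine (sieveSum_mono_left Finset.sdiff_subset _ hw i (L - logProd s)).trans
        ((h.sieveSum_kfold_le k i _).trans ?_)
      refine mul_le_mul_of_nonneg_left ?_ (by positivity)
      refine (truncPow_mono _ (show _ ≤ L + k * C by linarith [logProd_nonneg s])).trans ?_
      rw [truncPow_of_nonneg _ hLC]
      exact div_le_self (by positivity) (by exact_mod_cast Nat.factorial_pos _)
    have hci := hc i
    calc _ ≤ c i * L ^ (l - i) * (A ^ k * (L + k * C) ^ (i + k)) := by gcongr
      _ ≤ c i * (L + k * C) ^ (l - i) * (A ^ k * (L + k * C) ^ (i + k)) := by gcongr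
      _ = A ^ k * c i * ((L + k * C) ^ (l - i) * (L + k * C) ^ (i + k)) := by ring
      _ = _ := by rw [← pow_add]; congr 2; omega
  have h3 : 0 ≤ ∑ v ∈ (primesIoc D X \ s).powerset, (∏ p ∈ v, ((k : ℝ) * ((p : ℝ) - k)⁻¹)) *
        truncPoly c l L (L - logProd s - logProd v) :=
    Finset.sum_nonneg fun v hv => mul_nonneg (hwv v hv) (truncPoly_nonneg hc l hL _)
  rw [abs_of_nonneg h3]
  exact mul_le_mul h1 h2 h3 (by positivity)

/-- With `f = k/p` and `g = (k-1)/(p-1)`, the inner weight is `1/(p - 1)`: a one-dimensional sum,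
which integrates the polynomial once. The nonnegative lower bound may be squared and summed with the
outer weight, of dimension `k - 1`. -/
theorem le_quadForm_lower (h : SieveParams k D) (c : ℕ → ℝ) (hc : ∀ i, 0 ≤ c i) (l : ℕ) (L : ℝ)
    (hL : 0 ≤ L) (hX : 1 ≤ X) (hLX : L ≤ Real.log X) :
    roughDensity D ^ (k + 1) * L ^ (2 * l + k + 1) * lowerConst c l k ≤
      quadForm (primesIoc D X) (gpyWeight (primesIoc D X) k c l L)
        (fun p => ((k : ℝ) - 1) / ((p : ℝ) - 1)) := by
  have hρ := roughDensity_pos D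
  have hk := h.k_pos
  have hp : ∀ p ∈ primesIoc D X, (0 : ℝ) < p ∧ (0 : ℝ) < p - k ∧ (0 : ℝ) < p - 1 := fun p hp => by
    have := h.lt_of_mem hp
    refine ⟨?_, ?_, ?_⟩ <;> linarith
  have hk1 : (0 : ℝ) < k - 1 := by linarith
  have hg0 : ∀ p ∈ primesIoc D X, ((k : ℝ) - 1) / ((p : ℝ) - 1) ≠ 0 := fun p hpP => by
    have := (hp p hpP).2.2
    positivity
  unfold gpyWeight
  rw [quadForm_selbergWeight _ _ _ _ hg0]
  have hin : ∀ r ∈ (primesIoc D X).powerset, ∀ v ∈ (primesIoc D X \ r).powerset,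
      truncPoly c l L (L - logProd (r ∪ v)) * ∏ p ∈ v,
        ((1 - ((k : ℝ) - 1) / ((p : ℝ) - 1) / ((k : ℝ) / p)) * (((k : ℝ) / p)⁻¹ - 1)⁻¹) =
      (∏ p ∈ v, ((p : ℝ) - 1)⁻¹) * truncPoly c l L (L - logProd r - logProd v) := by
    intro r _ v hv
    rw [Finset.mem_powerset] at hv
    rw [logProd_union (Finset.disjoint_sdiff.mono_right hv), ← sub_sub, mul_comm]
    congr 1
    refine Finset.prod_congr rfl fun p hpv => ?_
    obtain ⟨h1, h2, h3⟩ := hp p (Finset.mem_sdiff.1 (hv hpv)).1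
    have h4 : ((k : ℝ) / p)⁻¹ - 1 = (p - k) / k := by field_simp
    have h5 : 1 - ((k : ℝ) - 1) / ((p : ℝ) - 1) / ((k : ℝ) / p) = (p - k) / (k * (p - 1)) := by
      field_simp
      ring
    rw [h4, h5]
    field_simp
  have hlow : ∀ r ∈ (primesIoc D X).powerset,
      roughDensity D * (∏ p ∈ r, (1 - (p : ℝ)⁻¹)) *
        (∑ i ∈ Finset.range (l + 1), c i * L ^ (l - i) * truncPow (i + 1) (L - logProd r)) ≤
      ∑ v ∈ (primesIoc D X \ r).powerset, truncPoly c l L (L - logProd (r ∪ v)) * ∏ p ∈ v,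
        ((1 - ((k : ℝ) - 1) / ((p : ℝ) - 1) / ((k : ℝ) / p)) * (((k : ℝ) / p)⁻¹ - 1)⁻¹) := by
    intro r hr
    rw [Finset.sum_congr rfl (hin r hr), sum_mul_truncPoly, Finset.mul_sum]
    refine Finset.sum_le_sum fun i _ => ?_
    have hci := hc i
    have h1 : roughDensity D * (∏ p ∈ r, (1 - (p : ℝ)⁻¹)) * truncPow (i + 1) (L - logProd r) ≤
        sieveSum (primesIoc D X \ r) (fun p => ((p : ℝ) - 1)⁻¹) i (L - logProd r) := by
      rcases lt_or_ge (L - logProd r) 0 with hn | hn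
      · rw [truncPow_of_neg _ hn, mul_zero]
        refine sieveSum_nonneg _ _ (fun p hpP => ?_) _ _
        exact inv_nonneg.2 (hp p (Finset.mem_sdiff.1 hpP).1).2.2.le
      · exact le_sieveSum_sdiff D X hX r (Finset.mem_powerset.1 hr) i _ hn
          (by linarith [logProd_nonneg r])
    have h2 := mul_le_mul_of_nonneg_left h1 (mul_nonneg hci (pow_nonneg hL (l - i)))
    refine le_trans (le_of_eq ?_) h2
    ring
  set F : ℝ → ℝ := fun u => ∑ i ∈ Finset.range (l + 1), c i * L ^ (l - i) * truncPow (i + 1) u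
    with hF
  have hF0 : ∀ u, 0 ≤ F u := fun u => Finset.sum_nonneg fun i _ =>
    mul_nonneg (mul_nonneg (hc i) (pow_nonneg hL _)) (truncPow_nonneg _ _)
  have hstep : ∀ r ∈ (primesIoc D X).powerset,
      roughDensity D ^ 2 * ((∏ p ∈ r, (((k - 1 : ℕ) : ℝ) * ((p : ℝ) - ((k - 1 : ℕ) : ℝ))⁻¹)) *
        F (L - logProd r) ^ 2) ≤
      (∏ p ∈ r, (((((k : ℝ) - 1) / ((p : ℝ) - 1))⁻¹ - 1) *
        (((k : ℝ) - 1) / ((p : ℝ) - 1) / ((k : ℝ) / p) * (((k : ℝ) / p)⁻¹ - 1)⁻¹) ^ 2)) *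
      (∑ v ∈ (primesIoc D X \ r).powerset, truncPoly c l L (L - logProd (r ∪ v)) * ∏ p ∈ v,
        ((1 - ((k : ℝ) - 1) / ((p : ℝ) - 1) / ((k : ℝ) / p)) * (((k : ℝ) / p)⁻¹ - 1)⁻¹)) ^ 2 := by
    intro r hr
    have hr' := Finset.mem_powerset.1 hr
    have hpr : 0 ≤ ∏ p ∈ r, (1 - (p : ℝ)⁻¹) := Finset.prod_nonneg fun p hpr =>
      (one_sub_inv_pos (prime_of_mem_primesIoc (hr' hpr))).le
    have h1 : (roughDensity D * (∏ p ∈ r, (1 - (p : ℝ)⁻¹)) * F (L - logProd r)) ^ 2 ≤ _ :=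
      pow_le_pow_left₀ (mul_nonneg (mul_nonneg hρ.le hpr) (hF0 _)) (hlow r hr) 2
    -- The factor `(1 - 1/p)²` from squaring the inner bound cancels exactly and leaves
    -- `(k-1)/(p-k)`. This is at least `(k-1)/(p-(k-1))`, the shape needed for the lower bound in
    -- dimension `k - 1`.
    have hw : ∀ p ∈ r, (((((k : ℝ) - 1) / ((p : ℝ) - 1))⁻¹ - 1) *
        (((k : ℝ) - 1) / ((p : ℝ) - 1) / ((k : ℝ) / p) * (((k : ℝ) / p)⁻¹ - 1)⁻¹) ^ 2) *
          (1 - (p : ℝ)⁻¹) ^ 2 = ((k : ℝ) - 1) * ((p : ℝ) - k)⁻¹ := by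
      intro p hpr
      obtain ⟨h1, h2, h3⟩ := hp p (hr' hpr)
      have h4 : ((k : ℝ) / p)⁻¹ - 1 = (p - k) / k := by field_simp
      have h5 : (((k : ℝ) - 1) / ((p : ℝ) - 1))⁻¹ - 1 = (p - k) / (k - 1) := by
        field_simp
        ring
      have h6 : 1 - (p : ℝ)⁻¹ = (p - 1) / p := by field_simp
      rw [h4, h5, h6]
      field_simp
    have hw0 : 0 ≤ ∏ p ∈ r, (((((k : ℝ) - 1) / ((p : ℝ) - 1))⁻¹ - 1) *
        (((k : ℝ) - 1) / ((p : ℝ) - 1) / ((k : ℝ) / p) * (((k : ℝ) / p)⁻¹ - 1)⁻¹) ^ 2) := by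
      refine Finset.prod_nonneg fun p hpr => mul_nonneg ?_ (sq_nonneg _)
      obtain ⟨h1, h2, h3⟩ := hp p (hr' hpr)
      have h5 : (((k : ℝ) - 1) / ((p : ℝ) - 1))⁻¹ - 1 = (p - k) / (k - 1) := by
        field_simp
        ring
      rw [h5]
      positivity
    refine le_trans ?_ (mul_le_mul_of_nonneg_left h1 hw0)
    rw [mul_pow, mul_pow, ← Finset.prod_pow]
    have h7 : ∏ p ∈ r, (((k - 1 : ℕ) : ℝ) * ((p : ℝ) - ((k - 1 : ℕ) : ℝ))⁻¹) ≤
        (∏ p ∈ r, (((((k : ℝ) - 1) / ((p : ℝ) - 1))⁻¹ - 1) *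
        (((k : ℝ) - 1) / ((p : ℝ) - 1) / ((k : ℝ) / p) * (((k : ℝ) / p)⁻¹ - 1)⁻¹) ^ 2)) *
        ∏ p ∈ r, (1 - (p : ℝ)⁻¹) ^ 2 := by
      rw [← Finset.prod_mul_distrib, Finset.prod_congr rfl hw]
      have hcast : ((k - 1 : ℕ) : ℝ) = (k : ℝ) - 1 := by
        have := h.two_le
        push_cast [Nat.cast_sub (by omega : 1 ≤ k)]
        ring
      rw [hcast]
      refine Finset.prod_le_prod (fun p hpr => ?_) fun p hpr => ?_
      · obtain ⟨h1, h2, h3⟩ := hp p (hr' hpr)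
        exact mul_nonneg hk1.le (inv_nonneg.2 (by linarith))
      · obtain ⟨h1, h2, h3⟩ := hp p (hr' hpr)
        exact mul_le_mul_of_nonneg_left (inv_anti₀ h2 (by linarith)) hk1.le
    have h8 := mul_le_mul_of_nonneg_right h7
      (mul_nonneg (sq_nonneg (roughDensity D)) (sq_nonneg (F (L - logProd r))))
    refine le_trans (le_of_eq ?_) (h8.trans (le_of_eq ?_)) <;> ring
  refine le_trans ?_ (Finset.sum_le_sum hstep)
  have e : ∀ r : Finset ℕ, F (L - logProd r) ^ 2 =
      ∑ i ∈ Finset.range (l + 1), ∑ j ∈ Finset.range (l + 1),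
        c i * c j * L ^ (l - i) * L ^ (l - j) * ((i + 1 + (j + 1)).choose (i + 1) : ℝ) *
          truncPow (i + 1 + (j + 1)) (L - logProd r) := by
    intro r
    rw [sq, hF, Finset.sum_mul_sum]
    refine Finset.sum_congr rfl fun i _ => Finset.sum_congr rfl fun j _ => ?_
    have := truncPow_mul (i + 1) (j + 1) (L - logProd r)
    calc _ = c i * c j * L ^ (l - i) * L ^ (l - j) *
          (truncPow (i + 1) (L - logProd r) * truncPow (j + 1) (L - logProd r)) := by ring
      _ = _ := by rw [this]; ring
  have e2 : ∑ r ∈ (primesIoc D X).powerset, roughDensity D ^ 2 *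
        ((∏ p ∈ r, (((k - 1 : ℕ) : ℝ) * ((p : ℝ) - ((k - 1 : ℕ) : ℝ))⁻¹)) *
        F (L - logProd r) ^ 2) =
      ∑ i ∈ Finset.range (l + 1), ∑ j ∈ Finset.range (l + 1), roughDensity D ^ 2 *
        (c i * c j * L ^ (l - i) * L ^ (l - j) * ((i + 1 + (j + 1)).choose (i + 1) : ℝ) *
          sieveSum (primesIoc D X)
            (fun p => ((k - 1 : ℕ) : ℝ) * ((p : ℝ) - ((k - 1 : ℕ) : ℝ))⁻¹)
            (i + 1 + (j + 1)) L) := by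
    simp only [e, sieveSum, Finset.mul_sum]
    rw [Finset.sum_comm]
    refine Finset.sum_congr rfl fun i _ => ?_
    rw [Finset.sum_comm]
    exact Finset.sum_congr rfl fun j _ => Finset.sum_congr rfl fun r _ => by ring
  rw [e2, lowerConst, Finset.mul_sum]
  refine Finset.sum_le_sum fun i hi => ?_
  rw [Finset.mul_sum]
  refine Finset.sum_le_sum fun j hj => ?_
  rw [Finset.mem_range] at hi hj
  have h1 := le_sieveSum_of_dim_one (primesIoc D X) (roughDensity D) (Real.log X) hρ.le
    (fun s hs j u hu huX => le_sieveSum_sdiff D X hX s hs j u hu huX) (k - 1)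
    (fun p hpP => by
      have h2 := (mem_primesIoc.1 hpP).1.1
      have h3 := h.two_mul_le
      omega) (i + 1 + (j + 1)) L hL hLX
  have h2k := h.two_le
  rw [truncPow_of_nonneg _ hL, show i + 1 + (j + 1) + (k - 1) = i + j + k + 1 by omega] at h1
  have hci := hc i
  have hcj := hc j
  have h2 : L ^ (2 * l + k + 1) = L ^ (l - i) * L ^ (l - j) * L ^ (i + j + k + 1) := by
    rw [← pow_add, ← pow_add]; congr 1; omega
  have h3 : roughDensity D ^ (k + 1) = roughDensity D ^ 2 * roughDensity D ^ (k - 1) := by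
    rw [← pow_add]; congr 1; omega
  rw [h2, h3]
  calc _ = roughDensity D ^ 2 *
        (c i * c j * L ^ (l - i) * L ^ (l - j) * ((i + 1 + (j + 1)).choose (i + 1) : ℝ) *
          (roughDensity D ^ (k - 1) * (L ^ (i + j + k + 1) / ((i + j + k + 1).factorial : ℝ)))) := by
        ring
    _ ≤ _ := by gcongr

end SieveParams

/-! ### Expansion of the squared divisor sum into residue classes -/

/-- The primes of `P` dividing one of the shifts `n + h`. -/
def dividingPrimes (P H : Finset ℕ) (n : ℕ) : Finset ℕ :=
  P.filter fun p => ∃ h ∈ H, p ∣ n + h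

/-- The sieve divisor sum at `n`. -/
noncomputable def divisorSum (P H : Finset ℕ) (lam : Finset ℕ → ℝ) (n : ℕ) : ℝ :=
  ∑ s ∈ (dividingPrimes P H n).powerset, lam s

theorem divisorSum_sq (P H : Finset ℕ) (lam : Finset ℕ → ℝ) (n : ℕ) :
    divisorSum P H lam n ^ 2 = ∑ s ∈ P.powerset, ∑ t ∈ P.powerset, lam s * lam t *
      (if s ∪ t ⊆ dividingPrimes P H n then 1 else 0) := by
  have h1 : divisorSum P H lam n =
      ∑ s ∈ P.powerset, if s ⊆ dividingPrimes P H n then lam s else 0 := by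
    rw [← Finset.sum_filter, divisorSum]
    congr 1
    ext s
    simp only [Finset.mem_filter, Finset.mem_powerset]
    exact ⟨fun h => ⟨h.trans (Finset.filter_subset _ _), h⟩, fun h => h.2⟩
  rw [h1, sq, Finset.sum_mul_sum]
  refine Finset.sum_congr rfl fun s _ => Finset.sum_congr rfl fun t _ => ?_
  by_cases h3 : s ⊆ dividingPrimes P H n <;> by_cases h4 : t ⊆ dividingPrimes P H n <;>
    simp [h3, h4, Finset.union_subset_iff]

theorem modEq_prod_iff (u : Finset ℕ) (hu : ∀ p ∈ u, p.Prime) (a b : ℕ) :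
    a ≡ b [MOD ∏ p ∈ u, p] ↔ ∀ p ∈ u, a ≡ b [MOD p] := by
  induction u using Finset.induction_on with
  | empty => simp [Nat.modEq_one]
  | insert p u hp ih =>
    have hu' : ∀ q ∈ u, q.Prime := fun q hq => hu q (Finset.mem_insert_of_mem hq)
    have hpp := hu p (Finset.mem_insert_self p u)
    have hc : Nat.Coprime p (∏ q ∈ u, q) := Nat.Coprime.prod_right fun q hq =>
      (Nat.coprime_primes hpp (hu' q hq)).2 fun h => hp (h ▸ hq)
    rw [Finset.prod_insert hp, ← Nat.modEq_and_modEq_iff_modEq_mul hc, ih hu']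
    simp

theorem exists_residue (W v : ℕ) (u : Finset ℕ) (hu : ∀ p ∈ u, p.Prime)
    (hW : ∀ p ∈ u, W.Coprime p) (c : ℕ → ℕ) :
    ∃ a : ℕ, ∀ n : ℕ, (n ≡ v [MOD W] ∧ ∀ p ∈ u, p ∣ n + c p) ↔ n ≡ a [MOD W * ∏ p ∈ u, p] := by
  -- `(p - 1) * c p` is `-c p` modulo `p`, written in the naturals.
  obtain ⟨b, hb⟩ := Nat.chineseRemainderOfFinset (fun p => (p - 1) * c p) (fun p => p) u
    (fun p hp => (hu p hp).ne_zero) (fun p hp q hq hpq => (Nat.coprime_primes (hu p hp) (hu q hq)).2 hpq)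
  have hWu : W.Coprime (∏ p ∈ u, p) := Nat.Coprime.prod_right hW
  obtain ⟨a, ha1, ha2⟩ := Nat.chineseRemainder hWu v b
  refine ⟨a, fun n => ?_⟩
  rw [← Nat.modEq_and_modEq_iff_modEq_mul hWu]
  refine and_congr ⟨fun h => h.trans ha1.symm, fun h => h.trans ha1⟩ ?_
  have h1 : n ≡ a [MOD ∏ p ∈ u, p] ↔ n ≡ b [MOD ∏ p ∈ u, p] :=
    ⟨fun h => h.trans ha2, fun h => h.trans ha2.symm⟩
  rw [h1, modEq_prod_iff u hu]
  refine forall₂_congr fun p hp => ?_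
  have h2 : b + c p ≡ 0 [MOD p] := by
    have h3 := (hb p hp).add_right (c p)
    have h4 : (p - 1) * c p + c p = p * c p := by
      obtain ⟨m, rfl⟩ : ∃ m, p = m + 1 := ⟨p - 1, by have := (hu p hp).pos; omega⟩
      simp; ring
    rw [h4] at h3
    exact h3.trans (Nat.modEq_zero_iff_dvd.2 (dvd_mul_right _ _))
  rw [← Nat.modEq_zero_iff_dvd]
  exact ⟨fun h => Nat.ModEq.add_right_cancel' (c p) (h.trans h2.symm),
    fun h => (h.add_right (c p)).trans h2⟩

/-- The shifts are distinct modulo each `p`, so a prime of `u` divides `n + h` for at most one `h ∈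
H`, and indicators add without overlap. The `|H|^|u|` choices of shifts become `|H|^|u|` residue
classes. -/
theorem indicator_subset_dividingPrimes (P H : Finset ℕ)
    (hH : ∀ p ∈ P, ∀ h ∈ H, ∀ h' ∈ H, h ≡ h' [MOD p] → h = h') (u : Finset ℕ) (hu : u ⊆ P)
    (n : ℕ) :
    (if u ⊆ dividingPrimes P H n then (1 : ℝ) else 0) =
      ∑ c ∈ u.pi fun _ => H, if ∀ p (hp : p ∈ u), p ∣ n + c p hp then 1 else 0 := by
  have h1 : ∀ p ∈ u, (∑ h ∈ H, if p ∣ n + h then (1 : ℝ) else 0) =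
      if p ∈ dividingPrimes P H n then 1 else 0 := by
    intro p hp
    split_ifs with h
    · obtain ⟨_, h0, h0H, hd⟩ := Finset.mem_filter.1 h
      rw [Finset.sum_eq_single_of_mem h0 h0H, if_pos hd]
      intro h' hh' hne
      rw [if_neg]
      intro hd'
      refine hne (hH p (hu hp) h' hh' h0 h0H ?_)
      exact Nat.ModEq.add_left_cancel' n
        ((Nat.modEq_zero_iff_dvd.2 hd').trans (Nat.modEq_zero_iff_dvd.2 hd).symm)
    · refine Finset.sum_eq_zero fun h' hh' => if_neg fun hd => h ?_
      exact Finset.mem_filter.2 ⟨hu hp, h', hh', hd⟩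
  have h2 : (if u ⊆ dividingPrimes P H n then (1 : ℝ) else 0) =
      ∏ p ∈ u, if p ∈ dividingPrimes P H n then (1 : ℝ) else 0 := by
    rw [Finset.prod_ite_zero]
    simp [Finset.subset_iff]
  rw [h2, ← Finset.prod_congr rfl h1, Finset.prod_sum]
  refine Finset.sum_congr rfl fun c _ => ?_
  rw [Finset.prod_ite_zero]
  simp

/-- Expansion of the sieve sum in terms of sums over residue classes. -/
theorem abs_sum_divisorSum_sq_sub_le (P H : Finset ℕ) (hP : ∀ p ∈ P, p.Prime)
    (hH : ∀ p ∈ P, ∀ h ∈ H, ∀ h' ∈ H, h ≡ h' [MOD p] → h = h') (W v : ℕ)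
    (hW : ∀ p ∈ P, W.Coprime p) (I : Finset ℕ) (ψ : ℕ → ℝ) (M : ℝ) (g : ℕ → ℝ)
    (Err : Finset ℕ → ℝ) (lam : Finset ℕ → ℝ)
    (hErr : ∀ u ⊆ P, ∀ a, a ≡ v [MOD W] → (∀ p ∈ u, ∃ h ∈ H, p ∣ a + h) →
      |(∑ n ∈ I with n ≡ a [MOD W * ∏ p ∈ u, p], ψ n) - M * ∏ p ∈ u, g p| ≤ Err u) :
    |(∑ n ∈ I with n ≡ v [MOD W], ψ n * divisorSum P H lam n ^ 2) -
        M * quadForm P lam (fun p => (H.card : ℝ) * g p)| ≤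
      ∑ s ∈ P.powerset, ∑ t ∈ P.powerset,
        |lam s| * |lam t| * ((H.card : ℝ) ^ (s ∪ t).card * Err (s ∪ t)) := by
  have key : ∀ u ⊆ P, |(∑ n ∈ I with n ≡ v [MOD W], ψ n *
      (if u ⊆ dividingPrimes P H n then 1 else 0)) - M * ∏ p ∈ u, ((H.card : ℝ) * g p)| ≤
      (H.card : ℝ) ^ u.card * Err u := by
    intro u hu
    have hcard : ((u.pi fun _ => H).card : ℝ) = (H.card : ℝ) ^ u.card := by
      rw [Finset.card_pi, Finset.prod_const]; push_cast; rfl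
    have e1 : M * ∏ p ∈ u, ((H.card : ℝ) * g p) =
        ∑ _c ∈ u.pi fun _ => H, M * ∏ p ∈ u, g p := by
      rw [Finset.sum_const, nsmul_eq_mul, hcard, Finset.prod_mul_distrib, Finset.prod_const]
      ring
    have e2 : (∑ n ∈ I with n ≡ v [MOD W], ψ n *
        (if u ⊆ dividingPrimes P H n then 1 else 0)) =
        ∑ c ∈ u.pi fun _ => H, ∑ n ∈ I with n ≡ v [MOD W],
          ψ n * (if ∀ p (hp : p ∈ u), p ∣ n + c p hp then 1 else 0) := by
      rw [Finset.sum_comm]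
      refine Finset.sum_congr rfl fun n _ => ?_
      rw [indicator_subset_dividingPrimes P H hH u hu n, Finset.mul_sum]
    rw [e1, e2, ← Finset.sum_sub_distrib]
    refine (Finset.abs_sum_le_sum_abs _ _).trans ?_
    rw [← hcard, ← nsmul_eq_mul]
    refine Finset.sum_le_card_nsmul _ _ _ fun c hc => ?_
    rw [Finset.mem_pi] at hc
    obtain ⟨a, ha⟩ := exists_residue W v u (fun p hp => hP p (hu hp)) (fun p hp => hW p (hu hp))
      (fun p => if hp : p ∈ u then c p hp else 0)
    have ha' := (ha a).2 rfl
    have e3 : (∑ n ∈ I with n ≡ v [MOD W],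
          ψ n * (if ∀ p (hp : p ∈ u), p ∣ n + c p hp then 1 else 0)) =
        ∑ n ∈ I with n ≡ a [MOD W * ∏ p ∈ u, p], ψ n := by
      rw [Finset.sum_filter, Finset.sum_filter]
      refine Finset.sum_congr rfl fun n _ => ?_
      have h1 : (∀ p ∈ u, p ∣ n + (if hp : p ∈ u then c p hp else 0)) ↔
          ∀ p (hp : p ∈ u), p ∣ n + c p hp :=
        forall₂_congr fun p hp => by rw [dif_pos hp]
      have h2 := ha n
      rw [h1] at h2
      by_cases h3 : n ≡ v [MOD W] <;> by_cases h4 : ∀ p (hp : p ∈ u), p ∣ n + c p hp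
      · rw [if_pos h3, if_pos h4, if_pos (h2.1 ⟨h3, h4⟩), mul_one]
      · rw [if_pos h3, if_neg h4, if_neg (fun h => h4 (h2.2 h).2), mul_zero]
      · rw [if_neg h3, if_neg (fun h => h3 (h2.2 h).1)]
      · rw [if_neg h3, if_neg (fun h => h3 (h2.2 h).1)]
    rw [e3]
    refine hErr u hu a ha'.1 fun p hp => ?_
    have := ha'.2 p hp
    rw [dif_pos hp] at this
    exact ⟨_, hc p hp, this⟩
  have e4 : (∑ n ∈ I with n ≡ v [MOD W], ψ n * divisorSum P H lam n ^ 2) =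
      ∑ s ∈ P.powerset, ∑ t ∈ P.powerset, lam s * lam t *
        ∑ n ∈ I with n ≡ v [MOD W], ψ n *
          (if s ∪ t ⊆ dividingPrimes P H n then 1 else 0) := by
    simp only [divisorSum_sq, Finset.mul_sum]
    rw [Finset.sum_comm]
    refine Finset.sum_congr rfl fun s _ => ?_
    rw [Finset.sum_comm]
    exact Finset.sum_congr rfl fun t _ => Finset.sum_congr rfl fun n _ => by ring
  rw [e4, quadForm, Finset.mul_sum, ← Finset.sum_sub_distrib]
  refine (Finset.abs_sum_le_sum_abs _ _).trans (Finset.sum_le_sum fun s hs => ?_)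
  rw [Finset.mul_sum, ← Finset.sum_sub_distrib]
  refine (Finset.abs_sum_le_sum_abs _ _).trans (Finset.sum_le_sum fun t ht => ?_)
  rw [Finset.mem_powerset] at hs ht
  have h5 := key (s ∪ t) (Finset.union_subset hs ht)
  rw [← abs_mul]
  refine le_trans (le_of_eq ?_) (mul_le_mul_of_nonneg_left h5 (abs_nonneg (lam s * lam t)))
  rw [← abs_mul]
  congr 1
  ring

theorem logProd_union_le (s t : Finset ℕ) : logProd (s ∪ t) ≤ logProd s + logProd t := by
  have h : logProd (s ∪ t) + logProd (s ∩ t) = logProd s + logProd t := Finset.sum_union_inter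
  linarith [logProd_nonneg (s ∩ t)]

/-- Error terms over pairs collapse to error terms over their unions. -/
theorem sum_pairs_le (P : Finset ℕ) (lam : Finset ℕ → ℝ) (B L : ℝ) (hB : 0 ≤ B)
    (hlam : ∀ s ⊆ P, |lam s| ≤ 2 ^ s.card * B) (hsupp : ∀ s, L < logProd s → lam s = 0)
    (E : Finset ℕ → ℝ) (hE : ∀ u ⊆ P, 0 ≤ E u) (κ : ℝ) (hκ : 0 ≤ κ) :
    ∑ s ∈ P.powerset, ∑ t ∈ P.powerset, |lam s| * |lam t| * (κ ^ (s ∪ t).card * E (s ∪ t)) ≤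
      B ^ 2 * ∑ u ∈ P.powerset with logProd u ≤ 2 * L, (16 * κ) ^ u.card * E u := by
  have h1 : ∑ s ∈ P.powerset, ∑ t ∈ P.powerset,
        |lam s| * |lam t| * (κ ^ (s ∪ t).card * E (s ∪ t)) ≤
      ∑ s ∈ P.powerset, ∑ t ∈ P.powerset, if logProd (s ∪ t) ≤ 2 * L then
        B ^ 2 * (4 ^ (s ∪ t).card * (κ ^ (s ∪ t).card * E (s ∪ t))) else 0 := by
    refine Finset.sum_le_sum fun s hs => Finset.sum_le_sum fun t ht => ?_
    rw [Finset.mem_powerset] at hs ht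
    have hEu := hE (s ∪ t) (Finset.union_subset hs ht)
    have hpos : 0 ≤ κ ^ (s ∪ t).card * E (s ∪ t) := by positivity
    rcases lt_or_ge L (logProd s) with h | h
    · rw [hsupp s h]
      simp only [abs_zero, zero_mul]
      split_ifs <;> positivity
    rcases lt_or_ge L (logProd t) with h' | h'
    · rw [hsupp t h']
      simp only [abs_zero, zero_mul, mul_zero]
      split_ifs <;> positivity
    rw [if_pos (by linarith [logProd_union_le s t])]
    have h2 : |lam s| * |lam t| ≤ B ^ 2 * 4 ^ (s ∪ t).card := by
      calc |lam s| * |lam t| ≤ (2 ^ s.card * B) * (2 ^ t.card * B) :=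
            mul_le_mul (hlam s hs) (hlam t ht) (abs_nonneg _) (by positivity)
        _ ≤ (2 ^ (s ∪ t).card * B) * (2 ^ (s ∪ t).card * B) := by
            have h3 : s.card ≤ (s ∪ t).card := Finset.card_le_card Finset.subset_union_left
            have h4 : t.card ≤ (s ∪ t).card := Finset.card_le_card Finset.subset_union_right
            gcongr <;> norm_num
        _ = _ := by
            rw [show (4 : ℝ) = 2 * 2 by norm_num, mul_pow]; ring
    calc _ ≤ B ^ 2 * 4 ^ (s ∪ t).card * (κ ^ (s ∪ t).card * E (s ∪ t)) :=
          mul_le_mul_of_nonneg_right h2 hpos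
      _ = _ := by ring
  refine h1.trans ?_
  rw [← Finset.sum_product']
  have hmaps : ∀ x ∈ P.powerset ×ˢ P.powerset, x.1 ∪ x.2 ∈ P.powerset := fun x hx => by
    rw [Finset.mem_product, Finset.mem_powerset, Finset.mem_powerset] at hx
    exact Finset.mem_powerset.2 (Finset.union_subset hx.1 hx.2)
  rw [← Finset.sum_fiberwise_of_maps_to hmaps, Finset.sum_filter, Finset.mul_sum]
  refine Finset.sum_le_sum fun u hu => ?_
  have hEu := hE u (Finset.mem_powerset.1 hu)
  -- At most `4^|u|` pairs have union `u`, and their weights contribute another `4^|u|`; hence the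
  -- `16`.
  have hcard : (((P.powerset ×ˢ P.powerset).filter (fun x => x.1 ∪ x.2 = u)).card : ℝ) ≤
      4 ^ u.card := by
    have hsub : (P.powerset ×ˢ P.powerset).filter (fun x => x.1 ∪ x.2 = u) ⊆
        u.powerset ×ˢ u.powerset := fun x hx => by
      rw [Finset.mem_filter] at hx
      rw [Finset.mem_product, Finset.mem_powerset, Finset.mem_powerset, ← hx.2]
      exact ⟨Finset.subset_union_left, Finset.subset_union_right⟩
    have h3 := Finset.card_le_card hsub
    rw [Finset.card_product, Finset.card_powerset, ← mul_pow] at h3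
    exact_mod_cast h3
  have hval : ∀ x ∈ (P.powerset ×ˢ P.powerset).filter (fun x => x.1 ∪ x.2 = u),
      (if logProd (x.1 ∪ x.2) ≤ 2 * L then
        B ^ 2 * (4 ^ (x.1 ∪ x.2).card * (κ ^ (x.1 ∪ x.2).card * E (x.1 ∪ x.2))) else 0) =
      if logProd u ≤ 2 * L then B ^ 2 * (4 ^ u.card * (κ ^ u.card * E u)) else 0 := by
    intro x hx
    rw [(Finset.mem_filter.1 hx).2]
  rw [Finset.sum_congr rfl hval, Finset.sum_const, nsmul_eq_mul]
  split_ifs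
  · calc _ ≤ 4 ^ u.card * (B ^ 2 * (4 ^ u.card * (κ ^ u.card * E u))) := by gcongr
      _ = _ := by
        rw [mul_pow, show (16 : ℝ) = 4 * 4 by norm_num, mul_pow]; ring
  · simp

/-! ### Integers and primes in arithmetic progressions -/

theorem abs_card_modEq_sub_le (a M N q : ℕ) (hMN : M ≤ N) (hq : 0 < q) :
    |(((Finset.Ioc M N).filter (fun n => n ≡ a [MOD q])).card : ℝ) - ((N : ℝ) - M) / q| ≤ 1 := by
  have h := Nat.Ioc_filter_modEq_card M N hq a
  have hle : ⌊((M : ℚ) - a) / q⌋ ≤ ⌊((N : ℚ) - a) / q⌋ := by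
    apply Int.floor_mono
    gcongr
  rw [max_eq_left (by linarith)] at h
  have h1 : (((Finset.Ioc M N).filter (fun n => n ≡ a [MOD q])).card : ℚ) =
      (⌊((N : ℚ) - a) / q⌋ : ℚ) - (⌊((M : ℚ) - a) / q⌋ : ℚ) := by
    exact_mod_cast h
  have h2 : |(((Finset.Ioc M N).filter (fun n => n ≡ a [MOD q])).card : ℚ) -
      ((N : ℚ) - M) / q| ≤ 1 := by
    rw [h1]
    have f1 := Int.floor_le (((N : ℚ) - a) / q)
    have f2 := Int.lt_floor_add_one (((N : ℚ) - a) / q)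
    have f3 := Int.floor_le (((M : ℚ) - a) / q)
    have f4 := Int.lt_floor_add_one (((M : ℚ) - a) / q)
    have f5 : ((N : ℚ) - a) / q = ((M : ℚ) - a) / q + ((N : ℚ) - M) / q := by ring
    rw [f5] at f1 f2 ⊢
    rw [abs_le]
    constructor <;> linarith
  have h3 := (Rat.cast_le (K := ℝ)).2 h2
  push_cast at h3
  exact h3

theorem maxError_nonneg (x : ℝ) (q : ℕ) : 0 ≤ maxError x q :=
  Real.iSup_nonneg fun _ => abs_nonneg _

theorem maxErrorStar_nonneg (N : ℝ) (q : ℕ) : 0 ≤ maxErrorStar N q :=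
  Real.sSup_nonneg (by rintro _ ⟨x, _, rfl⟩; exact maxError_nonneg x q)

theorem abs_errorTerm_le (N x : ℝ) (hx : 0 < x) (hxN : x ≤ N) (q : ℕ) (hq : 0 < q)
    (a : (ZMod q)ˣ) : |errorTerm x q (a : ZMod q)| ≤ maxErrorStar N q := by
  have : NeZero q := ⟨hq.ne'⟩
  have h1 : |errorTerm x q (a : ZMod q)| ≤ maxError x q :=
    le_ciSup (f := fun a : (ZMod q)ˣ => |errorTerm x q (a : ZMod q)|)
      (Set.finite_range _).bddAbove a
  exact h1.trans (le_csSup (bddAbove_maxError N q) ⟨x, ⟨hx, hxN⟩, rfl⟩)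

theorem varpi_le_log {n : ℕ} {x : ℝ} (hn : (n : ℝ) ≤ x) (hx : 1 ≤ x) : varpi n ≤ Real.log x := by
  unfold varpi
  split_ifs with h
  · exact Real.log_le_log (by exact_mod_cast h.pos) hn
  · exact Real.log_nonneg hx

/-- The trivial bound. It is used only against a negative power of `log N`, to control sets `u` with
large `b^|u|`. -/
theorem maxErrorStar_le (M : ℝ) (q : ℕ) (hq : 0 < q) (hM : 1 ≤ M) (hqM : (q : ℝ) ≤ M) :
    maxErrorStar M q ≤ 3 * M / q * Real.log (2 * M) + M / (Nat.totient q : ℝ) := by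
  have : NeZero q := ⟨hq.ne'⟩
  have hq' : (0 : ℝ) < q := by exact_mod_cast hq
  refine csSup_le ⟨_, M, ⟨by linarith, le_rfl⟩, rfl⟩ ?_
  rintro _ ⟨x, ⟨hx0, hxM⟩, rfl⟩
  refine ciSup_le fun a => ?_
  have hlog : 0 ≤ Real.log (2 * M) := Real.log_nonneg (by linarith)
  have h1 : (∑ n ∈ (Finset.Ioc ⌊x⌋₊ ⌊2 * x⌋₊).filter
      (fun n : ℕ => (n : ZMod q) = (a : ZMod q)), varpi n) ≤ 3 * M / q * Real.log (2 * M) := by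
    have e : (Finset.Ioc ⌊x⌋₊ ⌊2 * x⌋₊).filter (fun n : ℕ => (n : ZMod q) = (a : ZMod q)) =
        (Finset.Ioc ⌊x⌋₊ ⌊2 * x⌋₊).filter (fun n : ℕ => n ≡ (a : ZMod q).val [MOD q]) := by
      refine Finset.filter_congr fun n _ => ?_
      rw [← ZMod.natCast_eq_natCast_iff, ZMod.natCast_zmod_val]
    have hle : ⌊x⌋₊ ≤ ⌊2 * x⌋₊ := Nat.floor_mono (by linarith)
    have hc := abs_le.1 (abs_card_modEq_sub_le (a : ZMod q).val _ _ q hle hq)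
    rw [e]
    refine (Finset.sum_le_card_nsmul _ _ (Real.log (2 * M)) fun n hn => ?_).trans ?_
    · refine varpi_le_log ?_ (by linarith)
      have h2 := (Finset.mem_Ioc.1 (Finset.mem_filter.1 hn).1).2
      have h3 : (n : ℝ) ≤ 2 * x := (Nat.cast_le.2 h2).trans (Nat.floor_le (by linarith))
      linarith
    · rw [nsmul_eq_mul]
      refine mul_le_mul_of_nonneg_right ?_ hlog
      have h4 : ((⌊2 * x⌋₊ : ℕ) : ℝ) - ((⌊x⌋₊ : ℕ) : ℝ) ≤ M + 1 := by
        have := Nat.floor_le (show 0 ≤ 2 * x by linarith)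
        have := Nat.lt_floor_add_one x
        linarith
      have h5 : (((⌊2 * x⌋₊ : ℕ) : ℝ) - ((⌊x⌋₊ : ℕ) : ℝ)) / q ≤ (M + 1) / q := by gcongr
      have h6 : (1 : ℝ) ≤ M / q := by rwa [le_div_iff₀ hq', one_mul]
      have h7 : (M + 1) / q ≤ 2 * (M / q) := by
        rw [← mul_div_assoc]
        gcongr
        linarith
      have h8 : 3 * M / q = 3 * (M / q) := by ring
      linarith [hc.2]
  have h0 : 0 ≤ ∑ n ∈ (Finset.Ioc ⌊x⌋₊ ⌊2 * x⌋₊).filter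
      (fun n : ℕ => (n : ZMod q) = (a : ZMod q)), varpi n :=
    Finset.sum_nonneg fun n _ => varpi_nonneg n
  have h2 : x / (Nat.totient q : ℝ) ≤ M / (Nat.totient q : ℝ) := by gcongr
  have h3 : 0 ≤ x / (Nat.totient q : ℝ) := by positivity
  have h4 : 0 ≤ 3 * M / q * Real.log (2 * M) := by positivity
  unfold errorTerm
  rw [abs_le]
  constructor <;> linarith

theorem sum_varpi_shift_sub_le (N m q a : ℕ) (hN : 1 ≤ N) (hmN : m ≤ N) (hq : 0 < q)
    (ha : (a + m).Coprime q) :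
    |(∑ n ∈ Finset.Ioc N (2 * N) with n ≡ a [MOD q], varpi (n + m)) - N / (Nat.totient q : ℝ)| ≤
      maxErrorStar (2 * N) q + m * (Real.log (4 * N) + 1) := by
  have hN' : (1 : ℝ) ≤ N := by exact_mod_cast hN
  have hm' : (m : ℝ) ≤ N := by exact_mod_cast hmN
  have hm0 : (0 : ℝ) ≤ m := m.cast_nonneg
  -- Taking `x = N + m ≤ 2N` covers `(N + m, 2N + 2m]`, which exceeds the shifted interval by `m`
  -- integers, each contributing at most `log (4N)`.
  have h1 := abs_errorTerm_le (2 * N) ((N + m : ℕ) : ℝ) (by exact_mod_cast (by omega : 0 < N + m))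
    (by push_cast; linarith) q hq (ZMod.unitOfCoprime (a + m) ha)
  rw [ZMod.coe_unitOfCoprime, errorTerm, Nat.floor_natCast,
    show (2 * ((N + m : ℕ) : ℝ)) = ((2 * N + m + m : ℕ) : ℝ) by push_cast; ring,
    Nat.floor_natCast] at h1
  have hfil : ∀ A : Finset ℕ, A.filter (fun n : ℕ => (n : ZMod q) = ((a + m : ℕ) : ZMod q)) =
      A.filter (fun n => n ≡ a + m [MOD q]) := fun A =>
    Finset.filter_congr fun n _ => ZMod.natCast_eq_natCast_iff _ _ _
  rw [hfil] at h1
  have e1 : (∑ n ∈ Finset.Ioc N (2 * N) with n ≡ a [MOD q], varpi (n + m)) =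
      ∑ n ∈ Finset.Ioc (N + m) (2 * N + m) with n ≡ a + m [MOD q], varpi n := by
    refine Finset.sum_nbij' (fun n => n + m) (fun n => n - m) ?_ ?_ ?_ ?_ ?_
    · intro n hn
      rw [Finset.mem_filter, Finset.mem_Ioc] at hn ⊢
      exact ⟨by omega, hn.2.add_right m⟩
    · intro n hn
      rw [Finset.mem_filter, Finset.mem_Ioc] at hn ⊢
      refine ⟨by omega, ?_⟩
      refine Nat.ModEq.add_right_cancel' m ?_
      rw [Nat.sub_add_cancel (by omega)]
      exact hn.2
    · intro n _; simp
    · intro n hn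
      rw [Finset.mem_filter, Finset.mem_Ioc] at hn
      exact Nat.sub_add_cancel (by omega)
    · intro n _; rfl
  have e2 : (∑ n ∈ Finset.Ioc (N + m) (2 * N + m + m) with n ≡ a + m [MOD q], varpi n) =
      (∑ n ∈ Finset.Ioc (N + m) (2 * N + m) with n ≡ a + m [MOD q], varpi n) +
      ∑ n ∈ Finset.Ioc (2 * N + m) (2 * N + m + m) with n ≡ a + m [MOD q], varpi n := by
    rw [← Finset.Ioc_union_Ioc_eq_Ioc (show N + m ≤ 2 * N + m by omega)
      (show 2 * N + m ≤ 2 * N + m + m by omega), Finset.filter_union, Finset.sum_union]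
    refine Finset.disjoint_filter_filter ?_
    rw [Finset.disjoint_left]
    intro x hx hx'
    rw [Finset.mem_Ioc] at hx hx'
    omega
  have hlog : 0 ≤ Real.log (4 * N) := Real.log_nonneg (by linarith)
  have h2 : ∑ n ∈ Finset.Ioc (2 * N + m) (2 * N + m + m) with n ≡ a + m [MOD q], varpi n ≤
      m * Real.log (4 * N) := by
    calc _ ≤ ∑ n ∈ Finset.Ioc (2 * N + m) (2 * N + m + m), varpi n :=
          Finset.sum_le_sum_of_subset_of_nonneg (Finset.filter_subset _ _)
            fun n _ _ => varpi_nonneg n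
      _ ≤ (Finset.Ioc (2 * N + m) (2 * N + m + m)).card • Real.log (4 * N) := by
          refine Finset.sum_le_card_nsmul _ _ _ fun n hn => varpi_le_log ?_ (by linarith)
          rw [Finset.mem_Ioc] at hn
          exact_mod_cast (by omega : n ≤ 4 * N)
      _ = _ := by rw [Nat.card_Ioc, nsmul_eq_mul]; congr 2; omega
  have h3 : 0 ≤ ∑ n ∈ Finset.Ioc (2 * N + m) (2 * N + m + m) with n ≡ a + m [MOD q], varpi n :=
    Finset.sum_nonneg fun n _ => varpi_nonneg n
  have h4 : ((N + m : ℕ) : ℝ) / (Nat.totient q : ℝ) =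
      N / (Nat.totient q : ℝ) + m / (Nat.totient q : ℝ) := by push_cast; ring
  have h5 : (m : ℝ) / (Nat.totient q : ℝ) ≤ m :=
    div_le_self hm0 (by exact_mod_cast Nat.totient_pos.2 hq)
  have h6 : 0 ≤ (m : ℝ) / (Nat.totient q : ℝ) := by positivity
  rw [e2, h4] at h1
  rw [e1]
  rw [abs_le] at h1 ⊢
  constructor <;> nlinarith [h1.1, h1.2]

theorem coprime_factorial_of_mem {D X p : ℕ} (hp : p ∈ primesIoc D X) : D.factorial.Coprime p := by
  obtain ⟨⟨h1, _⟩, h2⟩ := mem_primesIoc.1 hp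
  rw [Nat.coprime_comm, h2.coprime_iff_not_dvd, h2.dvd_factorial]
  omega

theorem eq_of_modEq_of_mem {D X : ℕ} {H : Finset ℕ} (hH : ∀ h ∈ H, h ≤ D) :
    ∀ p ∈ primesIoc D X, ∀ h ∈ H, ∀ h' ∈ H, h ≡ h' [MOD p] → h = h' := by
  intro p hp h hh h' hh' hmod
  have h1 := (mem_primesIoc.1 hp).1.1
  exact hmod.eq_of_lt_of_lt ((hH h hh).trans_lt h1) ((hH h' hh').trans_lt h1)

theorem totient_prod_primes (u : Finset ℕ) (hu : ∀ p ∈ u, p.Prime) :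
    (Nat.totient (∏ p ∈ u, p) : ℝ) = ∏ p ∈ u, ((p : ℝ) - 1) := by
  induction u using Finset.induction_on with
  | empty => simp
  | insert p u hp ih =>
    have hu' : ∀ q ∈ u, q.Prime := fun q hq => hu q (Finset.mem_insert_of_mem hq)
    have hpp := hu p (Finset.mem_insert_self p u)
    have hc : Nat.Coprime p (∏ q ∈ u, q) := Nat.Coprime.prod_right fun q hq =>
      (Nat.coprime_primes hpp (hu' q hq)).2 fun h => hp (h ▸ hq)
    rw [Finset.prod_insert hp, Finset.prod_insert hp, Nat.totient_mul hc, Nat.totient_prime hpp,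
      Nat.cast_mul, ih hu', Nat.cast_sub hpp.one_le, Nat.cast_one]

theorem totient_factorial_mul_prod {D X : ℕ} {u : Finset ℕ} (hu : u ⊆ primesIoc D X) :
    (Nat.totient (D.factorial * ∏ p ∈ u, p) : ℝ) =
      Nat.totient D.factorial * ∏ p ∈ u, ((p : ℝ) - 1) := by
  rw [Nat.totient_mul (Nat.Coprime.prod_right fun p hp => coprime_factorial_of_mem (hu hp)),
    Nat.cast_mul, totient_prod_primes u fun p hp => prime_of_mem_primesIoc (hu hp)]

/-! ### The two sieve sums -/

/-- The sum of the sieve weight over integers in `(N, 2N]`. -/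
theorem sum_divisorSum_sq_le (D X N v : ℕ) (H : Finset ℕ) (hH : ∀ h ∈ H, h ≤ D)
    (lam : Finset ℕ → ℝ) (B L : ℝ) (hB : 0 ≤ B)
    (hlam : ∀ s ⊆ primesIoc D X, |lam s| ≤ 2 ^ s.card * B)
    (hsupp : ∀ s, L < logProd s → lam s = 0) :
    (∑ n ∈ Finset.Ioc N (2 * N) with n ≡ v [MOD D.factorial],
        divisorSum (primesIoc D X) H lam n ^ 2) ≤
      N / D.factorial * quadForm (primesIoc D X) lam (fun p => (H.card : ℝ) / p) +
      B ^ 2 * ∑ u ∈ (primesIoc D X).powerset with logProd u ≤ 2 * L,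
        (16 * (H.card : ℝ)) ^ u.card := by
  have h1 := abs_sum_divisorSum_sq_sub_le (primesIoc D X) H
    (fun p hp => prime_of_mem_primesIoc hp) (eq_of_modEq_of_mem hH) D.factorial v
    (fun p hp => coprime_factorial_of_mem hp) (Finset.Ioc N (2 * N)) (fun _ => 1)
    ((N : ℝ) / D.factorial) (fun p => (p : ℝ)⁻¹) (fun _ => 1) lam ?_
  · have h2 := sum_pairs_le (primesIoc D X) lam B L hB hlam hsupp (fun _ => 1)
      (fun _ _ => zero_le_one) (H.card : ℝ) H.card.cast_nonneg
    have h3 := (le_abs_self _).trans (h1.trans h2)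
    simp only [mul_one, one_mul] at h3
    simp only [div_eq_mul_inv] at h3 ⊢
    linarith
  · intro u hu a _ _
    have hpos : 0 < D.factorial * ∏ p ∈ u, p := Nat.mul_pos D.factorial_pos
      (prod_pos_of_prime fun p hp => prime_of_mem_primesIoc (hu hp))
    have h2 := abs_card_modEq_sub_le a N (2 * N) _ (by omega) hpos
    rw [Finset.sum_const, nsmul_eq_mul, mul_one]
    convert h2 using 3
    push_cast
    rw [Finset.prod_inv_distrib, div_mul_eq_div_div, ← div_eq_mul_inv]
    congr 2
    ring

/-- The sum of the sieve weight over primes. -/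
theorem le_sum_varpi_divisorSum_sq (D X N v : ℕ) (hN : 1 ≤ N) (hXN : X ≤ N) (hDN : D ≤ N)
    (H : Finset ℕ) (hH : ∀ h ∈ H, h ≤ D)
    (m : ℕ) (hm : m ∈ H) (hv : (v + m).Coprime D.factorial) (lam : Finset ℕ → ℝ) (B L : ℝ)
    (hB : 0 ≤ B)
    (hlam : ∀ s ⊆ primesIoc D X, |lam s| ≤ 2 ^ s.card * B)
    (hsupp : ∀ s, L < logProd s → lam s = 0) :
    N / (Nat.totient D.factorial : ℝ) *
        quadForm (primesIoc D X) lam (fun p => ((H.card : ℝ) - 1) / ((p : ℝ) - 1)) -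
      B ^ 2 * ∑ u ∈ (primesIoc D X).powerset with logProd u ≤ 2 * L,
        (16 * (H.card : ℝ)) ^ u.card *
          (maxErrorStar (2 * N) (D.factorial * ∏ p ∈ u, p) + D * (Real.log (4 * N) + 1)) ≤
    ∑ n ∈ Finset.Ioc N (2 * N) with n ≡ v [MOD D.factorial],
        varpi (n + m) * divisorSum (primesIoc D X) H lam n ^ 2 := by
  have hlog : 0 ≤ Real.log (4 * N) + 1 := by
    have : (1 : ℝ) ≤ N := by exact_mod_cast hN
    have := Real.log_nonneg (show (1 : ℝ) ≤ 4 * N by linarith)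
    linarith
  have hcard : ((H.erase m).card : ℝ) = (H.card : ℝ) - 1 := by
    rw [Finset.card_erase_of_mem hm, Nat.cast_sub (Finset.card_pos.2 ⟨m, hm⟩), Nat.cast_one]
  have hE0 : ∀ u ⊆ primesIoc D X, 0 ≤ maxErrorStar (2 * N) (D.factorial * ∏ p ∈ u, p) +
      D * (Real.log (4 * N) + 1) := fun u _ => by
    have := maxErrorStar_nonneg (2 * N) (D.factorial * ∏ p ∈ u, p)
    positivity
  -- If `n + m` is prime it exceeds `X`, so no sieving prime divides it. The shift `m` drops out,
  -- and `k` becomes `k - 1` in the quadratic form.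
  have hsum : ∑ n ∈ Finset.Ioc N (2 * N) with n ≡ v [MOD D.factorial],
        varpi (n + m) * divisorSum (primesIoc D X) H lam n ^ 2 =
      ∑ n ∈ Finset.Ioc N (2 * N) with n ≡ v [MOD D.factorial],
        varpi (n + m) * divisorSum (primesIoc D X) (H.erase m) lam n ^ 2 := by
    refine Finset.sum_congr rfl fun n hn => ?_
    by_cases hp : (n + m).Prime
    · have : dividingPrimes (primesIoc D X) H n = dividingPrimes (primesIoc D X) (H.erase m) n := by
        refine Finset.filter_congr fun p hpP => ?_
        refine ⟨?_, fun ⟨h, hh, hd⟩ => ⟨h, Finset.mem_of_mem_erase hh, hd⟩⟩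
        rintro ⟨h, hh, hd⟩
        refine ⟨h, Finset.mem_erase.2 ⟨?_, hh⟩, hd⟩
        rintro rfl
        have h1 := (Nat.prime_dvd_prime_iff_eq (prime_of_mem_primesIoc hpP) hp).1 hd
        have h2 := (mem_primesIoc.1 hpP).1.2
        have h3 := (Finset.mem_Ioc.1 (Finset.mem_filter.1 hn).1).1
        omega
      rw [divisorSum, divisorSum, this]
    · have : varpi (n + m) = 0 := if_neg hp
      rw [this, zero_mul, zero_mul]
  have h1 := abs_sum_divisorSum_sq_sub_le (primesIoc D X) (H.erase m)
    (fun p hp => prime_of_mem_primesIoc hp)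
    (eq_of_modEq_of_mem fun h hh => hH h (Finset.mem_of_mem_erase hh)) D.factorial v
    (fun p hp => coprime_factorial_of_mem hp) (Finset.Ioc N (2 * N)) (fun n => varpi (n + m))
    ((N : ℝ) / (Nat.totient D.factorial : ℝ)) (fun p => ((p : ℝ) - 1)⁻¹)
    (fun u => maxErrorStar (2 * N) (D.factorial * ∏ p ∈ u, p) +
      D * (Real.log (4 * N) + 1)) lam ?_
  · have h2 := sum_pairs_le (primesIoc D X) lam B L hB hlam hsupp _ hE0
      ((H.erase m).card : ℝ) (Nat.cast_nonneg _)
    have h3 := (abs_le.1 (h1.trans h2)).1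
    have h4 : ∑ u ∈ (primesIoc D X).powerset with logProd u ≤ 2 * L,
        (16 * ((H.erase m).card : ℝ)) ^ u.card *
          (maxErrorStar (2 * N) (D.factorial * ∏ p ∈ u, p) + D * (Real.log (4 * N) + 1)) ≤
        ∑ u ∈ (primesIoc D X).powerset with logProd u ≤ 2 * L,
        (16 * (H.card : ℝ)) ^ u.card *
          (maxErrorStar (2 * N) (D.factorial * ∏ p ∈ u, p) + D * (Real.log (4 * N) + 1)) := by
      refine Finset.sum_le_sum fun u hu => mul_le_mul_of_nonneg_right ?_
        (hE0 u (Finset.mem_powerset.1 (Finset.mem_filter.1 hu).1))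
      gcongr
      exact Finset.erase_subset _ _
    have h5 := mul_le_mul_of_nonneg_left h4 (sq_nonneg B)
    rw [hcard] at h3
    rw [hcard] at h5
    simp only [div_eq_mul_inv] at h3 ⊢
    rw [hsum]
    linarith
  · intro u hu a hav hua
    have hpos : 0 < D.factorial * ∏ p ∈ u, p := Nat.mul_pos D.factorial_pos
      (prod_pos_of_prime fun p hp => prime_of_mem_primesIoc (hu hp))
    -- Only reduced classes occur: each `p ∈ u` divides some `a + h` with `h ≠ m`, and the shifts
    -- are distinct modulo `p`.
    have hcop : (a + m).Coprime (D.factorial * ∏ p ∈ u, p) := by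
      refine Nat.Coprime.mul_right ?_ (Nat.Coprime.prod_right fun p hp => ?_)
      · have h2 := (hav.add_right m).gcd_eq
        rw [Nat.Coprime, h2]
        exact hv
      · have hpp := prime_of_mem_primesIoc (hu hp)
        rw [Nat.coprime_comm, hpp.coprime_iff_not_dvd]
        intro hd
        obtain ⟨h, hh, hd'⟩ := hua p hp
        rw [Finset.mem_erase] at hh
        refine hh.1 (eq_of_modEq_of_mem hH p (hu hp) h hh.2 m hm ?_)
        exact Nat.ModEq.add_left_cancel' a
          ((Nat.modEq_zero_iff_dvd.2 hd').trans (Nat.modEq_zero_iff_dvd.2 hd).symm)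
    have h2 := sum_varpi_shift_sub_le N m _ a hN ((hH m hm).trans hDN) hpos hcop
    rw [totient_factorial_mul_prod hu, div_mul_eq_div_div, div_eq_mul_inv (N / _ : ℝ),
      ← Finset.prod_inv_distrib] at h2
    refine h2.trans (add_le_add le_rfl (mul_le_mul_of_nonneg_right ?_ hlog))
    exact_mod_cast hH m hm

/-! ### Error terms and the inequality at finite `N` -/

/-- The sieve constant `∏ (1 - 1/p)`, up to a factor close to `1`. -/
noncomputable def upperDensity (k D : ℕ) : ℝ := Real.exp (2 * k / D) * roughDensity D

/-- The additive shift lost in each one-dimensional upper bound. -/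
noncomputable def logShift (D : ℕ) : ℝ := 1 + D.factorial / roughDensity D

theorem upperDensity_pos (k D : ℕ) : 0 < upperDensity k D :=
  mul_pos (Real.exp_pos _) (roughDensity_pos D)

theorem logShift_pos (D : ℕ) : 0 < logShift D := by
  have := roughDensity_pos D
  unfold logShift
  positivity

/-- A power of the logarithm bounding a divisor sum of dimension `b`. -/
noncomputable def divisorBound (k D b : ℕ) (L : ℝ) : ℝ :=
  upperDensity k D ^ b * (2 * L + b * logShift D) ^ b

/-- A bound for the sieve weights. -/
noncomputable def weightBound (k D : ℕ) (c : ℕ → ℝ) (l : ℕ) (L : ℝ) : ℝ :=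
  upperDensity k D ^ k * (∑ i ∈ Finset.range (l + 1), c i) * (L + k * logShift D) ^ (l + k)

theorem weightBound_nonneg (k D : ℕ) (c : ℕ → ℝ) (hc : ∀ i, 0 ≤ c i) (l : ℕ) {L : ℝ} (hL : 0 ≤ L) :
    0 ≤ weightBound k D c l L := by
  have := upperDensity_pos k D
  have := logShift_pos D
  have := Finset.sum_nonneg fun i (_ : i ∈ Finset.range (l + 1)) => hc i
  unfold weightBound
  positivity

namespace SieveParams

variable {k D X : ℕ}

theorem sieveSum_zero_le (h : SieveParams k D) (b : ℕ) (L : ℝ) (hL : 0 ≤ L) :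
    sieveSum (primesIoc D X) (fun p => b * ((p : ℝ) - k)⁻¹) 0 (2 * L) ≤ divisorBound k D b L := by
  have hA := upperDensity_pos k D
  have hC := logShift_pos D
  refine (h.sieveSum_kfold_le b 0 (2 * L)).trans ?_
  change upperDensity k D ^ b * truncPow (0 + b) (2 * L + b * logShift D) ≤ _
  rw [truncPow_of_nonneg _ (by positivity), zero_add]
  refine mul_le_mul_of_nonneg_left ?_ (by positivity)
  exact div_le_self (by positivity) (by exact_mod_cast Nat.factorial_pos _)

theorem prod_inv_le (h : SieveParams k D) {u : Finset ℕ} (hu : u ⊆ primesIoc D X) :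
    (((∏ p ∈ u, p : ℕ) : ℝ))⁻¹ ≤ ∏ p ∈ u, ((p : ℝ) - k)⁻¹ ∧
      (∏ p ∈ u, ((p : ℝ) - 1))⁻¹ ≤ ∏ p ∈ u, ((p : ℝ) - k)⁻¹ := by
  have hk := h.k_pos
  rw [Nat.cast_prod, ← Finset.prod_inv_distrib, ← Finset.prod_inv_distrib]
  constructor
  · refine Finset.prod_le_prod (fun p _ => by positivity) fun p hp => ?_
    have := h.lt_of_mem (hu hp)
    exact inv_anti₀ (by linarith) (by linarith)
  · refine Finset.prod_le_prod (fun p hp => ?_) fun p hp => ?_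
    · have := h.lt_of_mem (hu hp)
      exact inv_nonneg.2 (by linarith)
    · have := h.lt_of_mem (hu hp)
      exact inv_anti₀ (by linarith) (by linarith)

theorem sum_pow_card_mul_prod_le (h : SieveParams k D) (b : ℕ) (L : ℝ) (hL : 0 ≤ L) :
    ∑ u ∈ (primesIoc D X).powerset with logProd u ≤ 2 * L,
      (b : ℝ) ^ u.card * ∏ p ∈ u, ((p : ℝ) - k)⁻¹ ≤ divisorBound k D b L := by
  refine le_trans ?_ (h.sieveSum_zero_le (X := X) b L hL)
  rw [sieveSum]
  calc _ = ∑ u ∈ (primesIoc D X).powerset with logProd u ≤ 2 * L,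
      (∏ p ∈ u, (b * ((p : ℝ) - k)⁻¹)) * truncPow 0 (2 * L - logProd u) := by
        refine Finset.sum_congr rfl fun u hu => ?_
        rw [truncPow_of_nonneg 0 (by linarith [(Finset.mem_filter.1 hu).2]),
          Finset.prod_mul_distrib, Finset.prod_const]
        simp
    _ ≤ _ := Finset.sum_le_sum_of_subset_of_nonneg (Finset.filter_subset _ _) fun u hu _ =>
        mul_nonneg (Finset.prod_nonneg fun p hp => mul_nonneg b.cast_nonneg
          (h.weight_nonneg (Finset.mem_powerset.1 hu hp))) (truncPow_nonneg _ _)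

/-- Rankin's trick: `e^(2L) / ∏ p ≥ 1` on the range of summation reduces this to the sum weighted by
reciprocals. -/
theorem sum_pow_card_le (h : SieveParams k D) (b : ℕ) (L : ℝ) (hL : 0 ≤ L) :
    ∑ u ∈ (primesIoc D X).powerset with logProd u ≤ 2 * L, (b : ℝ) ^ u.card ≤
      Real.exp (2 * L) * divisorBound k D b L := by
  refine le_trans ?_ (mul_le_mul_of_nonneg_left
    (h.sum_pow_card_mul_prod_le (X := X) b L hL) (Real.exp_pos (2 * L)).le)
  rw [Finset.mul_sum]
  refine Finset.sum_le_sum fun u hu => ?_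
  rw [Finset.mem_filter, Finset.mem_powerset] at hu
  have hp : ∀ p ∈ u, p.Prime := fun p hp => prime_of_mem_primesIoc (hu.1 hp)
  have h1 := (logProd_le_iff hp _).1 hu.2
  have h2 := (h.prod_inv_le hu.1).1
  have h3 : (0 : ℝ) < ((∏ p ∈ u, p : ℕ) : ℝ) := by exact_mod_cast prod_pos_of_prime hp
  have h4 : 1 ≤ Real.exp (2 * L) * ∏ p ∈ u, ((p : ℝ) - k)⁻¹ := by
    calc (1 : ℝ) = ((∏ p ∈ u, p : ℕ) : ℝ) * (((∏ p ∈ u, p : ℕ) : ℝ))⁻¹ :=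
          (mul_inv_cancel₀ h3.ne').symm
      _ ≤ _ := mul_le_mul h1 h2 (by positivity) (Real.exp_pos _).le
  calc (b : ℝ) ^ u.card = (b : ℝ) ^ u.card * 1 := (mul_one _).symm
    _ ≤ (b : ℝ) ^ u.card * (Real.exp (2 * L) * ∏ p ∈ u, ((p : ℝ) - k)⁻¹) := by gcongr
    _ = _ := by ring

/-- The contribution of the errors in arithmetic progressions, controlled by an average. -/
theorem sum_pow_card_mul_maxErrorStar_le (h : SieveParams k D) (b N : ℕ) (hN : 1 ≤ N) (L : ℝ)
    (hL : 0 ≤ L) (T Q : ℝ) (hT : 0 < T) (hQ : D.factorial * Real.exp (2 * L) ≤ Q)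
    (hQN : Q ≤ 2 * N) :
    ∑ u ∈ (primesIoc D X).powerset with logProd u ≤ 2 * L,
      (b : ℝ) ^ u.card * maxErrorStar (2 * N) (D.factorial * ∏ p ∈ u, p) ≤
    T * (∑ q ∈ Finset.Icc 1 ⌊Q⌋₊, maxErrorStar (2 * N) q) +
      T⁻¹ * (2 * N * (3 * Real.log (4 * N) + 1) * divisorBound k D (b ^ 2) L) := by
  have hN' : (1 : ℝ) ≤ N := by exact_mod_cast hN
  have hlog : 0 ≤ Real.log (4 * N) := Real.log_nonneg (by linarith)
  have hP : ∀ p ∈ primesIoc D X, p.Prime := fun p hp => prime_of_mem_primesIoc hp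
  have hWQ : ∀ u ∈ (primesIoc D X).powerset.filter (fun u => logProd u ≤ 2 * L),
      (((D.factorial * ∏ p ∈ u, p : ℕ)) : ℝ) ≤ Q := fun u hu => by
    rw [Finset.mem_filter, Finset.mem_powerset] at hu
    have h1 := (logProd_le_iff (fun p hp => hP p (hu.1 hp)) _).1 hu.2
    rw [Nat.cast_mul]
    exact (mul_le_mul_of_nonneg_left h1 (Nat.cast_nonneg _)).trans hQ
  have hW : (1 : ℝ) ≤ D.factorial := by exact_mod_cast D.factorial_pos
  have h1 : ∑ u ∈ (primesIoc D X).powerset with logProd u ≤ 2 * L,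
      maxErrorStar (2 * N) (D.factorial * ∏ p ∈ u, p) ≤
      ∑ q ∈ Finset.Icc 1 ⌊Q⌋₊, maxErrorStar (2 * N) q := by
    refine sum_le_sum_of_injOn_map (fun u => D.factorial * ∏ p ∈ u, p) (fun u hu => ?_) ?_
      (fun _ _ => le_rfl) fun q _ => maxErrorStar_nonneg _ _
    · rw [Finset.mem_Icc]
      refine ⟨Nat.mul_pos D.factorial_pos (prod_pos_of_prime fun p hp => hP p
        (Finset.mem_powerset.1 (Finset.mem_filter.1 hu).1 hp)), Nat.le_floor (hWQ u hu)⟩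
    · intro s hs t ht hst
      exact prod_injOn_primes _ hP (Finset.mem_coe.2 (Finset.mem_filter.1 (Finset.mem_coe.1 hs)).1)
        (Finset.mem_coe.2 (Finset.mem_filter.1 (Finset.mem_coe.1 ht)).1)
        (Nat.eq_of_mul_eq_mul_left D.factorial_pos hst)
  have h2 : ∀ u ∈ (primesIoc D X).powerset.filter (fun u => logProd u ≤ 2 * L),
      maxErrorStar (2 * N) (D.factorial * ∏ p ∈ u, p) ≤
      2 * N * (3 * Real.log (4 * N) + 1) * ∏ p ∈ u, ((p : ℝ) - k)⁻¹ := by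
    intro u hu
    have hq := hWQ u hu
    rw [Finset.mem_filter, Finset.mem_powerset] at hu
    have hpos := prod_pos_of_prime fun p hp => hP p (hu.1 hp)
    obtain ⟨e1, e2⟩ := h.prod_inv_le hu.1
    have h3 := maxErrorStar_le (2 * N) (D.factorial * ∏ p ∈ u, p)
      (Nat.mul_pos D.factorial_pos hpos) (by linarith) (hq.trans hQN)
    rw [totient_factorial_mul_prod hu.1, show (2 * (2 * (N : ℝ))) = 4 * N by ring] at h3
    have hpos' : (0 : ℝ) < ((∏ p ∈ u, p : ℕ) : ℝ) := by exact_mod_cast hpos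
    have h4 : (((D.factorial * ∏ p ∈ u, p : ℕ)) : ℝ)⁻¹ ≤ ∏ p ∈ u, ((p : ℝ) - k)⁻¹ := by
      refine le_trans ?_ e1
      rw [Nat.cast_mul]
      exact inv_anti₀ hpos' (le_mul_of_one_le_left hpos'.le hW)
    have hφpos : (0 : ℝ) < ∏ p ∈ u, ((p : ℝ) - 1) := Finset.prod_pos fun p hp => by
      have : (1 : ℝ) < p := by exact_mod_cast (hP p (hu.1 hp)).one_lt
      linarith
    have hφ : (1 : ℝ) ≤ Nat.totient D.factorial := by
      exact_mod_cast Nat.totient_pos.2 D.factorial_pos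
    have h5 : ((Nat.totient D.factorial : ℝ) * ∏ p ∈ u, ((p : ℝ) - 1))⁻¹ ≤
        ∏ p ∈ u, ((p : ℝ) - k)⁻¹ :=
      (inv_anti₀ hφpos (le_mul_of_one_le_left hφpos.le hφ)).trans e2
    calc _ ≤ _ := h3
      _ = 6 * N * Real.log (4 * N) * (((D.factorial * ∏ p ∈ u, p : ℕ)) : ℝ)⁻¹ +
          2 * N * ((Nat.totient D.factorial : ℝ) * ∏ p ∈ u, ((p : ℝ) - 1))⁻¹ := by
          rw [div_eq_mul_inv, div_eq_mul_inv]; ring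
      _ ≤ 6 * N * Real.log (4 * N) * (∏ p ∈ u, ((p : ℝ) - k)⁻¹) +
          2 * N * ∏ p ∈ u, ((p : ℝ) - k)⁻¹ := by gcongr
      _ = _ := by ring
  have h3 : ∀ u ∈ (primesIoc D X).powerset.filter (fun u => logProd u ≤ 2 * L),
      (b : ℝ) ^ u.card * maxErrorStar (2 * N) (D.factorial * ∏ p ∈ u, p) ≤
      T * maxErrorStar (2 * N) (D.factorial * ∏ p ∈ u, p) +
        T⁻¹ * (2 * N * (3 * Real.log (4 * N) + 1) *
          (((b ^ 2 : ℕ) : ℝ) ^ u.card * ∏ p ∈ u, ((p : ℝ) - k)⁻¹)) := by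
    intro u hu
    have hE := maxErrorStar_nonneg (2 * N) (D.factorial * ∏ p ∈ u, p)
    set x := (b : ℝ) ^ u.card with hx
    have hx2 : ((b ^ 2 : ℕ) : ℝ) ^ u.card = x ^ 2 := by
      push_cast; rw [hx, ← pow_mul, ← pow_mul, mul_comm]
    -- This takes the place of Cauchy–Schwarz: the part with `T` is summed by the level of
    -- distribution, the part with `x²/T` by the trivial bound.
    have h4 : x ≤ T + T⁻¹ * x ^ 2 := by
      have h5 : 0 ≤ T⁻¹ * (x - T) ^ 2 := by positivity
      have h6 : T⁻¹ * (x - T) ^ 2 = T⁻¹ * x ^ 2 - 2 * x + T := by field_simp; ring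
      have hx0 : 0 ≤ x := by positivity
      linarith
    calc _ ≤ (T + T⁻¹ * x ^ 2) * maxErrorStar (2 * N) (D.factorial * ∏ p ∈ u, p) :=
          mul_le_mul_of_nonneg_right h4 hE
      _ = T * maxErrorStar (2 * N) (D.factorial * ∏ p ∈ u, p) +
          T⁻¹ * x ^ 2 * maxErrorStar (2 * N) (D.factorial * ∏ p ∈ u, p) := by ring
      _ ≤ T * maxErrorStar (2 * N) (D.factorial * ∏ p ∈ u, p) + T⁻¹ * x ^ 2 *
          (2 * N * (3 * Real.log (4 * N) + 1) * ∏ p ∈ u, ((p : ℝ) - k)⁻¹) :=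
          add_le_add le_rfl (mul_le_mul_of_nonneg_left (h2 u hu) (by positivity))
      _ = _ := by rw [hx2]; ring
  refine (Finset.sum_le_sum h3).trans ?_
  rw [Finset.sum_add_distrib, ← Finset.mul_sum, ← Finset.mul_sum, ← Finset.mul_sum]
  have h6 := h.sum_pow_card_mul_prod_le (X := X) (b ^ 2) L hL
  gcongr

/-- If no translate of `H` in the range contains two primes, the sieve yields an inequality. -/
theorem sieve_inequality (H : Finset ℕ) (h : SieveParams H.card D) (hHD : ∀ m ∈ H, m ≤ D)
    (v : ℕ) (hv : ∀ m ∈ H, (v + m).Coprime D.factorial) (c : ℕ → ℝ) (hc : ∀ i, 0 ≤ c i) (l : ℕ)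
    (N : ℕ) (hN : 1 ≤ N) (hDN : D ≤ N) (hX : 1 ≤ X) (hXN : X ≤ N)
    (hno : ∀ n, N < n → ∀ m ∈ H, ∀ m' ∈ H, (n + m).Prime → (n + m').Prime → m = m')
    (L : ℝ) (hL : 0 ≤ L) (hLX : L ≤ Real.log X) (T Q : ℝ) (hT : 0 < T)
    (hQ : D.factorial * Real.exp (2 * L) ≤ Q) (hQN : Q ≤ 2 * N) :
    H.card * (N / (Nat.totient D.factorial : ℝ) *
        (roughDensity D ^ (H.card + 1) * L ^ (2 * l + H.card + 1) * lowerConst c l H.card) -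
      weightBound H.card D c l L ^ 2 *
        (T * (∑ q ∈ Finset.Icc 1 ⌊Q⌋₊, maxErrorStar (2 * N) q) +
          T⁻¹ * (2 * N * (3 * Real.log (4 * N) + 1) *
            divisorBound H.card D ((16 * H.card) ^ 2) L) +
          D * (Real.log (4 * N) + 1) *
            (Real.exp (2 * L) * divisorBound H.card D (16 * H.card) L))) ≤
    Real.log (3 * N) * (N / D.factorial *
        (upperDensity H.card D ^ H.card * (L + H.card * logShift D) ^ (2 * l + H.card) *
          upperConst c l H.card) +
      weightBound H.card D c l L ^ 2 *
        (Real.exp (2 * L) * divisorBound H.card D (16 * H.card) L)) := by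
  have hN' : (1 : ℝ) ≤ N := by exact_mod_cast hN
  have hlog4 : 0 ≤ Real.log (4 * N) := Real.log_nonneg (by linarith)
  have hlog3 : 0 ≤ Real.log (3 * N) := Real.log_nonneg (by linarith)
  set P := primesIoc D X with hP
  set k := H.card with hk
  set lam := gpyWeight P k c l L with hlamdef
  set B := weightBound k D c l L with hBdef
  have hB : 0 ≤ B := weightBound_nonneg k D c hc l hL
  have hlam : ∀ s ⊆ P, |lam s| ≤ 2 ^ s.card * B := fun s hs => h.abs_gpyWeight_le c hc l L hL s hs
  have hsupp : ∀ s, L < logProd s → lam s = 0 := fun s hs => gpyWeight_eq_zero P k c l L hs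
  set b := 16 * k with hb
  have hbc : (16 * (k : ℝ)) = (b : ℝ) := by rw [hb]; push_cast; ring
  have hup := sum_divisorSum_sq_le D X N v H hHD lam B L hB hlam hsupp
  have hU := h.sum_pow_card_le (X := X) b L hL
  have hQ1 := h.quadForm_upper_le (X := X) c hc l L hL
  have hQ2 := h.le_quadForm_lower (X := X) c hc l L hL hX hLX
  have hE := h.sum_pow_card_mul_maxErrorStar_le (X := X) b N hN L hL T Q hT hQ hQN
  have hlow : ∀ m ∈ H, N / (Nat.totient D.factorial : ℝ) *
        (roughDensity D ^ (k + 1) * L ^ (2 * l + k + 1) * lowerConst c l k) -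
      B ^ 2 * (T * (∑ q ∈ Finset.Icc 1 ⌊Q⌋₊, maxErrorStar (2 * N) q) +
          T⁻¹ * (2 * N * (3 * Real.log (4 * N) + 1) * divisorBound k D (b ^ 2) L) +
          D * (Real.log (4 * N) + 1) * (Real.exp (2 * L) * divisorBound k D b L)) ≤
      ∑ n ∈ Finset.Ioc N (2 * N) with n ≡ v [MOD D.factorial],
        varpi (n + m) * divisorSum P H lam n ^ 2 := by
    intro m hm
    refine le_trans ?_ (le_sum_varpi_divisorSum_sq D X N v hN hXN hDN H hHD m hm (hv m hm) lam B L
      hB hlam hsupp)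
    refine sub_le_sub (mul_le_mul_of_nonneg_left hQ2 (by positivity))
      (mul_le_mul_of_nonneg_left ?_ (sq_nonneg B))
    rw [← hk, hbc]
    simp only [mul_add, Finset.sum_add_distrib]
    rw [← Finset.sum_mul, ← Finset.sum_mul]
    have h1 : 0 ≤ (D : ℝ) * (Real.log (4 * N) + 1) := by positivity
    have h2 := mul_le_mul_of_nonneg_left hU h1
    simp only [mul_add] at hE
    nlinarith [hE, h2]
  have hsum := Finset.sum_le_sum hlow
  rw [Finset.sum_const, nsmul_eq_mul, ← hk, Finset.sum_comm] at hsum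
  refine hsum.trans ?_
  -- The decisive comparison: at most one shift of `n` is prime, so the prime weights add up to at
  -- most a single logarithm.
  have h1 : ∀ n ∈ (Finset.Ioc N (2 * N)).filter (fun n => n ≡ v [MOD D.factorial]),
      ∑ m ∈ H, varpi (n + m) * divisorSum P H lam n ^ 2 ≤
        Real.log (3 * N) * divisorSum P H lam n ^ 2 := by
    intro n hn
    rw [← Finset.sum_mul]
    refine mul_le_mul_of_nonneg_right ?_ (sq_nonneg _)
    have hn' := Finset.mem_Ioc.1 (Finset.mem_filter.1 hn).1
    by_cases hex : ∃ m ∈ H, (n + m).Prime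
    · obtain ⟨m, hm, hmp⟩ := hex
      rw [Finset.sum_eq_single_of_mem m hm]
      · refine varpi_le_log ?_ (by linarith)
        have := hHD m hm
        exact_mod_cast (by omega : n + m ≤ 3 * N)
      · intro m' hm' hne
        exact if_neg fun hp => hne (hno n hn'.1 m' hm' m hm hp hmp)
    · push Not at hex
      have hz : ∑ m ∈ H, varpi (n + m) = 0 := Finset.sum_eq_zero fun m hm => if_neg (hex m hm)
      rw [hz]
      exact hlog3
  refine (Finset.sum_le_sum h1).trans ?_
  rw [← Finset.mul_sum]
  refine mul_le_mul_of_nonneg_left (hup.trans ?_) hlog3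
  rw [← hk, hbc]
  have h2 : (0 : ℝ) ≤ N / D.factorial := by positivity
  exact add_le_add (mul_le_mul_of_nonneg_left hQ1 h2) (mul_le_mul_of_nonneg_left hU (sq_nonneg B))

end SieveParams

/-! ### Passage to the limit in `N` -/

theorem tendsto_log_natCast : Tendsto (fun N : ℕ => Real.log N) atTop atTop :=
  Real.tendsto_log_atTop.comp tendsto_natCast_atTop_atTop

theorem tendsto_linear_div_log (a d : ℝ) :
    Tendsto (fun N : ℕ => (a * Real.log N + d) / Real.log N) atTop (nhds a) := by
  have h1 : Tendsto (fun N : ℕ => a + d * (Real.log N)⁻¹) atTop (nhds (a + d * 0)) :=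
    tendsto_const_nhds.add (tendsto_const_nhds.mul tendsto_log_natCast.inv_tendsto_atTop)
  rw [mul_zero, add_zero] at h1
  refine h1.congr' ?_
  filter_upwards [tendsto_log_natCast.eventually_gt_atTop 0] with N hN
  field_simp

theorem tendsto_log_pow_mul_rpow (m : ℕ) (η : ℝ) (hη : 2 * η < 1) :
    Tendsto (fun N : ℕ => Real.log N ^ m * (Real.exp (2 * (η * Real.log N)) / N)) atTop
      (nhds 0) := by
  have h1 := (isLittleO_log_rpow_rpow_atTop (m : ℝ) (show 0 < 1 - 2 * η by linarith)).tendsto_div_nhds_zero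
  refine (h1.comp tendsto_natCast_atTop_atTop).congr' ?_
  filter_upwards [eventually_gt_atTop 0] with N hN
  have hN' : (0 : ℝ) < N := by exact_mod_cast hN
  simp only [Function.comp]
  rw [Real.rpow_natCast, Real.rpow_sub hN', Real.rpow_one,
    show 2 * (η * Real.log N) = Real.log N * (2 * η) by ring, ← Real.rpow_def_of_pos hN']
  field_simp

theorem tendsto_divisorBound (k D b : ℕ) (η : ℝ) :
    Tendsto (fun N : ℕ => divisorBound k D b (η * Real.log N) / Real.log N ^ b) atTop
      (nhds (upperDensity k D ^ b * (2 * η) ^ b)) := by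
  have h1 := ((tendsto_linear_div_log (2 * η) (b * logShift D)).pow b).const_mul
    (upperDensity k D ^ b)
  refine h1.congr fun N => ?_
  rw [divisorBound, div_pow]
  ring_nf

theorem tendsto_weightBound (k D : ℕ) (c : ℕ → ℝ) (l : ℕ) (η : ℝ) :
    Tendsto (fun N : ℕ => weightBound k D c l (η * Real.log N) / Real.log N ^ (l + k)) atTop
      (nhds (upperDensity k D ^ k * (∑ i ∈ Finset.range (l + 1), c i) * η ^ (l + k))) := by
  have h1 := ((tendsto_linear_div_log η (k * logShift D)).pow (l + k)).const_mul
    (upperDensity k D ^ k * (∑ i ∈ Finset.range (l + 1), c i))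
  refine h1.congr fun N => ?_
  rw [weightBound, div_pow]
  ring

theorem HypothesisBV.tendsto {θ : ℝ} (h : HypothesisBV θ) (ε : ℝ) (hε : 0 < ε) (m : ℕ) :
    Tendsto (fun N : ℕ => Real.log N ^ m *
      (∑ q ∈ Finset.Icc 1 ⌊(2 * (N : ℝ)) ^ (θ - ε)⌋₊, maxErrorStar (2 * N) q) / N) atTop
      (nhds 0) := by
  have h2 : Tendsto (fun N : ℕ => 2 * (N : ℝ)) atTop atTop :=
    tendsto_natCast_atTop_atTop.const_mul_atTop (by norm_num)
  -- The exponent `A = m + 1` leaves one factor `1/log N` to force convergence to zero.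
  obtain ⟨C, hC⟩ := ((h (m + 1 : ℕ) (by positivity) ε hε).comp_tendsto h2).bound
  have h3 : Tendsto (fun N : ℕ => 2 * C * (Real.log N)⁻¹) atTop (nhds 0) := by
    have := tendsto_log_natCast.inv_tendsto_atTop.const_mul (2 * C)
    rwa [mul_zero] at this
  refine squeeze_zero' (Eventually.of_forall fun N => ?_) ?_ h3
  · have := Finset.sum_nonneg fun q
      (_ : q ∈ Finset.Icc 1 ⌊(2 * (N : ℝ)) ^ (θ - ε)⌋₊) => maxErrorStar_nonneg (2 * N) q
    have := Real.log_natCast_nonneg N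
    positivity
  · filter_upwards [hC, tendsto_log_natCast.eventually_gt_atTop 0, eventually_gt_atTop 0]
      with N hN hlog hpos
    have hN' : (0 : ℝ) < N := by exact_mod_cast hpos
    simp only [Function.comp] at hN
    rw [Real.norm_of_nonneg (Finset.sum_nonneg fun q _ => maxErrorStar_nonneg _ q)] at hN
    have hle : Real.log N ≤ Real.log (2 * N) := Real.log_le_log hN' (by linarith)
    have hlog2 : 0 < Real.log (2 * N) := hlog.trans_le hle
    rw [Real.norm_of_nonneg (by positivity), Real.rpow_neg hlog2.le, Real.rpow_natCast] at hN
    have hS0 := Finset.sum_nonneg fun q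
      (_ : q ∈ Finset.Icc 1 ⌊(2 * (N : ℝ)) ^ (θ - ε)⌋₊) => maxErrorStar_nonneg (2 * N) q
    have hC0 : 0 ≤ C := by
      by_contra hneg
      have : C * (2 * N * (Real.log (2 * N) ^ (m + 1))⁻¹) < 0 :=
        mul_neg_of_neg_of_pos (not_le.1 hneg) (by positivity)
      linarith
    have h4 : (Real.log (2 * N) ^ (m + 1))⁻¹ ≤ (Real.log N ^ (m + 1))⁻¹ :=
      inv_anti₀ (by positivity) (by gcongr)
    calc _ ≤ Real.log N ^ m * (C * (2 * N * (Real.log N ^ (m + 1))⁻¹)) / N := by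
          gcongr
          exact hN.trans (by gcongr)
      _ = _ := by rw [pow_succ]; field_simp

theorem exists_coprime_translate (H : Finset ℕ)
    (hadm : ∀ p : ℕ, p.Prime → ∃ v, ∀ m ∈ H, ¬ p ∣ v + m) (D : ℕ) :
    ∃ v, ∀ m ∈ H, (v + m).Coprime D.factorial := by
  have hadm' : ∀ p : ℕ, ∃ v, p.Prime → ∀ m ∈ H, ¬ p ∣ v + m := fun p => by
    by_cases hp : p.Prime
    · obtain ⟨v, hv⟩ := hadm p hp
      exact ⟨v, fun _ => hv⟩
    · exact ⟨0, fun h => absurd h hp⟩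
  choose w hw using hadm'
  obtain ⟨v, hv⟩ := Nat.chineseRemainderOfFinset w (fun p => p) (primesIoc 0 D)
    (fun p hp => (prime_of_mem_primesIoc hp).ne_zero) (fun p hp q hq hpq =>
      (Nat.coprime_primes (prime_of_mem_primesIoc hp) (prime_of_mem_primesIoc hq)).2 hpq)
  refine ⟨v, fun m hm => ?_⟩
  by_contra hcop
  obtain ⟨p, hp, hd1, hd2⟩ := Nat.Prime.not_coprime_iff_dvd.1 hcop
  have hpD := hp.dvd_factorial.1 hd2
  have hmod := hv p (mem_primesIoc.2 ⟨⟨hp.pos, hpD⟩, hp⟩)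
  refine hw p hp m hm ?_
  exact Nat.modEq_zero_iff_dvd.1 ((hmod.add_right m).symm.trans (Nat.modEq_zero_iff_dvd.2 hd1))

/-- The asymptotic form of the sieve inequality. -/
theorem le_of_eventually_no_pair (H : Finset ℕ) (D : ℕ) (h : SieveParams H.card D)
    (hHD : ∀ m ∈ H, m ≤ D) (v : ℕ) (hv : ∀ m ∈ H, (v + m).Coprime D.factorial) (c : ℕ → ℝ)
    (hc : ∀ i, 0 ≤ c i) (l : ℕ) (θ : ℝ) (hθ : θ ≤ 1) (hBV : HypothesisBV θ) (η : ℝ) (hη : 0 < η)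
    (hηθ : 2 * η < θ) (N₀ : ℕ)
    (hno : ∀ n, N₀ < n → ∀ m ∈ H, ∀ m' ∈ H, (n + m).Prime → (n + m').Prime → m = m') :
    H.card * η * lowerConst c l H.card ≤
      Real.exp (2 * H.card / D) ^ H.card * upperConst c l H.card := by
  set k := H.card with hk
  have hk2 := h.two_le
  set b := 16 * k with hb
  -- With `T = (log N)^a`, the trivial-bound part has order `N (log N)^(b² + 1 + 2(l + k) - a) = N
  -- (log N)^(2l + k)`, one logarithm below the main term.
  set a := b ^ 2 + k + 1 with ha
  set ε := (θ - 2 * η) / 2 with hεdef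
  have hε : 0 < ε := by rw [hεdef]; linarith
  have hθε : θ - ε = 2 * η + ε := by rw [hεdef]; ring
  set S : ℕ → ℝ := fun N =>
    ∑ q ∈ Finset.Icc 1 ⌊(2 * (N : ℝ)) ^ (θ - ε)⌋₊, maxErrorStar (2 * N) q with hS
  set K := 2 * l + k + 1 with hK
  -- the inequality for all large `N`
  have hineq : ∀ᶠ N : ℕ in atTop,
      k * (N / (Nat.totient D.factorial : ℝ) *
        (roughDensity D ^ (k + 1) * (η * Real.log N) ^ K * lowerConst c l k) -
      weightBound k D c l (η * Real.log N) ^ 2 *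
        (Real.log N ^ a * S N +
          (Real.log N ^ a)⁻¹ * (2 * N * (3 * Real.log (4 * N) + 1) *
            divisorBound k D (b ^ 2) (η * Real.log N)) +
          D * (Real.log (4 * N) + 1) *
            (Real.exp (2 * (η * Real.log N)) * divisorBound k D b (η * Real.log N)))) ≤
    Real.log (3 * N) * (N / D.factorial *
        (upperDensity k D ^ k * (η * Real.log N + k * logShift D) ^ (2 * l + k) *
          upperConst c l k) +
      weightBound k D c l (η * Real.log N) ^ 2 *
        (Real.exp (2 * (η * Real.log N)) * divisorBound k D b (η * Real.log N))) := by
    -- Half of the gap between `2η` and `θ` absorbs the fixed modulus `D!`; the other half is the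
    -- `ε` of the hypothesis.
    have hWbig : ∀ᶠ N : ℕ in atTop, (D.factorial : ℝ) ≤ (N : ℝ) ^ ε :=
      ((tendsto_rpow_atTop hε).comp tendsto_natCast_atTop_atTop).eventually_ge_atTop _
    filter_upwards [eventually_ge_atTop 1, eventually_ge_atTop D, eventually_ge_atTop N₀,
      tendsto_log_natCast.eventually_gt_atTop 0, hWbig] with N hN hDN hN0 hlog hWN
    have hN' : (1 : ℝ) ≤ N := by exact_mod_cast hN
    have hNpos : (0 : ℝ) < N := by linarith
    have hexp : ∀ x : ℝ, Real.exp (x * Real.log N) = (N : ℝ) ^ x := fun x => by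
      rw [Real.rpow_def_of_pos hNpos, mul_comm]
    have hX1 : 1 ≤ ⌈(N : ℝ) ^ η⌉₊ := Nat.one_le_ceil_iff.2 (by positivity)
    refine h.sieve_inequality (X := ⌈(N : ℝ) ^ η⌉₊) H hHD v hv c hc l N hN hDN hX1 ?_
      (fun n hn => hno n (hN0.trans_lt hn)) (η * Real.log N) (by positivity) ?_
      (Real.log N ^ a) ((2 * (N : ℝ)) ^ (θ - ε)) (by positivity) ?_ ?_
    · rw [Nat.ceil_le]
      exact Real.rpow_le_self_of_one_le hN' (by linarith)
    · rw [← Real.log_rpow hNpos]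
      exact Real.log_le_log (by positivity) (Nat.le_ceil _)
    · rw [show 2 * (η * Real.log N) = 2 * η * Real.log N by ring, hexp, hθε]
      calc (D.factorial : ℝ) * (N : ℝ) ^ (2 * η) ≤ (N : ℝ) ^ ε * (N : ℝ) ^ (2 * η) := by gcongr
        _ = (N : ℝ) ^ (2 * η + ε) := by rw [← Real.rpow_add hNpos, add_comm]
        _ ≤ (2 * (N : ℝ)) ^ (2 * η + ε) :=
            Real.rpow_le_rpow hNpos.le (by linarith) (by linarith)
    · exact Real.rpow_le_self_of_one_le (by linarith) (by linarith)
  -- limits of the normalised pieces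
  set β := upperDensity k D ^ k * (∑ i ∈ Finset.range (l + 1), c i) * η ^ (l + k) with hβ
  have tW := (tendsto_weightBound k D c l η).pow 2
  rw [← hβ] at tW
  have tL : Tendsto (fun N : ℕ => (η * Real.log N) / Real.log N) atTop (nhds η) := by
    simpa using tendsto_linear_div_log η 0
  have t3 : Tendsto (fun N : ℕ => Real.log (3 * N) / Real.log N) atTop (nhds 1) := by
    refine (tendsto_linear_div_log 1 (Real.log 3)).congr' ?_
    filter_upwards [eventually_gt_atTop 0] with N hN
    rw [Real.log_mul (by norm_num) (by positivity)]
    ring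
  have t4 : ∀ x : ℝ, Tendsto (fun N : ℕ => (x * Real.log (4 * N) + 1) / Real.log N) atTop
      (nhds x) := fun x => by
    refine (tendsto_linear_div_log x (x * Real.log 4 + 1)).congr' ?_
    filter_upwards [eventually_gt_atTop 0] with N hN
    rw [Real.log_mul (by norm_num) (by positivity)]
    ring
  have tinv : Tendsto (fun N : ℕ => (Real.log N)⁻¹) atTop (nhds 0) :=
    tendsto_log_natCast.inv_tendsto_atTop
  have z1 : Tendsto (fun N : ℕ => Real.log N ^ (a + k - 1) * S N / N) atTop (nhds 0) :=
    hBV.tendsto ε hε _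
  have z2 : Tendsto (fun N : ℕ => 2 * ((3 * Real.log (4 * N) + 1) / Real.log N) *
      (divisorBound k D (b ^ 2) (η * Real.log N) / Real.log N ^ (b ^ 2)) * (Real.log N)⁻¹) atTop
      (nhds 0) := by
    have := (((t4 3).const_mul 2).mul (tendsto_divisorBound k D (b ^ 2) η)).mul tinv
    rwa [mul_zero] at this
  have z4 : Tendsto (fun N : ℕ => (divisorBound k D b (η * Real.log N) / Real.log N ^ b) *
      (Real.log N ^ (b + k) * (Real.exp (2 * (η * Real.log N)) / N))) atTop (nhds 0) := by
    have := (tendsto_divisorBound k D b η).mul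
      (tendsto_log_pow_mul_rpow (b + k) η (by linarith))
    rwa [mul_zero] at this
  have z3 : Tendsto (fun N : ℕ => D * ((1 * Real.log (4 * N) + 1) / Real.log N) *
      ((divisorBound k D b (η * Real.log N) / Real.log N ^ b) *
      (Real.log N ^ (b + k) * (Real.exp (2 * (η * Real.log N)) / N)))) atTop (nhds 0) := by
    have := ((t4 1).const_mul (D : ℝ)).mul z4
    rwa [mul_zero] at this
  have hleft := (((tL.pow K).const_mul ((Nat.totient D.factorial : ℝ)⁻¹ * roughDensity D ^ (k + 1) *
      lowerConst c l k)).sub (tW.mul ((z1.add z2).add z3))).const_mul (k : ℝ)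
  have hright := t3.mul ((((tendsto_linear_div_log η (k * logShift D)).pow (2 * l + k)).const_mul
      ((D.factorial : ℝ)⁻¹ * upperDensity k D ^ k * upperConst c l k)).add (tW.mul z4))
  have hlim := le_of_tendsto_of_tendsto hleft hright ?_
  · simp only [add_zero, mul_zero, sub_zero, one_mul] at hlim
    have hρ := roughDensity_pos D
    have hW : (0 : ℝ) < D.factorial := by exact_mod_cast D.factorial_pos
    have hφ : (0 : ℝ) < Nat.totient D.factorial := by
      exact_mod_cast Nat.totient_pos.2 D.factorial_pos
    -- As `roughDensity D = φ(D!)/D!`, the extra density factor in the prime sum turns `1/φ(D!)`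
    -- into `1/D!`, and all dependence on `D` cancels except the exponential.
    have e1 : (Nat.totient D.factorial : ℝ)⁻¹ * roughDensity D ^ (k + 1) =
        (D.factorial : ℝ)⁻¹ * roughDensity D ^ k := by
      rw [pow_succ]
      nth_rw 2 [roughDensity_eq]
      field_simp
    rw [e1, upperDensity, mul_pow, hK, pow_succ η] at hlim
    have hpos : 0 < (D.factorial : ℝ)⁻¹ * roughDensity D ^ k * η ^ (2 * l + k) := by positivity
    refine le_of_mul_le_mul_left ?_ hpos
    refine le_trans (le_of_eq ?_) (hlim.trans (le_of_eq ?_)) <;> ring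
  · filter_upwards [hineq, tendsto_log_natCast.eventually_gt_atTop 0, eventually_gt_atTop 0]
      with N hN hlog hNpos
    have hN' : (0 : ℝ) < N := by exact_mod_cast hNpos
    have hden : (0 : ℝ) < N * Real.log N ^ K := by positivity
    have hdiv := div_le_div_of_nonneg_right hN hden.le
    refine le_trans (le_of_eq ?_) (hdiv.trans (le_of_eq ?_))
    · set ℓ := Real.log N with hℓ
      have p1 : ℓ ^ (a + k - 1) = ℓ ^ (b ^ 2) * ℓ ^ (2 * k) := by
        rw [← pow_add]; congr 1; omega
      have p2 : ℓ ^ a = ℓ ^ (b ^ 2) * ℓ ^ k * ℓ := by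
        rw [← pow_add, ← pow_succ]
      have p3 : ℓ ^ K = ℓ ^ (2 * l) * ℓ ^ k * ℓ := by
        rw [← pow_add, ← pow_succ]
      have p4 : (ℓ ^ (l + k)) ^ 2 = ℓ ^ (2 * l) * ℓ ^ k * ℓ ^ k := by
        rw [← pow_mul, ← pow_add, ← pow_add]; congr 1; omega
      have p5 : ℓ ^ (2 * k) = ℓ ^ k * ℓ ^ k := by rw [← pow_add]; congr 1; omega
      rw [p1, p2, mul_pow η, div_pow (weightBound _ _ _ _ _), p4, div_pow, mul_pow η, p3, p5,
        pow_add ℓ b k]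
      field_simp
    · set ℓ := Real.log N with hℓ
      have p3 : ℓ ^ K = ℓ ^ (2 * l) * ℓ ^ k * ℓ := by
        rw [← pow_add, ← pow_succ]
      have p4 : (ℓ ^ (l + k)) ^ 2 = ℓ ^ (2 * l) * ℓ ^ k * ℓ ^ k := by
        rw [← pow_mul, ← pow_add, ← pow_add]; congr 1; omega
      rw [div_pow (weightBound _ _ _ _ _), p4, div_pow, p3, pow_add ℓ b k, pow_add ℓ (2 * l) k]
      field_simp

/-- An admissible tuple satisfying the Goldston–Pintz–Yıldırım criterion has infinitely many
translates containing two primes. -/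
theorem exists_prime_pair (H : Finset ℕ) (hk : 2 ≤ H.card)
    (hadm : ∀ p : ℕ, p.Prime → ∃ v, ∀ m ∈ H, ¬ p ∣ v + m) (c : ℕ → ℝ) (hc : ∀ i, 0 ≤ c i) (l : ℕ)
    (θ : ℝ) (hθ0 : 0 < θ) (hθ : θ ≤ 1) (hBV : HypothesisBV θ)
    (hcrit : upperConst c l H.card < H.card * (θ / 2) * lowerConst c l H.card) (N₀ : ℕ) :
    ∃ n, N₀ < n ∧ ∃ m ∈ H, ∃ m' ∈ H, m < m' ∧ (n + m).Prime ∧ (n + m').Prime := by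
  by_contra hcon
  have hno : ∀ n, N₀ < n → ∀ m ∈ H, ∀ m' ∈ H, (n + m).Prime → (n + m').Prime → m = m' := by
    intro n hn m hm m' hm' hp hp'
    by_contra hne
    rcases lt_or_gt_of_ne hne with h | h
    · exact hcon ⟨n, hn, m, hm, m', hm', h, hp, hp'⟩
    · exact hcon ⟨n, hn, m', hm', m, hm, h, hp', hp⟩
  -- The criterion is a strict inequality, so it survives taking `η` slightly below `θ/2` and, next,
  -- `D` large.
  have hη : ∃ η, 0 < η ∧ 2 * η < θ ∧ upperConst c l H.card < H.card * η * lowerConst c l H.card := by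
    have hcont : Tendsto (fun η : ℝ => H.card * η * lowerConst c l H.card) (nhdsWithin (θ / 2)
        (Set.Iio (θ / 2))) (nhds (H.card * (θ / 2) * lowerConst c l H.card)) := by
      refine Tendsto.mono_left ?_ nhdsWithin_le_nhds
      exact (by fun_prop : Continuous fun η : ℝ => H.card * η * lowerConst c l H.card).tendsto _
    have h1 := hcont.eventually_const_lt hcrit
    have h2 : ∀ᶠ η in nhdsWithin (θ / 2) (Set.Iio (θ / 2)), 0 < η :=
      nhdsWithin_le_nhds (lt_mem_nhds (by linarith))
    obtain ⟨η, h3, h4, h5⟩ := (h1.and (h2.and self_mem_nhdsWithin)).exists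
    exact ⟨η, h4, by
      have : η < θ / 2 := h5
      linarith, h3⟩
  obtain ⟨η, hη0, hηθ, hη⟩ := hη
  have hD : ∀ᶠ D : ℕ in atTop, Real.exp (2 * H.card / D) ^ H.card * upperConst c l H.card <
      H.card * η * lowerConst c l H.card := by
    have h1 : Tendsto (fun D : ℕ => (2 * H.card : ℝ) / D) atTop (nhds 0) :=
      tendsto_const_div_atTop_nhds_zero_nat _
    have h2 := (((Real.continuous_exp.tendsto 0).comp h1).pow H.card).mul_const
      (upperConst c l H.card)
    rw [Real.exp_zero, one_pow, one_mul] at h2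
    exact h2.eventually_lt_const hη
  obtain ⟨D, hD1, hD2, hD3⟩ := (hD.and ((eventually_ge_atTop (2 * H.card)).and
    (eventually_ge_atTop (H.sup id)))).exists
  obtain ⟨v, hv⟩ := exists_coprime_translate H hadm D
  have := le_of_eventually_no_pair H D ⟨hk, hD2⟩
    (fun m hm => (Finset.le_sup (f := id) hm).trans hD3) v hv c hc l θ hθ hBV η hη0 hηθ N₀ hno
  linarith

/-! ### From prime pairs to gaps, and the choice of tuples -/

theorem liminf_primeGap_le (B : ℕ) (h : ∀ N₀ : ℕ, ∃ p q : ℕ, N₀ < p ∧ p < q ∧ q ≤ p + B ∧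
    p.Prime ∧ q.Prime) : liminf primeGap atTop ≤ (B : EReal) := by
  refine liminf_le_of_frequently_le' ?_
  rw [Filter.frequently_atTop]
  intro M
  obtain ⟨p, q, hp0, hpq, hqB, hp, hq⟩ := h (Nat.nth Nat.Prime M)
  have hinf := Nat.infinite_setOfPred_prime
  have e1 : Nat.nth Nat.Prime (Nat.count Nat.Prime p) = p := Nat.nth_count hp
  have e2 : Nat.nth Nat.Prime (Nat.count Nat.Prime q) = q := Nat.nth_count hq
  refine ⟨Nat.count Nat.Prime p, ?_, ?_⟩
  · refine (Nat.nth_lt_nth hinf).1 ?_ |>.le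
    rw [e1]
    exact hp0
  · have h1 : Nat.count Nat.Prime p < Nat.count Nat.Prime q := by
      rw [← Nat.nth_lt_nth hinf, e1, e2]
      exact hpq
    have h2 : Nat.nth Nat.Prime (Nat.count Nat.Prime p + 1) ≤ q := by
      rw [← e2]
      exact (Nat.nth_le_nth hinf).2 h1
    unfold primeGap
    rw [e1]
    have h3 : ((Nat.nth Nat.Prime (Nat.count Nat.Prime p + 1) : ℝ) - (p : ℝ)) ≤ (B : ℝ) := by
      have : (Nat.nth Nat.Prime (Nat.count Nat.Prime p + 1) : ℝ) ≤ ((p + B : ℕ) : ℝ) := by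
        exact_mod_cast h2.trans hqB
      push_cast at this
      linarith
    exact_mod_cast EReal.coe_le_coe_iff.2 h3

theorem liminf_primeGap_le_of_criterion (H : Finset ℕ) (hk : 2 ≤ H.card)
    (hadm : ∀ p : ℕ, p.Prime → ∃ v, ∀ m ∈ H, ¬ p ∣ v + m) (B : ℕ) (hB : ∀ m ∈ H, m ≤ B)
    (c : ℕ → ℝ) (hc : ∀ i, 0 ≤ c i) (l : ℕ) (θ : ℝ) (hθ0 : 0 < θ) (hθ : θ ≤ 1)
    (hBV : HypothesisBV θ)
    (hcrit : upperConst c l H.card < H.card * (θ / 2) * lowerConst c l H.card) :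
    liminf primeGap atTop ≤ (B : EReal) := by
  refine liminf_primeGap_le B fun N₀ => ?_
  obtain ⟨n, hn, m, _, m', hm', hlt, hp, hp'⟩ :=
    exists_prime_pair H hk hadm c hc l θ hθ0 hθ hBV hcrit N₀
  have := hB m' hm'
  exact ⟨n + m, n + m', by omega, by omega, by omega, hp, hp'⟩

/-- A residue class avoiding a set with fewer than `p` elements. -/
theorem exists_translate_not_dvd (H : Finset ℕ) (p : ℕ) (hp : 0 < p) (hlt : H.card < p) :
    ∃ v, ∀ m ∈ H, ¬ p ∣ v + m := by
  have : NeZero p := ⟨hp.ne'⟩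
  have hcard : (H.image fun m : ℕ => -(m : ZMod p)).card < (Finset.univ : Finset (ZMod p)).card := by
    rw [Finset.card_univ, ZMod.card]
    exact Finset.card_image_le.trans_lt hlt
  obtain ⟨x, _, hx⟩ := Finset.exists_mem_notMem_of_card_lt_card hcard
  refine ⟨x.val, fun m hm hd => hx (Finset.mem_image.2 ⟨m, hm, ?_⟩)⟩
  have h1 := (ZMod.natCast_eq_zero_iff (x.val + m) p).2 hd
  push_cast at h1
  rw [ZMod.natCast_zmod_val] at h1
  exact (eq_neg_of_add_eq_zero_left h1).symm

theorem liminf_primeGap_lt_top (θ : ℝ) (hθ2 : 1 / 2 < θ) (hθ : θ ≤ 1) (hBV : HypothesisBV θ) :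
    liminf primeGap atTop < ⊤ := by
  obtain ⟨l, hl⟩ := exists_nat_gt ((3 / 2) / (θ - 1 / 2))
  have hδ : 0 < θ - 1 / 2 := by linarith
  rw [div_lt_iff₀ hδ] at hl
  have hl1 : 1 ≤ l := by
    by_contra h0
    rw [Nat.lt_one_iff.1 (not_le.1 h0)] at hl
    norm_num at hl
  -- For the monomial of degree `l` the criterion reads `k θ (2l+1) > (l+1)(k+2l+1)`. With this `k`
  -- it becomes `(2l+1) θ > l + 2`, which the chosen `l` ensures since `2θ > 1`.
  set k := (2 * l + 1) * (l + 1) with hk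
  have hk2 : 2 ≤ k := by rw [hk]; nlinarith
  -- Multiples of `k!` all vanish modulo a prime `p ≤ k`, while a prime `p > k` has more classes
  -- than `H` has elements; hence `H` is admissible.
  set H : Finset ℕ := (Finset.range k).image fun j => j * k.factorial with hH
  have hcard : H.card = k := by
    rw [hH, Finset.card_image_of_injective, Finset.card_range]
    intro i j hij
    exact Nat.eq_of_mul_eq_mul_right k.factorial_pos hij
  have hadm : ∀ p : ℕ, p.Prime → ∃ v, ∀ m ∈ H, ¬ p ∣ v + m := by
    intro p hp
    rcases le_or_gt p k with h | h
    · refine ⟨1, fun m hm hd => hp.one_lt.ne' ?_⟩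
      obtain ⟨j, _, rfl⟩ := Finset.mem_image.1 hm
      have h1 : p ∣ j * k.factorial := (hp.dvd_factorial.2 h).mul_left j
      exact Nat.dvd_one.1 ((Nat.dvd_add_left h1).1 hd)
    · exact exists_translate_not_dvd H p hp.pos (by rwa [hcard])
  refine lt_of_le_of_lt (liminf_primeGap_le_of_criterion H (by rwa [hcard]) hadm (k * k.factorial) ?_
    (fun i => if i = l then 1 else 0) (fun i => by split_ifs <;> norm_num) l θ (by linarith) hθ hBV
    ?_) (EReal.coe_lt_top ((k * k.factorial : ℕ) : ℝ))
  · intro m hm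
    obtain ⟨j, hj, rfl⟩ := Finset.mem_image.1 hm
    exact Nat.mul_le_mul_right _ (Finset.mem_range.1 hj).le
  · have e1 : upperConst (fun i => if i = l then 1 else 0) l k =
        (Nat.centralBinom l : ℝ) / ((2 * l + k).factorial : ℝ) := by
      rw [upperConst, Finset.sum_eq_single_of_mem l (by simp), Finset.sum_eq_single_of_mem l (by simp)]
      · simp [Nat.centralBinom, two_mul]
      · intro j _ hj; simp [hj]
      · intro i _ hi; simp [hi]
    have e2 : lowerConst (fun i => if i = l then 1 else 0) l k =
        (Nat.centralBinom (l + 1) : ℝ) / ((2 * l + k + 1).factorial : ℝ) := by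
      rw [lowerConst, Finset.sum_eq_single_of_mem l (by simp), Finset.sum_eq_single_of_mem l (by simp)]
      · simp [Nat.centralBinom, two_mul]
      · intro j _ hj; simp [hj]
      · intro i _ hi; simp [hi]
    rw [hcard, e1, e2, Nat.factorial_succ]
    have e3 : ((l : ℝ) + 1) * (Nat.centralBinom (l + 1) : ℝ) =
        2 * (2 * l + 1) * (Nat.centralBinom l : ℝ) := by
      exact_mod_cast Nat.succ_mul_centralBinom_succ l
    have e4 : (Nat.centralBinom (l + 1) : ℝ) =
        2 * (2 * l + 1) * (Nat.centralBinom l : ℝ) / (l + 1) := by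
      rw [← e3]; field_simp
    have hc0 : (0 : ℝ) < Nat.centralBinom l := by exact_mod_cast Nat.centralBinom_pos l
    have hf : (0 : ℝ) < (2 * l + k).factorial := by exact_mod_cast Nat.factorial_pos _
    rw [e4, hk]
    push_cast
    rw [← sub_pos]
    have hl0 : (0 : ℝ) ≤ l := l.cast_nonneg
    have e5 : ((2 * (l : ℝ) + 1) * (l + 1)) * (θ / 2) *
        (2 * (2 * l + 1) * (Nat.centralBinom l : ℝ) / (l + 1) /
          ((2 * l + (2 * l + 1) * (l + 1) + 1) *
            ((2 * l + (2 * l + 1) * (l + 1)).factorial : ℝ))) -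
        (Nat.centralBinom l : ℝ) / ((2 * l + (2 * l + 1) * (l + 1)).factorial : ℝ) =
        (Nat.centralBinom l : ℝ) / ((2 * l + (2 * l + 1) * (l + 1)).factorial : ℝ) *
          (((2 * l + 1) * θ - (l + 2)) / (l + 2)) := by
      have h1 : (2 * (l : ℝ) + (2 * l + 1) * (l + 1) + 1) = (2 * l + 1) * (l + 2) := by ring
      rw [h1]
      field_simp
    rw [e5]
    have h6 : 0 < (2 * (l : ℝ) + 1) * θ - (l + 2) := by nlinarith
    positivity

theorem liminf_primeGap_le_sixteen (θ : ℝ) (hθ2 : 4 * (8 - Real.sqrt 19) / 15 < θ) (hθ : θ ≤ 1)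
    (hBV : HypothesisBV θ) : liminf primeGap atTop ≤ 16 := by
  set s := Real.sqrt 19 with hs
  have hs2 : s ^ 2 = 19 := Real.sq_sqrt (by norm_num)
  have hs0 : 0 ≤ s := Real.sqrt_nonneg _
  have hs5 : s < 5 := by nlinarith
  have hadm : ∀ p : ℕ, p.Prime → ∃ v, ∀ m ∈ ({0, 4, 6, 10, 12, 16} : Finset ℕ), ¬ p ∣ v + m := by
    intro p hp
    rcases lt_or_ge 6 p with h | h
    · exact exists_translate_not_dvd _ p hp.pos (by simpa using h)
    · interval_cases p
      · exact absurd hp (by norm_num)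
      · exact absurd hp (by norm_num)
      · exact ⟨1, by decide⟩
      · exact ⟨1, by decide⟩
      · exact absurd hp (by norm_num)
      · exact ⟨2, by decide⟩
      · exact absurd hp (by norm_num)
  -- For `k = 6` and coefficients `1, b` the criterion is `θ > (b² + 8b + 28)/(b² + 9b + 24)`. For
  -- `b ≥ 0` the right side is least at the positive root `b = 4 + 2√19` of `b² - 8b - 60`, where it
  -- equals `4(8 - √19)/15`.
  refine liminf_primeGap_le_of_criterion {0, 4, 6, 10, 12, 16} (by simp) hadm 16 (by decide)
    (fun i => if i = 0 then 1 else 4 + 2 * s) (fun i => ?_) 1 θ (by linarith) hθ hBV ?_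
  · split_ifs <;> linarith
  · have hcard : ({0, 4, 6, 10, 12, 16} : Finset ℕ).card = 6 := by simp
    rw [hcard, upperConst, lowerConst]
    simp only [Finset.sum_range_succ, Finset.sum_range_zero]
    norm_num [Nat.choose, Nat.factorial]
    nlinarith

end PrimeGaps

theorem theorem2 :
    (∀ θ : ℝ, 1 / 2 < θ → θ ≤ 1 → PrimeGaps.HypothesisBV θ →
      Filter.liminf PrimeGaps.primeGap Filter.atTop < ⊤) ∧
    (∀ θ : ℝ, 4 * (8 - Real.sqrt 19) / 15 < θ → θ ≤ 1 → PrimeGaps.HypothesisBV θ →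
      Filter.liminf PrimeGaps.primeGap Filter.atTop ≤ 16) :=
  ⟨PrimeGaps.liminf_primeGap_lt_top, PrimeGaps.liminf_primeGap_le_sixteen⟩
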